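/- **Theorem 2.1.** Let $m\ge 0$ be an integer and $0<k<1$, let $F(\varphi,k)=\int_0^{\varphi}\frac{d\theta}{\sqrt{1-k^2\sin^2\theta}}$, $K=F(\pi/2,k)$, and $\operatorname{sn}(x,k)=\sin(\operatorname{am}(x,k))$, where $\operatorname{am}(\cdot,k)$ is the inverse function of $F(\cdot,k)$. Consider the Lamé operator $$L_m=-\frac{d^2}{dx^2}+m(m+1)k^2\operatorname{sn}^2(x,k)$$ in $L^2(\mathbb{R})$ with domain $H^2(\mathbb{R})$; its potential has period $2K$. The real numbers $\lambda$ for which $-\psi''+m(m+1)k^2\operatorname{sn}^2(x,k)\psi=\lambda\psi$ has a nonzero $2K$-periodic, respectively $2K$-antiperiodic, solution, each repeated according to its multiplicity (the dimension of the space of such solutions), form sequences $\lambda_0,\lambda_1,\lambda_2,\dots$, respectively $\lambda_1',\lambda_2',\lambda_3',\dots$, tending to infinity, with $$\lambda_0<\lambda_1'\le\lambda_2'<\lambda_1\le\lambda_2<\lambda_3'\le\lambda_4'<\lambda_3\le\lambda_4<\cdots .$$ For $j\ge 1$ let the $j$-th spectral gap be $G_j=(\lambda_j',\lambda_{j+1}')$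 if $j$ is odd and $G_j=(\lambda_{j-1},\lambda_j)$ if $j$ is even; it is called open if it is nonempty and closed otherwise. Then the spectrum of $L_m$ is $[\lambda_0,\infty)\setminus\bigcup_{j\ge1}G_j$, and the open gaps are precisely the first $m$ gaps: $G_j$ is open if and only if $j\le m$. Moreover, every point of coexistence, that is, every real $\lambda$ for which the equation has two linearly independent $2K$-periodic solutions or two linearly independent $2K$-antiperiodic solutions, lies in the infinite spectral band: $[\lambda,\infty)$ is contained in the spectrum of $L_m$. -/

import Mathlib

open MeasureTheory Set Filter Topology
open scoped ContDiff

namespace Lame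

noncomputable section

/-! ### The Jacobi function `sn` -/

/-- The incomplete elliptic integral of the first kind
`F(φ, k) = ∫₀^φ dθ / √(1 - k² sin² θ)`. -/
def ellipticF (k φ : ℝ) : ℝ :=
  ∫ θ in (0 : ℝ)..φ, 1 / Real.sqrt (1 - k ^ 2 * Real.sin θ ^ 2)

/-- The complete elliptic integral `K = F(π/2, k)`. -/
def ellipticK (k : ℝ) : ℝ := ellipticF k (Real.pi / 2)

/-- The Jacobi amplitude `am(x, k)`: the inverse function of `φ ↦ F(φ, k)`,
which is a bijection of `ℝ` for `0 < k < 1` (see `ellipticF_bijective`). -/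
def jacobiAm (k : ℝ) : ℝ → ℝ := Function.invFun (ellipticF k)

/-- The Jacobi elliptic function `sn(x, k) = sin (am(x, k))`. -/
def jacobiSn (k x : ℝ) : ℝ := Real.sin (jacobiAm k x)

/-- The Lamé potential `m(m+1) k² sn²(x, k)`. -/
def lamePotential (m : ℕ) (k x : ℝ) : ℝ :=
  (m : ℝ) * ((m : ℝ) + 1) * k ^ 2 * jacobiSn k x ^ 2

theorem ellipticF_radicand_pos {k : ℝ} (h0 : 0 < k) (h1 : k < 1) (θ : ℝ) :
    0 < 1 - k ^ 2 * Real.sin θ ^ 2 := by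
  have hs : Real.sin θ ^ 2 ≤ 1 := Real.sin_sq_le_one θ
  have hk : k ^ 2 < 1 := by nlinarith
  nlinarith [sq_nonneg k]

theorem ellipticF_integrand_continuous {k : ℝ} (h0 : 0 < k) (h1 : k < 1) :
    Continuous fun θ : ℝ => 1 / Real.sqrt (1 - k ^ 2 * Real.sin θ ^ 2) := by
  refine Continuous.div continuous_const (by fun_prop) fun θ => ?_
  exact (Real.sqrt_pos.2 (ellipticF_radicand_pos h0 h1 θ)).ne'

theorem ellipticF_hasDerivAt {k : ℝ} (h0 : 0 < k) (h1 : k < 1) (φ : ℝ) :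
    HasDerivAt (ellipticF k) (1 / Real.sqrt (1 - k ^ 2 * Real.sin φ ^ 2)) φ :=
  intervalIntegral.integral_hasDerivAt_right
    ((ellipticF_integrand_continuous h0 h1).intervalIntegrable _ _)
    ((ellipticF_integrand_continuous h0 h1).stronglyMeasurableAtFilter _ _)
    (ellipticF_integrand_continuous h0 h1).continuousAt

theorem ellipticF_bijective {k : ℝ} (h0 : 0 < k) (h1 : k < 1) :
    Function.Bijective (ellipticF k) := by
  have hd := ellipticF_hasDerivAt h0 h1
  have hge : ∀ φ : ℝ, 1 ≤ 1 / Real.sqrt (1 - k ^ 2 * Real.sin φ ^ 2) := fun φ => by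
    rw [le_div_iff₀ (Real.sqrt_pos.2 (ellipticF_radicand_pos h0 h1 φ)), one_mul]
    refine Real.sqrt_le_one.2 ?_
    nlinarith [mul_nonneg (sq_nonneg k) (sq_nonneg (Real.sin φ))]
  have hmono : StrictMono (ellipticF k) := by
    refine strictMono_of_deriv_pos fun φ => ?_
    rw [(hd φ).deriv]
    exact lt_of_lt_of_le one_pos (hge φ)
  have hdiff : Monotone fun φ => ellipticF k φ - φ := by
    refine monotone_of_deriv_nonneg
      (fun φ => ((hd φ).sub (hasDerivAt_id φ)).differentiableAt) fun φ => ?_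
    have := ((hd φ).sub (hasDerivAt_id φ)).deriv
    have h2 : deriv (fun φ => ellipticF k φ - φ) φ
        = 1 / Real.sqrt (1 - k ^ 2 * Real.sin φ ^ 2) - 1 := this
    rw [h2]
    linarith [hge φ]
  have hzero : ellipticF k 0 = 0 := by simp [ellipticF]
  have hcont : Continuous (ellipticF k) :=
    continuous_iff_continuousAt.2 fun φ => (hd φ).continuousAt
  refine ⟨hmono.injective, hcont.surjective ?_ ?_⟩
  · refine tendsto_atTop_mono' _ ?_ tendsto_id
    filter_upwards [eventually_ge_atTop (0 : ℝ)] with φ hφ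
    have := hdiff hφ
    simp only [hzero] at this
    simp only [id]; linarith
  · refine tendsto_atBot_mono' _ ?_ tendsto_id
    filter_upwards [eventually_le_atBot (0 : ℝ)] with φ hφ
    have := hdiff hφ
    simp only [hzero] at this
    simp only [id]; linarith

theorem ellipticF_jacobiAm {k : ℝ} (h0 : 0 < k) (h1 : k < 1) (x : ℝ) :
    ellipticF k (jacobiAm k x) = x :=
  Function.invFun_eq ((ellipticF_bijective h0 h1).2 x)

/-! ### The operator `-d²/dx² + q` in `L²(ℝ)` and its spectrum -/

/-- The complex Hilbert space `L²(ℝ)`. -/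
abbrev L2 : Type := Lp ℂ 2 (volume : Measure ℝ)

/-- `v` is the weak derivative of `u` on the real line. -/
def HasWeakDeriv (u v : L2) : Prop :=
  ∀ φ : ℝ → ℝ, ContDiff ℝ ∞ φ → HasCompactSupport φ →
    ∫ x, ((deriv φ x : ℝ) : ℂ) * u x = -∫ x, (φ x : ℂ) * v x

theorem integrable_test_mul {φ : ℝ → ℝ} (hφ : Continuous φ) (hc : HasCompactSupport φ) (u : L2) :
    Integrable fun x => (φ x : ℂ) * u x := by
  have hu : LocallyIntegrable (fun x => u x) volume :=
    (Lp.memLp u).locallyIntegrable (by norm_num)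
  have := hu.integrable_smul_left_of_hasCompactSupport hφ hc
  simpa [Complex.real_smul] using this

theorem continuous_deriv_test {φ : ℝ → ℝ} (hφ : ContDiff ℝ ∞ φ) : Continuous (deriv φ) :=
  hφ.continuous_deriv (by simp)

theorem HasWeakDeriv.zero : HasWeakDeriv 0 0 := by
  intro φ _ _
  have h0 : ∀ ψ : ℝ → ℝ, ∫ x, (ψ x : ℂ) * (0 : L2) x = 0 := fun ψ => by
    rw [integral_eq_zero_of_ae]
    filter_upwards [Lp.coeFn_zero ℂ 2 (volume : Measure ℝ)] with x _
    simp
  rw [h0, h0, neg_zero]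

theorem HasWeakDeriv.add {u v u' v' : L2} (h : HasWeakDeriv u v) (h' : HasWeakDeriv u' v') :
    HasWeakDeriv (u + u') (v + v') := by
  intro φ hφ hc
  have key : ∀ ψ : ℝ → ℝ, Continuous ψ → HasCompactSupport ψ → ∀ f g : L2,
      ∫ x, (ψ x : ℂ) * (f + g : L2) x = (∫ x, (ψ x : ℂ) * f x) + ∫ x, (ψ x : ℂ) * g x := by
    intro ψ hψ hψc f g
    rw [← integral_add (integrable_test_mul hψ hψc f) (integrable_test_mul hψ hψc g)]
    refine integral_congr_ae ?_
    filter_upwards [Lp.coeFn_add f g] with x hx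
    rw [hx, Pi.add_apply, mul_add]
  rw [key _ (continuous_deriv_test hφ) hc.deriv, key _ hφ.continuous hc, h φ hφ hc, h' φ hφ hc]
  ring

theorem HasWeakDeriv.smul {u v : L2} (c : ℂ) (h : HasWeakDeriv u v) :
    HasWeakDeriv (c • u) (c • v) := by
  intro φ hφ hc
  have key : ∀ (ψ : ℝ → ℝ) (f : L2),
      ∫ x, (ψ x : ℂ) * (c • f : L2) x = c * ∫ x, (ψ x : ℂ) * f x := by
    intro ψ f
    rw [← integral_const_mul]
    refine integral_congr_ae ?_
    filter_upwards [Lp.coeFn_smul c f] with x hx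
    rw [hx, Pi.smul_apply, smul_eq_mul]
    ring
  rw [key, key, h φ hφ hc]
  ring

/-- The graph of `-d²/dx² + q` in `L²(ℝ)`, with the derivatives taken in the weak sense: the pairs
`(u, f)` such that `u` has weak derivatives `u', u'' ∈ L²(ℝ)` and `f = -u'' + q u` almost
everywhere.  For a bounded potential `q` its domain is the Sobolev space `H²(ℝ)`. -/
def hillGraph (q : ℝ → ℝ) : Submodule ℂ (L2 × L2) where
  carrier := {p | ∃ u₁ u₂ : L2, HasWeakDeriv p.1 u₁ ∧ HasWeakDeriv u₁ u₂ ∧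
    ∀ᵐ x : ℝ, p.2 x = -u₂ x + (q x : ℂ) * p.1 x}
  zero_mem' := by
    refine ⟨0, 0, HasWeakDeriv.zero, HasWeakDeriv.zero, ?_⟩
    filter_upwards [Lp.coeFn_zero ℂ 2 (volume : Measure ℝ)] with x _
    simp
  add_mem' := by
    rintro ⟨u, f⟩ ⟨v, g⟩ ⟨u₁, u₂, h1, h2, h3⟩ ⟨v₁, v₂, k1, k2, k3⟩
    refine ⟨u₁ + v₁, u₂ + v₂, h1.add k1, h2.add k2, ?_⟩
    filter_upwards [h3, k3, Lp.coeFn_add u v, Lp.coeFn_add f g, Lp.coeFn_add u₂ v₂]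
      with x a b c d e
    simp only [Prod.mk_add_mk, c, d, e, Pi.add_apply]
    rw [a, b]
    ring
  smul_mem' := by
    rintro c ⟨u, f⟩ ⟨u₁, u₂, h1, h2, h3⟩
    refine ⟨c • u₁, c • u₂, h1.smul c, h2.smul c, ?_⟩
    filter_upwards [h3, Lp.coeFn_smul c u, Lp.coeFn_smul c f, Lp.coeFn_smul c u₂] with x a b d e
    simp only [Prod.smul_mk, b, d, e, Pi.smul_apply, smul_eq_mul]
    rw [a]
    ring

theorem HasWeakDeriv.eq_zero {v : L2} (h : HasWeakDeriv 0 v) : v = 0 := by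
  have hloc : LocallyIntegrable (fun x => v x) volume :=
    (Lp.memLp v).locallyIntegrable (by norm_num)
  have h0 : ∀ᵐ x : ℝ, v x = 0 := by
    refine ae_eq_zero_of_integral_contDiff_smul_eq_zero hloc fun φ hφ hc => ?_
    have h1 := h φ hφ hc
    have h2 : ∫ x, ((deriv φ x : ℝ) : ℂ) * (0 : L2) x = 0 := by
      rw [integral_eq_zero_of_ae]
      filter_upwards [Lp.coeFn_zero ℂ 2 (volume : Measure ℝ)] with x _
      simp
    rw [h2] at h1
    simpa [Complex.real_smul] using h1.symm
  exact (Lp.eq_zero_iff_ae_eq_zero).2 h0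

theorem hillGraph_single_valued (q : ℝ → ℝ) (p : L2 × L2) (hp : p ∈ hillGraph q)
    (h : p.1 = 0) : p.2 = 0 := by
  obtain ⟨u, f⟩ := p
  obtain ⟨u₁, u₂, h1, h2, h3⟩ := hp
  simp only at h h1 h3
  subst h
  have e1 := h1.eq_zero
  subst e1
  have e2 := h2.eq_zero
  subst e2
  refine (Lp.eq_zero_iff_ae_eq_zero).2 ?_
  filter_upwards [h3, Lp.coeFn_zero ℂ 2 (volume : Measure ℝ)] with x a _
  simp [a]

/-- The operator `-d²/dx² + q` in `L²(ℝ)`, an unbounded operator (see `hillOperator_graph`). -/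
def hillOperator (q : ℝ → ℝ) : L2 →ₗ.[ℂ] L2 := (hillGraph q).toLinearPMap

theorem hillOperator_graph (q : ℝ → ℝ) : (hillOperator q).graph = hillGraph q :=
  Submodule.toLinearPMap_graph_eq _ (hillGraph_single_valued q)

/-- The Lamé operator `L_m = -d²/dx² + m(m+1) k² sn²(x, k)` in `L²(ℝ)`. -/
def lameOperator (m : ℕ) (k : ℝ) : L2 →ₗ.[ℂ] L2 := hillOperator (lamePotential m k)

/-- The spectrum of an unbounded operator `A` in a Hilbert space: the `z ∈ ℂ` such that
`A - z : dom A → H` does not have a bounded everywhere defined two-sided inverse. -/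
def unboundedSpectrum {H : Type*} [NormedAddCommGroup H] [InnerProductSpace ℂ H]
    (A : H →ₗ.[ℂ] H) : Set ℂ :=
  {z | ¬ ∃ R : H →L[ℂ] H,
    (∀ f : H, ∃ u : A.domain, (u : H) = R f ∧ A u - z • (u : H) = f) ∧
    ∀ u : A.domain, R (A u - z • (u : H)) = u}

/-- The infinite band of a spectrum: the real points `x` with `[x, ∞) ⊆ S`. -/
def infiniteBand (S : Set ℂ) : Set ℝ := {x | ∀ y : ℝ, x ≤ y → (y : ℂ) ∈ S}

/-! ### Periodic and antiperiodic eigenvalues and the spectral gaps -/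

/-- The real vector space of classical solutions of `-ψ'' + q ψ = μ ψ` on `ℝ` with
`ψ(x + T) = s ψ(x)`; the case `s = 1` is that of `T`-periodic and the case `s = -1` that of
`T`-antiperiodic solutions. -/
def floquetSolutions (q : ℝ → ℝ) (T s μ : ℝ) : Submodule ℝ (ℝ → ℝ) where
  carrier := {ψ | Differentiable ℝ ψ ∧ Differentiable ℝ (deriv ψ) ∧
    (∀ x, -deriv (deriv ψ) x + q x * ψ x = μ * ψ x) ∧ ∀ x, ψ (x + T) = s * ψ x}
  zero_mem' := by
    have h0 : deriv (0 : ℝ → ℝ) = 0 := by ext x; simp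
    refine ⟨differentiable_const _, ?_, fun x => ?_, fun x => ?_⟩
    · rw [h0]; exact differentiable_const _
    · rw [h0, h0]; simp
    · simp
  add_mem' := by
    rintro f g ⟨f1, f2, f3, f4⟩ ⟨g1, g2, g3, g4⟩
    have h : deriv (f + g) = deriv f + deriv g := by
      ext x; exact deriv_add (f1 x) (g1 x)
    have h' : deriv (deriv f + deriv g) = deriv (deriv f) + deriv (deriv g) := by
      ext x; exact deriv_add (f2 x) (g2 x)
    refine ⟨f1.add g1, by rw [h]; exact f2.add g2, fun x => ?_, fun x => ?_⟩
    · rw [h, h']; simp only [Pi.add_apply]; linarith [f3 x, g3 x]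
    · simp only [Pi.add_apply]; rw [f4, g4]; ring
  smul_mem' := by
    rintro c f ⟨f1, f2, f3, f4⟩
    have h : deriv (c • f) = c • deriv f := by
      ext x; exact deriv_const_smul c (f1 x)
    have h' : deriv (c • deriv f) = c • deriv (deriv f) := by
      ext x; exact deriv_const_smul c (f2 x)
    refine ⟨f1.const_smul c, by rw [h]; exact f2.const_smul c, fun x => ?_, fun x => ?_⟩
    · rw [h, h']; simp only [Pi.smul_apply, smul_eq_mul]; linear_combination c * f3 x
    · simp only [Pi.smul_apply, smul_eq_mul]; rw [f4]; ring

/-- `μ` is a point of coexistence: two linearly independent `T`-periodic solutions, or two linearly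
independent `T`-antiperiodic solutions, of `-ψ'' + q ψ = μ ψ` exist. -/
def IsCoexistencePoint (q : ℝ → ℝ) (T μ : ℝ) : Prop :=
  ∃ s : ℝ, (s = 1 ∨ s = -1) ∧ ∃ ψ₁ ∈ floquetSolutions q T s μ, ∃ ψ₂ ∈ floquetSolutions q T s μ,
    LinearIndependent ℝ ![ψ₁, ψ₂]

/-- `a 0, a 1, a 2, …` (written `λ₀, λ₁, λ₂, …` in the literature) are the `T`-periodic and
`b 0, b 1, b 2, …` (written `λ'₁, λ'₂, λ'₃, …`) the `T`-antiperiodic eigenvalues of `-d²/dx² + q`,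
each listed as often as its multiplicity, going to infinity, and ordered by
`λ₀ < λ'₁ ≤ λ'₂ < λ₁ ≤ λ₂ < λ'₃ ≤ λ'₄ < λ₃ ≤ λ₄ < ⋯`.  These properties determine both
sequences. -/
structure IsHillSequence (q : ℝ → ℝ) (T : ℝ) (a b : ℕ → ℝ) : Prop where
  periodic : ∀ μ : ℝ, {n | a n = μ}.encard = (Module.finrank ℝ (floquetSolutions q T 1 μ) : ℕ∞)
  antiperiodic :
    ∀ μ : ℝ, {n | b n = μ}.encard = (Module.finrank ℝ (floquetSolutions q T (-1) μ) : ℕ∞)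
  periodic_lt_antiperiodic : ∀ n, a (2 * n) < b (2 * n)
  antiperiodic_le : ∀ n, b (2 * n) ≤ b (2 * n + 1)
  antiperiodic_lt_periodic : ∀ n, b (2 * n + 1) < a (2 * n + 1)
  periodic_le : ∀ n, a (2 * n + 1) ≤ a (2 * n + 2)
  periodic_tendsto : Tendsto a atTop atTop
  antiperiodic_tendsto : Tendsto b atTop atTop

/-- The `j`-th spectral gap, `j = 1, 2, 3, …`, counted from the left:
`(λ'₁, λ'₂), (λ₁, λ₂), (λ'₃, λ'₄), (λ₃, λ₄), …`, that is `(λ'_j, λ'_{j+1})` for odd `j` and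
`(λ_{j-1}, λ_j)` for even `j`; recall that `b i` is `λ'_{i+1}`. The gap is open if this interval
is nonempty, and closed if it is empty. -/
def spectralGap (a b : ℕ → ℝ) (j : ℕ) : Set ℝ :=
  if Odd j then Ioo (b (j - 1)) (b j) else Ioo (a (j - 1)) (a j)

end

end Lame

namespace Lame

/-! ### Scalar differential equations on the line -/

/-! The potential is even and `2K`-periodic, so the monodromy matrix over a period is determined by
the even and odd fundamental solutions `c`, `s` at the half period `K` (`reflect_cos`,
`reflect_sin`). The periodic and antiperiodic eigenvalues are therefore those of four boundary value
problems on `[0, K]`: `c' = 0`, `c = 0`, `s = 0` or `s' = 0` at `K`. In Prüfer coordinates `ψ = r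
sin θ`, `ψ' = r cos θ` each condition says that an angle at `K` is a multiple of `π/2`. The angles
at `K` are continuous and strictly increasing in the spectral parameter, and the angle of `s` lies
below that of `c` by less than `π`. This yields existence, interlacing and multiplicities at once
(`isHillSequence`): the gap number `j + 1` lies between `cosEigenvalue (j + 1)` and `sinEigenvalue
j`, and is closed exactly when these coincide.

The spectrum is the set where half the discriminant `d = c s' + c' s` at `K` satisfies `|d| ≤ 1`
(`abs_discr_le_one_iff` translates this into bands). If `|d| ≤ 1`, a bounded Bloch solution cut off
at distance `N` is a Weyl sequence. If `|d| > 1`, the decaying and growing Floquet solutions give a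
bounded self-adjoint resolvent, and a self-adjoint resolvent at one real point provides resolvents
at all nonreal points.

Gaps beyond the `m`-th are closed (`le_of_cosEigenvalue_ne_sinEigenvalue`): products of solutions
satisfy a third order equation which, in `t = sn²`, lowers the degree of polynomials of degree at
most `m`, and so has a nonzero polynomial solution `P` of degree at most `m`. At the edge
`cosEigenvalue (j + 1)` of an open gap `P(sn²)` must be a multiple of `c²`, and counting its zeros
gives `j + 1 ≤ m`.

The first `m` gaps are open (`cosEigenvalue_ne_sinEigenvalue`): a Wronskian argument with a Fredholm
alternative on polynomials shows that the relevant eigenvalues carry Lamé functions `sn^a cn^b dn^e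
P(sn²)` (`exists_lamePolynomial`). If the two edges coincided, the even and the odd Lamé function
would have a nonzero constant Wronskian equal to an odd power of `dn` times a polynomial in `sn²`,
impossible by parity of degree (`not_lamePolynomial_pair`).

A coexistence point is a closed gap, hence beyond the `m`-th, and no open gap lies to its right. -/

theorem exists_hasDerivAt_of_lipschitz_of_bounded (f : ℝ → ℝ → ℝ) (L B : NNReal)
    (hL : ∀ t, LipschitzWith L (f t)) (hc : ∀ x, Continuous fun t => f t x)
    (hB : ∀ t x, ‖f t x‖ ≤ B) (x₀ : ℝ) :
    ∃ θ : ℝ → ℝ, θ 0 = x₀ ∧ ∀ t, HasDerivAt θ (f t (θ t)) t := by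
  have hex : ∀ n : ℕ, ∃ θ : ℝ → ℝ, θ 0 = x₀ ∧
      ∀ t ∈ Icc (-(n + 1 : ℝ)) (n + 1), HasDerivWithinAt θ (f t (θ t)) (Icc (-(n + 1 : ℝ)) (n + 1)) t := by
    intro n
    have hn : (0 : ℝ) ≤ n + 1 := by positivity
    -- A field bounded by `B` cannot leave the ball of radius `B * (n + 1)` within time `n + 1`, so
    -- the local theorem covers the whole interval.
    have hP : IsPicardLindelof f (tmin := -(n + 1 : ℝ)) (tmax := n + 1)
        ⟨0, by constructor <;> linarith⟩ x₀ (B * (n + 1)) 0 B L :=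
      { lipschitzOnWith := fun t _ => (hL t).lipschitzOnWith
        continuousOn := fun x _ => (hc x).continuousOn
        norm_le := fun t _ x _ => hB t x
        mul_max_le := by simp }
    obtain ⟨α, h0, h1⟩ := hP.exists_eq_forall_mem_Icc_hasDerivWithinAt₀
    exact ⟨α, h0, h1⟩
  choose θ h0 h1 using hex
  have hd : ∀ n : ℕ, ∀ t ∈ Ioo (-(n + 1 : ℝ)) (n + 1), HasDerivAt (θ n) (f t (θ n t)) t :=
    fun n t ht => (h1 n t (Ioo_subset_Icc_self ht)).hasDerivAt (Icc_mem_nhds ht.1 ht.2)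
  have heq : ∀ m n : ℕ, m ≤ n → EqOn (θ m) (θ n) (Icc (-(m + 1 : ℝ)) (m + 1)) := by
    intro m n hmn
    have hmn' : (m : ℝ) ≤ n := by exact_mod_cast hmn
    have hm : (0 : ℝ) < m + 1 := by positivity
    have hsub : Icc (-(m + 1 : ℝ)) (m + 1) ⊆ Icc (-(n + 1 : ℝ)) (n + 1) :=
      Icc_subset_Icc (by linarith) (by linarith)
    have hsub' : Ioo (-(m + 1 : ℝ)) (m + 1) ⊆ Ioo (-(n + 1 : ℝ)) (n + 1) :=
      Ioo_subset_Ioo (by linarith) (by linarith)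
    exact ODE_solution_unique_of_mem_Icc (v := f) (s := fun _ => univ) (K := L) (t₀ := 0)
      (fun t _ => (hL t).lipschitzOnWith) ⟨by linarith, hm⟩
      (fun t ht => (h1 m t ht).continuousWithinAt) (fun t ht => hd m t ht) (fun _ _ => mem_univ _)
      (fun t ht => ((h1 n t (hsub ht)).continuousWithinAt).mono hsub)
      (fun t ht => hd n t (hsub' ht)) (fun _ _ => mem_univ _) (by rw [h0, h0])
  refine ⟨fun t => θ ⌈|t|⌉₊ t, by simp [h0], fun t => ?_⟩
  -- One more than the ceiling, so that `|s| < N` holds on a neighbourhood of `t`; there the patched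
  -- function is `θ N`.
  set N := ⌈|t|⌉₊ + 1 with hN
  have htN : |t| < N := by
    have := Nat.le_ceil |t|
    push_cast [hN]; linarith
  have hev : (fun t => θ ⌈|t|⌉₊ t) =ᶠ[𝓝 t] θ N := by
    have : ∀ᶠ s : ℝ in 𝓝 t, |s| < (N : ℝ) := (continuous_abs.tendsto t).eventually (gt_mem_nhds htN)
    filter_upwards [this] with s hs
    have hle : ⌈|s|⌉₊ ≤ N := Nat.ceil_le.2 hs.le
    refine heq _ _ hle ?_
    have := Nat.le_ceil |s|
    rw [abs_le] at this
    constructor <;> linarith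
  have hdt := hd N t ⟨by have := (abs_lt.1 htN).1; linarith, by have := (abs_lt.1 htN).2; linarith⟩
  have := hdt.congr_of_eventuallyEq hev
  rwa [← hev.eq_of_nhds] at this

/-- The integrating factor `exp (-∫ h)` removes the linear term and leaves only the nonnegative
source. All comparison results for Prüfer angles come from this. -/
theorem monotone_mul_exp_of_linear {D h g : ℝ → ℝ} (hh : Continuous h) (hg : ∀ x, 0 ≤ g x)
    (hD : ∀ x, HasDerivAt D (h x * D x + g x) x) :
    ∃ E : ℝ → ℝ, (∀ x, 0 < E x) ∧ (∀ x, HasDerivAt (fun x => D x * E x) (g x * E x) x) ∧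
      Monotone fun x => D x * E x := by
  have hH : ∀ x, HasDerivAt (fun x => Real.exp (-∫ y in (0 : ℝ)..x, h y))
      (Real.exp (-∫ y in (0 : ℝ)..x, h y) * (-h x)) x := fun x =>
    ((intervalIntegral.integral_hasDerivAt_right (hh.intervalIntegrable _ _)
      (hh.stronglyMeasurableAtFilter _ _) hh.continuousAt).neg).exp
  have hprod : ∀ x, HasDerivAt (fun x => D x * Real.exp (-∫ y in (0 : ℝ)..x, h y))
      (g x * Real.exp (-∫ y in (0 : ℝ)..x, h y)) x := fun x => by
    convert! (hD x).mul (hH x) using 1; ring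
  refine ⟨_, fun x => Real.exp_pos _, hprod, ?_⟩
  refine monotone_of_deriv_nonneg (fun x => (hprod x).differentiableAt) fun x => ?_
  rw [(hprod x).deriv]
  exact mul_nonneg (hg x) (Real.exp_pos _).le

theorem nonneg_of_linear {D h g : ℝ → ℝ} (hh : Continuous h) (hg : ∀ x, 0 ≤ g x)
    (hD : ∀ x, HasDerivAt D (h x * D x + g x) x) {a b : ℝ} (hab : a ≤ b) (ha : 0 ≤ D a) :
    0 ≤ D b := by
  obtain ⟨E, hE, _, hm⟩ := monotone_mul_exp_of_linear hh hg hD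
  have h1 : D a * E a ≤ D b * E b := hm hab
  have h2 := mul_nonneg ha (hE a).le
  exact nonneg_of_mul_nonneg_left (h2.trans h1) (hE b)

theorem pos_of_linear {D h g : ℝ → ℝ} (hh : Continuous h) (hg : ∀ x, 0 ≤ g x)
    (hD : ∀ x, HasDerivAt D (h x * D x + g x) x) {a b : ℝ} (hab : a ≤ b) (ha : 0 < D a) :
    0 < D b := by
  obtain ⟨E, hE, _, hm⟩ := monotone_mul_exp_of_linear hh hg hD
  have h1 : D a * E a ≤ D b * E b := hm hab
  have h2 := mul_pos ha (hE a)
  exact pos_of_mul_pos_left (h2.trans_le h1) (hE b).le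

/-- The rigid case of the comparison: a monotone function going from nonnegative to nonpositive is
constantly zero in between, so its derivative, the weighted source, vanishes too. Strict
inequalities are proved by contradicting this. -/
theorem eq_zero_of_linear {D h g : ℝ → ℝ} (hh : Continuous h) (hg : ∀ x, 0 ≤ g x)
    (hD : ∀ x, HasDerivAt D (h x * D x + g x) x) {a b : ℝ} (ha : 0 ≤ D a) (hb : D b ≤ 0) :
    ∀ x ∈ Ioo a b, D x = 0 ∧ g x = 0 := by
  obtain ⟨E, hE, hd, hm⟩ := monotone_mul_exp_of_linear hh hg hD
  have hz : ∀ x ∈ Ioo a b, D x * E x = 0 := fun x hx => by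
    have h1 : D a * E a ≤ D x * E x := hm hx.1.le
    have h2 : D x * E x ≤ D b * E b := hm hx.2.le
    have h3 := mul_nonneg ha (hE a).le
    have h4 := mul_nonpos_of_nonpos_of_nonneg hb (hE b).le
    linarith
  intro x hx
  refine ⟨(mul_eq_zero.1 (hz x hx)).resolve_right (hE x).ne', ?_⟩
  have hev : (fun x => D x * E x) =ᶠ[𝓝 x] fun _ => 0 := by
    filter_upwards [Ioo_mem_nhds hx.1 hx.2] with y hy using hz y hy
  have := (hd x).unique ((hasDerivAt_const x (0 : ℝ)).congr_of_eventuallyEq hev)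
  exact (mul_eq_zero.1 this).resolve_right (hE x).ne'

theorem sin_eq_mul_sinc (x : ℝ) : Real.sin x = x * Real.sinc x := by
  by_cases h : x = 0
  · simp [h]
  · rw [Real.sinc_of_ne_zero h]; field_simp

/-- Makes the difference of two Prüfer angles solve a linear equation; `sinc` keeps the coefficient
continuous where the angles meet. -/
theorem sin_sq_sub_sin_sq (a b : ℝ) :
    Real.sin a ^ 2 - Real.sin b ^ 2 = Real.sinc (a - b) * Real.sin (a + b) * (a - b) := by
  have : Real.sin a ^ 2 - Real.sin b ^ 2 = Real.sin (a - b) * Real.sin (a + b) := by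
    rw [Real.sin_sub, Real.sin_add]
    nlinarith [Real.sin_sq_add_cos_sq a, Real.sin_sq_add_cos_sq b]
  rw [this, sin_eq_mul_sinc (a - b)]; ring

/-! ### Prüfer angles -/

/-- An even, smooth, nonnegative potential of period `2 * K`, bounded by `Q`. -/
structure IsEvenPotential (q : ℝ → ℝ) (K Q : ℝ) : Prop where
  K_pos : 0 < K
  smooth : ContDiff ℝ ∞ q
  even : ∀ x, q (-x) = q x
  periodic : ∀ x, q (x + 2 * K) = q x
  nonneg : ∀ x, 0 ≤ q x
  le : ∀ x, q x ≤ Q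

/-- `θ` is a Prüfer angle of `-ψ'' + q ψ = l ψ`. -/
def IsPruferAngle (q : ℝ → ℝ) (l : ℝ) (θ : ℝ → ℝ) : Prop :=
  ∀ x, HasDerivAt θ (1 + (l - q x - 1) * Real.sin (θ x) ^ 2) x

/-- As `q` is bounded, the right hand side is bounded and Lipschitz in the angle uniformly in `x`,
so the solution is global. -/
theorem IsEvenPotential.exists_pruferAngle {q : ℝ → ℝ} {K Q : ℝ} (hq : IsEvenPotential q K Q)
    (l θ₀ : ℝ) : ∃ θ : ℝ → ℝ, θ 0 = θ₀ ∧ IsPruferAngle q l θ := by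
  have hQ : 0 ≤ Q := (hq.nonneg 0).trans (hq.le 0)
  have hb : ∀ t, |l - q t - 1| ≤ |l| + Q + 1 := fun t => by
    have h1 := hq.nonneg t
    have h2 := hq.le t
    have h3 := neg_abs_le l
    have h4 := le_abs_self l
    rw [abs_le]; constructor <;> linarith
  have hqc := hq.smooth.continuous
  refine exists_hasDerivAt_of_lipschitz_of_bounded
    (fun t θ => 1 + (l - q t - 1) * Real.sin θ ^ 2) (Real.toNNReal (|l| + Q + 1))
    (Real.toNNReal (1 + (|l| + Q + 1))) (fun t => ?_) (fun x => by fun_prop) (fun t x => ?_) θ₀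
  · refine LipschitzWith.of_dist_le_mul fun a b => ?_
    rw [Real.dist_eq, Real.dist_eq]
    have : 1 + (l - q t - 1) * Real.sin a ^ 2 - (1 + (l - q t - 1) * Real.sin b ^ 2) =
        (l - q t - 1) * (Real.sinc (a - b) * Real.sin (a + b)) * (a - b) := by
      have := sin_sq_sub_sin_sq a b
      linear_combination (l - q t - 1) * this
    rw [this, abs_mul, abs_mul, abs_mul, Real.coe_toNNReal _ (by positivity)]
    refine mul_le_mul_of_nonneg_right ?_ (abs_nonneg _)
    have h1 := Real.abs_sinc_le_one (a - b)
    have h2 := Real.abs_sin_le_one (a + b)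
    have h3 := hb t
    have h4 : |Real.sinc (a - b)| * |Real.sin (a + b)| ≤ 1 :=
      mul_le_one₀ h1 (abs_nonneg _) h2
    calc _ ≤ |l - q t - 1| * 1 := mul_le_mul_of_nonneg_left h4 (abs_nonneg _)
      _ ≤ _ := by rw [mul_one]; exact h3
  · rw [Real.norm_eq_abs]
    refine (abs_add_le _ _).trans ?_
    rw [abs_one, abs_mul]
    have h1 : |Real.sin x ^ 2| ≤ 1 := by
      rw [abs_of_nonneg (sq_nonneg _)]; exact Real.sin_sq_le_one x
    have := mul_le_mul (hb t) h1 (abs_nonneg _) (by positivity)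
    rw [Real.coe_toNNReal _ (by positivity)]
    linarith

namespace IsPruferAngle

variable {q : ℝ → ℝ} {l m : ℝ} {θ φ : ℝ → ℝ}

theorem continuous (h : IsPruferAngle q l θ) : Continuous θ :=
  continuous_iff_continuousAt.2 fun x => (h x).continuousAt

theorem add_pi (h : IsPruferAngle q l θ) : IsPruferAngle q l fun x => θ x + Real.pi := fun x => by
  have := (h x).add_const Real.pi
  simpa [Real.sin_add_pi] using this

theorem hasDerivAt_sub (h : IsPruferAngle q l θ) (h' : IsPruferAngle q m φ) (x : ℝ) :
    HasDerivAt (fun x => φ x - θ x)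
      (((m - q x - 1) * (Real.sinc (φ x - θ x) * Real.sin (φ x + θ x))) * (φ x - θ x) +
        (m - l) * Real.sin (θ x) ^ 2) x := by
  convert! (h' x).sub (h x) using 1
  have := sin_sq_sub_sin_sq (φ x) (θ x)
  linear_combination -(m - q x - 1) * this

theorem continuous_coeff (hq : Continuous q) (h : IsPruferAngle q l θ) (h' : IsPruferAngle q m φ) :
    Continuous fun x =>
      (m - q x - 1) * (Real.sinc (φ x - θ x) * Real.sin (φ x + θ x)) := by
  have := h.continuous
  have := h'.continuous
  have := Real.continuous_sinc
  fun_prop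

theorem le_of_le (hq : Continuous q) (h : IsPruferAngle q l θ) (h' : IsPruferAngle q m φ)
    (hlm : l ≤ m) {a b : ℝ} (hab : a ≤ b) (ha : θ a ≤ φ a) : θ b ≤ φ b := by
  have := nonneg_of_linear (h.continuous_coeff hq h')
    (fun x => mul_nonneg (sub_nonneg.2 hlm) (sq_nonneg (Real.sin (θ x)))) (h.hasDerivAt_sub h') hab
    (sub_nonneg.2 ha)
  linarith

theorem lt_of_lt (hq : Continuous q) (h : IsPruferAngle q l θ) (h' : IsPruferAngle q m φ)
    (hlm : l ≤ m) {a b : ℝ} (hab : a ≤ b) (ha : θ a < φ a) : θ b < φ b := by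
  have := pos_of_linear (h.continuous_coeff hq h')
    (fun x => mul_nonneg (sub_nonneg.2 hlm) (sq_nonneg (Real.sin (θ x)))) (h.hasDerivAt_sub h') hab
    (sub_pos.2 ha)
  linarith

/-- Strict Sturm comparison. If strictness failed, the source `(m - l) sin² θ` would vanish on an
interval; but where `sin θ = 0` the angle moves with speed `1`, so this cannot persist. -/
theorem lt_of_param_lt (hq : Continuous q) (h : IsPruferAngle q l θ) (h' : IsPruferAngle q m φ)
    (hlm : l < m) {a b : ℝ} (hab : a < b) (ha : θ a ≤ φ a) : θ b < φ b := by
  by_contra hcon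
  have hz := eq_zero_of_linear (h.continuous_coeff hq h')
    (fun x => mul_nonneg (sub_nonneg.2 hlm.le) (sq_nonneg (Real.sin (θ x)))) (h.hasDerivAt_sub h')
    (sub_nonneg.2 ha) (sub_nonpos.2 (not_lt.1 hcon))
  have hs : ∀ x ∈ Ioo a b, Real.sin (θ x) = 0 := fun x hx => by
    have := (mul_eq_zero.1 (hz x hx).2).resolve_left (sub_pos.2 hlm).ne'
    exact pow_eq_zero_iff (two_ne_zero) |>.1 this
  obtain ⟨x, hx⟩ := nonempty_Ioo.2 hab
  have hd := (h x).sin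
  have hev : (fun x => Real.sin (θ x)) =ᶠ[𝓝 x] fun _ => 0 := by
    filter_upwards [Ioo_mem_nhds hx.1 hx.2] with y hy using hs y hy
  have h1 := hd.unique ((hasDerivAt_const x (0 : ℝ)).congr_of_eventuallyEq hev)
  have h2 := Real.sin_sq_add_cos_sq (θ x)
  rw [hs x hx] at h1 h2
  simp only [ne_eq, OfNat.ofNat_ne_zero, not_false_eq_true, zero_pow, mul_zero, add_zero,
    mul_one, zero_add] at h1 h2
  rw [h1] at h2
  norm_num at h2

/-- A Prüfer angle crosses the zeros of the sine upwards only. -/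
theorem lt_of_level (hq : Continuous q) (h : IsPruferAngle q l θ) {c a b : ℝ}
    (hc : Real.sin c = 0) (hab : a < b) (ha : c ≤ θ a) : c < θ b := by
  by_contra hcon
  have hθ := h.continuous
  have hcos : Real.cos c ^ 2 = 1 := by
    have := Real.sin_sq_add_cos_sq c
    rw [hc] at this; linarith
  -- The source is `cos² (θ - c)`, equal to `1` wherever `θ = c`, so `θ - c` cannot vanish on an
  -- interval.
  have hD : ∀ x, HasDerivAt (fun x => θ x - c)
      (((l - q x) * (Real.sin (θ x - c) * Real.sinc (θ x - c))) * (θ x - c) +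
        Real.cos (θ x - c) ^ 2) x := fun x => by
    convert! (h x).sub_const c using 1
    have h1 : Real.sin (θ x - c) ^ 2 = Real.sin (θ x) ^ 2 := by
      rw [Real.sin_sub, hc]
      linear_combination Real.sin (θ x) ^ 2 * hcos
    have h2 := sin_eq_mul_sinc (θ x - c)
    have h3 := Real.sin_sq_add_cos_sq (θ x - c)
    linear_combination -(l - q x) * Real.sin (θ x - c) * h2 + h3 + (l - q x - 1) * h1
  have hcont : Continuous fun x => (l - q x) * (Real.sin (θ x - c) * Real.sinc (θ x - c)) := by
    have := Real.continuous_sinc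
    fun_prop
  have hz := eq_zero_of_linear hcont (fun x => sq_nonneg _) hD (sub_nonneg.2 ha)
    (sub_nonpos.2 (not_lt.1 hcon))
  obtain ⟨x, hx⟩ := nonempty_Ioo.2 hab
  obtain ⟨h1, h2⟩ := hz x hx
  rw [h1] at h2
  simp at h2

/-- At the level `π/2` the speed of the angle is `l - q ≤ 0`, so it is not crossed upwards. This
supplies the lower end for the intermediate value argument. -/
theorem le_pi_div_two (h : IsPruferAngle q l θ) (hl : ∀ x, l ≤ q x) {a b : ℝ}
    (hab : a ≤ b) (ha : θ a ≤ Real.pi / 2) : θ b ≤ Real.pi / 2 := by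
  have hθ := h.continuous
  have hD : ∀ x, HasDerivAt (fun x => Real.pi / 2 - θ x)
      ((-(Real.sin (Real.pi / 2 - θ x) * Real.sinc (Real.pi / 2 - θ x))) * (Real.pi / 2 - θ x) +
        (q x - l) * Real.cos (Real.pi / 2 - θ x) ^ 2) x := fun x => by
    convert! (h x).const_sub (Real.pi / 2) using 1
    have h2 := sin_eq_mul_sinc (Real.pi / 2 - θ x)
    have h4 : Real.cos (Real.pi / 2 - θ x) = Real.sin (θ x) := Real.cos_pi_div_two_sub _
    have h3 := Real.sin_sq_add_cos_sq (Real.pi / 2 - θ x)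
    rw [h4] at *
    linear_combination Real.sin (Real.pi / 2 - θ x) * h2 - h3
  have hcont : Continuous fun x =>
      -(Real.sin (Real.pi / 2 - θ x) * Real.sinc (Real.pi / 2 - θ x)) := by
    have := Real.continuous_sinc
    fun_prop
  have := nonneg_of_linear hcont
    (fun x => mul_nonneg (sub_nonneg.2 (hl x)) (sq_nonneg _)) hD hab (sub_nonneg.2 ha)
  linarith

/-- A Grönwall estimate with rate `|m| + Q + 1`, a bound for `m - q - 1`. It makes the angle at `K`
locally Lipschitz in the spectral parameter. -/
theorem sub_le_mul_exp {K Q : ℝ} (hq : IsEvenPotential q K Q) (h : IsPruferAngle q l θ)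
    (h' : IsPruferAngle q m φ) (hlm : l ≤ m) (h0 : θ 0 = φ 0) :
    φ K - θ K ≤ (m - l) * K * Real.exp ((|m| + Q + 1) * K) := by
  set C := |m| + Q + 1 with hC
  have hQ : 0 ≤ Q := (hq.nonneg 0).trans (hq.le 0)
  have hC0 : 0 ≤ C := by positivity
  have hd : ∀ x, HasDerivAt (fun x => (φ x - θ x) * Real.exp (-C * x) - (m - l) * x)
      (((((m - q x - 1) * (Real.sinc (φ x - θ x) * Real.sin (φ x + θ x))) * (φ x - θ x) +
        (m - l) * Real.sin (θ x) ^ 2) * Real.exp (-C * x) +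
        (φ x - θ x) * (Real.exp (-C * x) * (-C * 1))) - (m - l) * 1) x := fun x =>
    ((h.hasDerivAt_sub h' x).mul (((hasDerivAt_id x).const_mul (-C)).exp)).sub
      ((hasDerivAt_id x).const_mul (m - l))
  have hanti : AntitoneOn (fun x => (φ x - θ x) * Real.exp (-C * x) - (m - l) * x) (Ici 0) := by
    refine antitoneOn_of_deriv_nonpos (convex_Ici 0)
      (fun x _ => (hd x).continuousAt.continuousWithinAt)
      (fun x _ => (hd x).differentiableAt.differentiableWithinAt) fun x hx => ?_
    rw [interior_Ici, mem_Ioi] at hx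
    rw [(hd x).deriv]
    have hD : 0 ≤ φ x - θ x :=
      sub_nonneg.2 (h.le_of_le hq.smooth.continuous h' hlm hx.le h0.le)
    have he : Real.exp (-C * x) ≤ 1 := Real.exp_le_one_iff.2 (by nlinarith)
    have he0 := Real.exp_pos (-C * x)
    have hb : (m - q x - 1) * (Real.sinc (φ x - θ x) * Real.sin (φ x + θ x)) ≤ C := by
      have h1 := Real.abs_sinc_le_one (φ x - θ x)
      have h2 := Real.abs_sin_le_one (φ x + θ x)
      have h3 : |m - q x - 1| ≤ C := by
        have := hq.nonneg x
        have := hq.le x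
        have := neg_abs_le m
        have := le_abs_self m
        rw [abs_le]; constructor <;> linarith
      refine (le_abs_self _).trans ?_
      rw [abs_mul, abs_mul]
      have h4 : |Real.sinc (φ x - θ x)| * |Real.sin (φ x + θ x)| ≤ 1 :=
        mul_le_one₀ h1 (abs_nonneg _) h2
      calc _ ≤ |m - q x - 1| * 1 := mul_le_mul_of_nonneg_left h4 (abs_nonneg _)
        _ ≤ C := by rw [mul_one]; exact h3
    have hs := Real.sin_sq_le_one (θ x)
    have hml := sub_nonneg.2 hlm
    have e1 := mul_le_mul_of_nonneg_right (mul_le_mul_of_nonneg_right hb hD) he0.le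
    have e2 : (m - l) * Real.sin (θ x) ^ 2 * Real.exp (-C * x) ≤ (m - l) * 1 * 1 :=
      mul_le_mul (mul_le_mul_of_nonneg_left hs hml) he he0.le (by linarith)
    nlinarith
  have := hanti (mem_Ici.2 le_rfl) (mem_Ici.2 hq.K_pos.le) hq.K_pos.le
  simp only [h0, sub_self, zero_mul, mul_zero] at this
  have h2 : (φ K - θ K) * Real.exp (-C * K) ≤ (m - l) * K := by linarith
  have h3 := mul_le_mul_of_nonneg_right h2 (Real.exp_pos (C * K)).le
  rwa [mul_assoc, ← Real.exp_add, show -C * K + C * K = 0 by ring, Real.exp_zero, mul_one] at h3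

/-- Prüfer angles grow at least like `w x` when `l - q ≥ w ^ 2`. -/
theorem growth (h : IsPruferAngle q l θ) {w : ℝ} (hw : 0 < w) (hl : ∀ x, w ^ 2 ≤ l - q x)
    {b : ℝ} (hb : 0 ≤ b) (h0 : 0 ≤ θ 0) (h0' : Real.sin (θ 0) * Real.cos (θ 0) = 0) :
    w * b - Real.pi / 2 ≤ θ b := by
  have hpos : ∀ y : ℝ, 0 < Real.cos y ^ 2 + w * Real.sin y ^ 2 := fun y => by
    have h1 := Real.sin_sq_add_cos_sq y
    rcases (sq_nonneg (Real.sin y)).eq_or_lt with h | h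
    · rw [← h]; rw [← h] at h1; linarith
    · have := mul_pos hw h
      have := sq_nonneg (Real.cos y)
      linarith
  have hpos2 : ∀ y : ℝ, 0 < Real.cos y ^ 2 + w ^ 2 * Real.sin y ^ 2 := fun y => by
    have h1 := Real.sin_sq_add_cos_sq y
    rcases (sq_nonneg (Real.sin y)).eq_or_lt with h | h
    · rw [← h]; rw [← h] at h1; linarith
    · have := mul_pos (pow_pos hw 2) h
      have := sq_nonneg (Real.cos y)
      linarith
  -- `Φ` is the continuous branch of `arctan (w tan y)`, the angle after rescaling `ψ` by `w`; it
  -- moves at least at speed `w`. Since `Φ y - y` is an arctangent, it costs less than `π/2`, and it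
  -- vanishes at the initial angle because `sin * cos = 0` there.
  let A : ℝ → ℝ := fun y =>
    (w - 1) * (Real.sin y * Real.cos y) / (Real.cos y ^ 2 + w * Real.sin y ^ 2)
  let Φ : ℝ → ℝ := fun y => y + Real.arctan (A y)
  have hΦ : ∀ y, HasDerivAt Φ (w / (Real.cos y ^ 2 + w ^ 2 * Real.sin y ^ 2)) y := fun y => by
    have hs := Real.hasDerivAt_sin y
    have hc := Real.hasDerivAt_cos y
    have hA := (((hs.fun_mul hc).const_mul (w - 1)).fun_div
      ((hc.fun_pow 2).fun_add ((hs.fun_pow 2).const_mul w)) (hpos y).ne')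
    convert! (hasDerivAt_id y).fun_add hA.arctan using 1
    have h1 := Real.sin_sq_add_cos_sq y
    have p1 := (hpos y).ne'
    have p2 := (hpos2 y).ne'
    generalize Real.sin y = S at *
    generalize Real.cos y = C at *
    have key : 1 + ((w - 1) * (S * C) / (C ^ 2 + w * S ^ 2)) ^ 2 =
        (C ^ 2 + w ^ 2 * S ^ 2) / (C ^ 2 + w * S ^ 2) ^ 2 := by
      field_simp
      linear_combination (C ^ 2 + w ^ 2 * S ^ 2) * h1
    have num : (w - 1) * (C * C + S * -S) * (C ^ 2 + w * S ^ 2) -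
        (w - 1) * (S * C) * (((2 : ℕ) : ℝ) * C ^ (2 - 1) * -S +
          w * (((2 : ℕ) : ℝ) * S ^ (2 - 1) * C)) = (w - 1) * (C ^ 2 - w * S ^ 2) := by
      push_cast
      linear_combination (w - 1) * (C ^ 2 - w * S ^ 2) * h1
    rw [key, num]
    field_simp
    linear_combination -w * h1
  have hder : ∀ x, HasDerivAt (fun x => Φ (θ x) - w * x)
      (w / (Real.cos (θ x) ^ 2 + w ^ 2 * Real.sin (θ x) ^ 2) *
        (1 + (l - q x - 1) * Real.sin (θ x) ^ 2) - w * 1) x := fun x =>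
    ((hΦ (θ x)).comp x (h x)).sub ((hasDerivAt_id x).const_mul w)
  have hmono : Monotone fun x => Φ (θ x) - w * x := by
    refine monotone_of_deriv_nonneg (fun x => (hder x).differentiableAt) fun x => ?_
    rw [(hder x).deriv]
    have h1 : Real.cos (θ x) ^ 2 + w ^ 2 * Real.sin (θ x) ^ 2 ≤
        1 + (l - q x - 1) * Real.sin (θ x) ^ 2 := by
      have := Real.sin_sq_add_cos_sq (θ x)
      nlinarith [mul_le_mul_of_nonneg_right (hl x) (sq_nonneg (Real.sin (θ x)))]
    have h2 : w ≤ w / (Real.cos (θ x) ^ 2 + w ^ 2 * Real.sin (θ x) ^ 2) *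
        (1 + (l - q x - 1) * Real.sin (θ x) ^ 2) := by
      rw [div_mul_eq_mul_div, le_div_iff₀ (hpos2 _)]
      exact mul_le_mul_of_nonneg_left h1 hw.le
    linarith
  have h1 : Φ (θ 0) - w * 0 ≤ Φ (θ b) - w * b := hmono hb
  have h2 : Φ (θ 0) = θ 0 := by
    simp [Φ, A, h0']
  have h3 : Φ (θ b) < θ b + Real.pi / 2 := by
    have := Real.arctan_lt_pi_div_two (A (θ b))
    simp only [Φ]; linarith
  linarith

end IsPruferAngle
end Lame

namespace Lame

/-! ### Fundamental solutions -/

/-- `f` is a solution of `-ψ'' + q ψ = l ψ` with derivative `f'`. -/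
structure IsSol (q : ℝ → ℝ) (l : ℝ) (f f' : ℝ → ℝ) : Prop where
  deriv : ∀ x, HasDerivAt f (f' x) x
  deriv' : ∀ x, HasDerivAt f' ((q x - l) * f x) x

/-- `c` and `s` are the fundamental solutions of `-ψ'' + q ψ = l ψ` at the origin. -/
structure IsFundamental (q : ℝ → ℝ) (l : ℝ) (c c' s s' : ℝ → ℝ) : Prop where
  cos : IsSol q l c c'
  sin : IsSol q l s s'
  cos_zero : c 0 = 1
  cos_zero' : c' 0 = 0
  sin_zero : s 0 = 0
  sin_zero' : s' 0 = 1

namespace IsSol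

variable {q : ℝ → ℝ} {l : ℝ} {f f' g g' : ℝ → ℝ}

theorem wronskian_eq (hf : IsSol q l f f') (hg : IsSol q l g g') (x : ℝ) :
    f x * g' x - f' x * g x = f 0 * g' 0 - f' 0 * g 0 := by
  have h : ∀ x, HasDerivAt (fun x => f x * g' x - f' x * g x) 0 x := fun x => by
    convert! ((hf.deriv x).mul (hg.deriv' x)).sub ((hf.deriv' x).mul (hg.deriv x)) using 1
    ring
  exact is_const_of_deriv_eq_zero (fun x => (h x).differentiableAt) (fun x => (h x).deriv) x 0

theorem comp_neg (hf : IsSol q l f f') (hq : ∀ x, q (-x) = q x) :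
    IsSol q l (fun x => f (-x)) fun x => -f' (-x) where
  deriv x := by
    convert! (hf.deriv (-x)).comp x (hasDerivAt_neg x) using 1; ring
  deriv' x := by
    convert! ((hf.deriv' (-x)).comp x (hasDerivAt_neg x)).neg using 1; rw [hq]; ring

theorem comp_add (hf : IsSol q l f f') {T : ℝ} (hq : ∀ x, q (x + T) = q x) :
    IsSol q l (fun x => f (x + T)) fun x => f' (x + T) where
  deriv x := (hf.deriv (x + T)).comp_add_const x T
  deriv' x := by
    convert! (hf.deriv' (x + T)).comp_add_const x T using 1; rw [hq]

theorem lincomb (hf : IsSol q l f f') (hg : IsSol q l g g') (a b : ℝ) :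
    IsSol q l (fun x => a * f x + b * g x) fun x => a * f' x + b * g' x where
  deriv x := ((hf.deriv x).const_mul a).add ((hg.deriv x).const_mul b)
  deriv' x := by
    convert! ((hf.deriv' x).const_mul a).add ((hg.deriv' x).const_mul b) using 1; ring

theorem deriv_eq (hf : IsSol q l f f') : _root_.deriv f = f' := funext fun x => (hf.deriv x).deriv

theorem continuous (hf : IsSol q l f f') : Continuous f :=
  continuous_iff_continuousAt.2 fun x => (hf.deriv x).continuousAt

theorem continuous' (hf : IsSol q l f f') : Continuous f' :=
  continuous_iff_continuousAt.2 fun x => (hf.deriv' x).continuousAt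

theorem mem_floquetSolutions (hf : IsSol q l f f') {T s : ℝ} (h : ∀ x, f (x + T) = s * f x) :
    f ∈ floquetSolutions q T s l := by
  refine ⟨fun x => (hf.deriv x).differentiableAt, ?_, fun x => ?_, h⟩
  · rw [hf.deriv_eq]; exact fun x => (hf.deriv' x).differentiableAt
  · rw [hf.deriv_eq, (hf.deriv' x).deriv]; ring

theorem of_mem_floquetSolutions {T s : ℝ} (h : f ∈ floquetSolutions q T s l) :
    IsSol q l f (_root_.deriv f) where
  deriv x := (h.1 x).hasDerivAt
  deriv' x := by
    convert! (h.2.1 x).hasDerivAt using 1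
    linarith [h.2.2.1 x]

end IsSol

namespace IsFundamental

variable {q : ℝ → ℝ} {K Q l : ℝ} {c c' s s' f f' : ℝ → ℝ}

theorem wronskian (F : IsFundamental q l c c' s s') (x : ℝ) : c x * s' x - c' x * s x = 1 := by
  rw [F.cos.wronskian_eq F.sin, F.cos_zero, F.cos_zero', F.sin_zero, F.sin_zero']; ring

/-- Cramer's rule: the coefficients are the constant Wronskians with `c` and `s`, so no uniqueness
theorem for the equation is needed. -/
theorem eq_lincomb (F : IsFundamental q l c c' s s') (hf : IsSol q l f f') (x : ℝ) :
    f x = f 0 * c x + f' 0 * s x := by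
  have h1 := F.cos.wronskian_eq hf x
  have h2 := F.sin.wronskian_eq hf x
  rw [F.cos_zero, F.cos_zero'] at h1
  rw [F.sin_zero, F.sin_zero'] at h2
  linear_combination (-f x) * F.wronskian x + s x * h1 - c x * h2

theorem eq_lincomb' (F : IsFundamental q l c c' s s') (hf : IsSol q l f f') (x : ℝ) :
    f' x = f 0 * c' x + f' 0 * s' x := by
  have h1 := F.cos.wronskian_eq hf x
  have h2 := F.sin.wronskian_eq hf x
  rw [F.cos_zero, F.cos_zero'] at h1
  rw [F.sin_zero, F.sin_zero'] at h2
  linear_combination (-f' x) * F.wronskian x + s' x * h1 - c' x * h2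

/-! ### Reflection about the half period, monodromy matrix and Floquet solutions. -/

section

variable (F : IsFundamental q l c c' s s') (hq : IsEvenPotential q K Q)
include F hq

/-- `x ↦ c (2K - x)` is again a solution, hence a combination of `c` and `s` with coefficients `c
(2K)` and `-c' (2K)`. At the fixed point `x = K` value and derivative are known up to the sign of
the derivative, and solving this system expresses the coefficients by data at `K`. -/
theorem reflect_cos (x : ℝ) :
    c (2 * K - x) = (c K * s' K + c' K * s K) * c x - 2 * (c K * c' K) * s x ∧
    -c' (2 * K - x) = (c K * s' K + c' K * s K) * c' x - 2 * (c K * c' K) * s' x := by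
  have hs := (F.cos.comp_add hq.periodic).comp_neg hq.even
  have h1 := F.eq_lincomb hs
  have h2 := F.eq_lincomb' hs
  have k1 := h1 K
  have k2 := h2 K
  have w := F.wronskian K
  simp only [neg_zero, zero_add] at k1 k2 h1 h2
  rw [show -K + 2 * K = K by ring] at k1 k2
  have hA : c (2 * K) = c K * s' K + c' K * s K := by
    linear_combination (-c (2 * K)) * w - s' K * k1 + s K * k2
  have hB : -c' (2 * K) = -(2 * (c K * c' K)) := by
    linear_combination (c' (2 * K)) * w + c' K * k1 - c K * k2
  have h1 := h1 x
  have h2 := h2 x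
  rw [hA, hB, show -x + 2 * K = 2 * K - x by ring] at h1 h2
  exact ⟨by rw [h1]; ring, by rw [h2]; ring⟩

theorem reflect_sin (x : ℝ) :
    s (2 * K - x) = 2 * (s K * s' K) * c x - (c K * s' K + c' K * s K) * s x ∧
    -s' (2 * K - x) = 2 * (s K * s' K) * c' x - (c K * s' K + c' K * s K) * s' x := by
  have hs := (F.sin.comp_add hq.periodic).comp_neg hq.even
  have h1 := F.eq_lincomb hs
  have h2 := F.eq_lincomb' hs
  have k1 := h1 K
  have k2 := h2 K
  have w := F.wronskian K
  simp only [neg_zero, zero_add] at k1 k2 h1 h2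
  rw [show -K + 2 * K = K by ring] at k1 k2
  have hA : s (2 * K) = 2 * (s K * s' K) := by
    linear_combination (-s (2 * K)) * w - s' K * k1 + s K * k2
  have hB : -s' (2 * K) = -(c K * s' K + c' K * s K) := by
    linear_combination (s' (2 * K)) * w + c' K * k1 - c K * k2
  have h1 := h1 x
  have h2 := h2 x
  rw [hA, hB, show -x + 2 * K = 2 * K - x by ring] at h1 h2
  exact ⟨by rw [h1]; ring, by rw [h2]; ring⟩

theorem cos_neg (x : ℝ) : c (-x) = c x := by
  have := F.eq_lincomb (F.cos.comp_neg hq.even) x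
  simpa [F.cos_zero, F.cos_zero'] using this

theorem sin_neg (x : ℝ) : s (-x) = -s x := by
  have := F.eq_lincomb (F.sin.comp_neg hq.even) x
  simpa [F.sin_zero, F.sin_zero'] using this

theorem cos_neg' (x : ℝ) : c' (-x) = -c' x := by
  have := F.eq_lincomb' (F.cos.comp_neg hq.even) x
  simp only [neg_zero, F.cos_zero, F.cos_zero'] at this
  linarith

theorem sin_neg' (x : ℝ) : s' (-x) = s' x := by
  have := F.eq_lincomb' (F.sin.comp_neg hq.even) x
  simp only [neg_zero, F.sin_zero, F.sin_zero'] at this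
  linarith

theorem cos_add (x : ℝ) :
    c (x + 2 * K) = (c K * s' K + c' K * s K) * c x + 2 * (c K * c' K) * s x := by
  have h := (F.reflect_cos hq (-x)).1
  rw [F.cos_neg hq, F.sin_neg hq, show 2 * K - -x = x + 2 * K by ring] at h
  rw [h]; ring

theorem cos_add' (x : ℝ) :
    c' (x + 2 * K) = (c K * s' K + c' K * s K) * c' x + 2 * (c K * c' K) * s' x := by
  have h := (F.reflect_cos hq (-x)).2
  rw [F.cos_neg' hq, F.sin_neg' hq, show 2 * K - -x = x + 2 * K by ring] at h
  linear_combination -h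

theorem sin_add (x : ℝ) :
    s (x + 2 * K) = 2 * (s K * s' K) * c x + (c K * s' K + c' K * s K) * s x := by
  have h := (F.reflect_sin hq (-x)).1
  rw [F.cos_neg hq, F.sin_neg hq, show 2 * K - -x = x + 2 * K by ring] at h
  rw [h]; ring

theorem sin_add' (x : ℝ) :
    s' (x + 2 * K) = 2 * (s K * s' K) * c' x + (c K * s' K + c' K * s K) * s' x := by
  have h := (F.reflect_sin hq (-x)).2
  rw [F.cos_neg' hq, F.sin_neg' hq, show 2 * K - -x = x + 2 * K by ring] at h
  linear_combination -h

/-- The eigenvector equation `(M - σ) (a, b) = 0` for the monodromy matrix `M`, whose diagonal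
entries are both the half discriminant `c s' + c' s` at `K`. -/
theorem lincomb_mem_iff (σ a b : ℝ) :
    (fun x => a * c x + b * s x) ∈ floquetSolutions q (2 * K) σ l ↔
      a * (c K * s' K + c' K * s K - σ) + b * (2 * (s K * s' K)) = 0 ∧
      a * (2 * (c K * c' K)) + b * (c K * s' K + c' K * s K - σ) = 0 := by
  have hsol := F.cos.lincomb F.sin a b
  constructor
  · intro h
    have h4 := h.2.2.2
    have h5 : ∀ x, a * c' (x + 2 * K) + b * s' (x + 2 * K) = σ * (a * c' x + b * s' x) := fun x => by
      have e1 := (hsol.comp_add hq.periodic).deriv x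
      have e2 := (hsol.deriv x).const_mul σ
      have : (fun x => a * c (x + 2 * K) + b * s (x + 2 * K)) =
          fun x => σ * (a * c x + b * s x) := funext h4
      rw [this] at e1
      exact e1.unique e2
    have h4 := h4 0
    have h5 := h5 0
    simp only [F.cos_add hq, F.sin_add hq, F.cos_add' hq, F.sin_add' hq, F.cos_zero, F.sin_zero,
      F.cos_zero', F.sin_zero'] at h4 h5
    exact ⟨by linear_combination h4, by linear_combination h5⟩
  · rintro ⟨h1, h2⟩
    refine hsol.mem_floquetSolutions fun x => ?_
    simp only [F.cos_add hq, F.sin_add hq]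
    linear_combination c x * h1 + s x * h2

theorem cos_mem_iff (σ : ℝ) : c ∈ floquetSolutions q (2 * K) σ l ↔
    c K * s' K + c' K * s K = σ ∧ c K * c' K = 0 := by
  have := F.lincomb_mem_iff hq σ 1 0
  simpa [sub_eq_zero] using this

theorem sin_mem_iff (σ : ℝ) : s ∈ floquetSolutions q (2 * K) σ l ↔
    c K * s' K + c' K * s K = σ ∧ s K * s' K = 0 := by
  have := F.lincomb_mem_iff hq σ 0 1
  simpa [sub_eq_zero, and_comm] using this

/-- For multipliers `±1` the Floquet space splits into its even and odd parts, so multiplicities can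
be counted separately for `c` and `s`. -/
theorem smul_mem_of_lincomb_mem {σ a b : ℝ} (hσ : σ ^ 2 = 1)
    (h : (fun x => a * c x + b * s x) ∈ floquetSolutions q (2 * K) σ l) :
    (a = 0 ∨ c ∈ floquetSolutions q (2 * K) σ l) ∧
      (b = 0 ∨ s ∈ floquetSolutions q (2 * K) σ l) := by
  rw [F.cos_mem_iff hq, F.sin_mem_iff hq]
  obtain ⟨h1, h2⟩ := (F.lincomb_mem_iff hq σ a b).1 h
  have w := F.wronskian K
  -- The monodromy matrix has determinant `1`. With equal diagonal entries different from `σ` this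
  -- leaves only the trivial eigenvector.
  have hd : (c K * s' K + c' K * s K) ^ 2 - 1 = 2 * (s K * s' K) * (2 * (c K * c' K)) := by
    linear_combination (c K * s' K - c' K * s K + 1) * w
  by_cases hds : c K * s' K + c' K * s K = σ
  · rw [hds, sub_self, mul_zero] at h1 h2
    simp only [zero_add, add_zero, mul_eq_zero, OfNat.ofNat_ne_zero, false_or] at h1 h2
    simp only [hds, mul_eq_zero]
    tauto
  · have hne : c K * s' K + c' K * s K - σ ≠ 0 := sub_ne_zero.2 hds
    have hσ0 : σ ≠ 0 := by rintro rfl; norm_num at hσ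
    have ha : a * (-2 * σ * (c K * s' K + c' K * s K - σ)) = 0 := by
      linear_combination (c K * s' K + c' K * s K - σ) * h1 - 2 * (s K * s' K) * h2 - a * hd +
        a * hσ
    have hb : b * (-2 * σ * (c K * s' K + c' K * s K - σ)) = 0 := by
      linear_combination (c K * s' K + c' K * s K - σ) * h2 - 2 * (c K * c' K) * h1 - b * hd +
        b * hσ
    have : -2 * σ * (c K * s' K + c' K * s K - σ) ≠ 0 := by
      simp [hσ0, hne]
    exact ⟨Or.inl ((mul_eq_zero.1 ha).resolve_right this),
      Or.inl ((mul_eq_zero.1 hb).resolve_right this)⟩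

omit hq in
theorem linearIndependent : LinearIndependent ℝ ![c, s] := by
  rw [LinearIndependent.pair_iff]
  intro a b hab
  have h0 : ∀ x, a * c x + b * s x = 0 := fun x => congrFun hab x
  have h1 := h0 0
  rw [F.cos_zero, F.sin_zero] at h1
  have ha : a = 0 := by linarith
  refine ⟨ha, ?_⟩
  by_contra hb
  have : ∀ x, s x = 0 := fun x => by
    have := h0 x
    rw [ha, zero_mul, zero_add] at this
    exact (mul_eq_zero.1 this).resolve_left hb
  have hs : s = fun _ => 0 := funext this
  have h2 := F.sin.deriv 0
  rw [F.sin_zero', hs] at h2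
  have := h2.unique (hasDerivAt_const _ _)
  norm_num at this

open Classical in
theorem finrank_floquetSolutions {σ : ℝ} (hσ : σ ^ 2 = 1) :
    Module.finrank ℝ (floquetSolutions q (2 * K) σ l) =
      (if c ∈ floquetSolutions q (2 * K) σ l then 1 else 0) +
      (if s ∈ floquetSolutions q (2 * K) σ l then 1 else 0) := by
  have hli := F.linearIndependent
  have hdec : ∀ f ∈ floquetSolutions q (2 * K) σ l, ∃ a b : ℝ, f = a • c + b • s ∧
      (a = 0 ∨ c ∈ floquetSolutions q (2 * K) σ l) ∧
      (b = 0 ∨ s ∈ floquetSolutions q (2 * K) σ l) := fun f hf => by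
    have he := F.eq_lincomb (IsSol.of_mem_floquetSolutions hf)
    have he' : f = fun x => f 0 * c x + deriv f 0 * s x := funext he
    refine ⟨f 0, deriv f 0, he', F.smul_mem_of_lincomb_mem hq hσ ?_⟩
    rw [← he']; exact hf
  have hc0 : c ≠ 0 := hli.ne_zero 0
  have hs0 : s ≠ 0 := hli.ne_zero 1
  by_cases hc : c ∈ floquetSolutions q (2 * K) σ l <;>
    by_cases hs : s ∈ floquetSolutions q (2 * K) σ l
  · rw [if_pos hc, if_pos hs]
    have : floquetSolutions q (2 * K) σ l = Submodule.span ℝ (Set.range ![c, s]) := by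
      refine le_antisymm (fun f hf => ?_) ?_
      · obtain ⟨a, b, rfl, -⟩ := hdec f hf
        exact add_mem (Submodule.smul_mem _ _ (Submodule.subset_span ⟨0, rfl⟩))
          (Submodule.smul_mem _ _ (Submodule.subset_span ⟨1, rfl⟩))
      · rw [Submodule.span_le]
        rintro _ ⟨i, rfl⟩
        fin_cases i
        · exact hc
        · exact hs
    rw [this, finrank_span_eq_card hli]; simp
  · rw [if_pos hc, if_neg hs]
    have : floquetSolutions q (2 * K) σ l = Submodule.span ℝ {c} := by
      refine le_antisymm (fun f hf => ?_) ?_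
      · obtain ⟨a, b, rfl, -, h | h⟩ := hdec f hf
        · rw [h, zero_smul, add_zero]
          exact Submodule.smul_mem _ _ (Submodule.mem_span_singleton_self c)
        · exact absurd h hs
      · rw [Submodule.span_le]; simpa using hc
    rw [this, finrank_span_singleton hc0]
  · rw [if_neg hc, if_pos hs]
    have : floquetSolutions q (2 * K) σ l = Submodule.span ℝ {s} := by
      refine le_antisymm (fun f hf => ?_) ?_
      · obtain ⟨a, b, rfl, h | h, -⟩ := hdec f hf
        · rw [h, zero_smul, zero_add]
          exact Submodule.smul_mem _ _ (Submodule.mem_span_singleton_self s)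
        · exact absurd h hc
      · rw [Submodule.span_le]; simpa using hs
    rw [this, finrank_span_singleton hs0]
  · rw [if_neg hc, if_neg hs]
    have : floquetSolutions q (2 * K) σ l = ⊥ := by
      refine (Submodule.eq_bot_iff _).2 fun f hf => ?_
      obtain ⟨a, b, rfl, h1, h2⟩ := hdec f hf
      rw [h1.resolve_right hc, h2.resolve_right hs]; simp
    rw [this, finrank_bot]

/-- An even solution is `2K`-periodic exactly when it is also symmetric about `K`. The next three
criteria are the analogous ones for the other parities at `0` and `K`. -/
theorem cos_mem_periodic_iff : c ∈ floquetSolutions q (2 * K) 1 l ↔ c' K = 0 := by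
  rw [F.cos_mem_iff hq]
  have w := F.wronskian K
  constructor
  · rintro ⟨h1, h2⟩
    have h3 : c' K * s K = 0 := by linarith
    by_contra h
    have e1 := (mul_eq_zero.1 h2).resolve_right h
    have e2 := (mul_eq_zero.1 h3).resolve_left h
    rw [e1, e2] at w; norm_num at w
  · intro h
    rw [h] at w ⊢
    exact ⟨by linarith, by ring⟩

theorem cos_mem_antiperiodic_iff : c ∈ floquetSolutions q (2 * K) (-1) l ↔ c K = 0 := by
  rw [F.cos_mem_iff hq]
  have w := F.wronskian K
  constructor
  · rintro ⟨h1, h2⟩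
    have h3 : c K * s' K = 0 := by linarith
    by_contra h
    have e1 := (mul_eq_zero.1 h2).resolve_left h
    have e2 := (mul_eq_zero.1 h3).resolve_left h
    rw [e1, e2] at w; norm_num at w
  · intro h
    rw [h] at w ⊢
    exact ⟨by linarith, by ring⟩

theorem sin_mem_periodic_iff : s ∈ floquetSolutions q (2 * K) 1 l ↔ s K = 0 := by
  rw [F.sin_mem_iff hq]
  have w := F.wronskian K
  constructor
  · rintro ⟨h1, h2⟩
    have h3 : c' K * s K = 0 := by linarith
    by_contra h
    have e1 := (mul_eq_zero.1 h2).resolve_left h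
    have e2 := (mul_eq_zero.1 h3).resolve_right h
    rw [e1, e2] at w; norm_num at w
  · intro h
    rw [h] at w ⊢
    exact ⟨by linarith, by ring⟩

theorem sin_mem_antiperiodic_iff : s ∈ floquetSolutions q (2 * K) (-1) l ↔ s' K = 0 := by
  rw [F.sin_mem_iff hq]
  have w := F.wronskian K
  constructor
  · rintro ⟨h1, h2⟩
    have h3 : c K * s' K = 0 := by linarith
    by_contra h
    have e1 := (mul_eq_zero.1 h2).resolve_right h
    have e2 := (mul_eq_zero.1 h3).resolve_right h
    rw [e1, e2] at w; norm_num at w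
  · intro h
    rw [h] at w ⊢
    exact ⟨by linarith, by ring⟩

end

end IsFundamental

/-! ### Prüfer angles and amplitudes of the fundamental solutions -/

noncomputable section

/-- The Prüfer angle of `-ψ'' + q ψ = l ψ` with initial value `θ₀` at the origin. -/
def pruferAngle (q : ℝ → ℝ) (l θ₀ : ℝ) : ℝ → ℝ :=
  Classical.epsilon fun θ => θ 0 = θ₀ ∧ IsPruferAngle q l θ

/-- The Prüfer amplitude belonging to a Prüfer angle `θ`. -/
def pruferAmplitude (q : ℝ → ℝ) (l : ℝ) (θ : ℝ → ℝ) (x : ℝ) : ℝ :=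
  Real.exp (∫ y in (0 : ℝ)..x, (1 - (l - q y)) * (Real.sin (θ y) * Real.cos (θ y)))

/-- The Prüfer angle of the even fundamental solution. -/
def cosAngle (q : ℝ → ℝ) (l : ℝ) : ℝ → ℝ := pruferAngle q l (Real.pi / 2)

/-- The Prüfer angle of the odd fundamental solution. -/
def sinAngle (q : ℝ → ℝ) (l : ℝ) : ℝ → ℝ := pruferAngle q l 0

end

theorem pruferAmplitude_pos (q : ℝ → ℝ) (l : ℝ) (θ : ℝ → ℝ) (x : ℝ) :
    0 < pruferAmplitude q l θ x := Real.exp_pos _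

theorem pruferAmplitude_zero (q : ℝ → ℝ) (l : ℝ) (θ : ℝ → ℝ) : pruferAmplitude q l θ 0 = 1 := by
  simp [pruferAmplitude]

/-- Polar coordinates in the phase plane. As the amplitude is positive, zeros of the solution and of
its derivative are those of the sine and cosine of the angle. -/
theorem IsPruferAngle.isSol {q θ : ℝ → ℝ} {l : ℝ} (h : IsPruferAngle q l θ) (hq : Continuous q) :
    IsSol q l (fun x => pruferAmplitude q l θ x * Real.sin (θ x))
      fun x => pruferAmplitude q l θ x * Real.cos (θ x) := by
  have hθ := h.continuous
  have hc : Continuous fun y => (1 - (l - q y)) * (Real.sin (θ y) * Real.cos (θ y)) := by fun_prop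
  have hr : ∀ x, HasDerivAt (pruferAmplitude q l θ)
      (pruferAmplitude q l θ x * ((1 - (l - q x)) * (Real.sin (θ x) * Real.cos (θ x)))) x := fun x =>
    (intervalIntegral.integral_hasDerivAt_right (hc.intervalIntegrable _ _)
      (hc.stronglyMeasurableAtFilter _ _) hc.continuousAt).exp
  constructor <;> intro x
  · convert! (hr x).mul (h x).sin using 1
    have := Real.sin_sq_add_cos_sq (θ x)
    ring
  · convert! (hr x).mul (h x).cos using 1
    have := Real.sin_sq_add_cos_sq (θ x)
    linear_combination pruferAmplitude q l θ x * (-(1 - (l - q x)) * Real.sin (θ x)) * this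

/-! ### Dependence of the Prüfer angles at `K` on the spectral parameter. -/

namespace IsEvenPotential

variable {q : ℝ → ℝ} {K Q : ℝ} (hq : IsEvenPotential q K Q)
include hq

theorem pruferAngle_spec (l θ₀ : ℝ) :
    pruferAngle q l θ₀ 0 = θ₀ ∧ IsPruferAngle q l (pruferAngle q l θ₀) :=
  Classical.epsilon_spec (hq.exists_pruferAngle l θ₀)

theorem cosAngle_zero (l : ℝ) : cosAngle q l 0 = Real.pi / 2 := (hq.pruferAngle_spec l _).1

theorem sinAngle_zero (l : ℝ) : sinAngle q l 0 = 0 := (hq.pruferAngle_spec l _).1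

theorem isPruferAngle_cosAngle (l : ℝ) : IsPruferAngle q l (cosAngle q l) :=
  (hq.pruferAngle_spec l _).2

theorem isPruferAngle_sinAngle (l : ℝ) : IsPruferAngle q l (sinAngle q l) :=
  (hq.pruferAngle_spec l _).2

theorem isFundamental (l : ℝ) : IsFundamental q l
    (fun x => pruferAmplitude q l (cosAngle q l) x * Real.sin (cosAngle q l x))
    (fun x => pruferAmplitude q l (cosAngle q l) x * Real.cos (cosAngle q l x))
    (fun x => pruferAmplitude q l (sinAngle q l) x * Real.sin (sinAngle q l x))
    (fun x => pruferAmplitude q l (sinAngle q l) x * Real.cos (sinAngle q l x)) where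
  cos := (hq.isPruferAngle_cosAngle l).isSol hq.smooth.continuous
  sin := (hq.isPruferAngle_sinAngle l).isSol hq.smooth.continuous
  cos_zero := by simp [pruferAmplitude_zero, hq.cosAngle_zero]
  cos_zero' := by simp [pruferAmplitude_zero, hq.cosAngle_zero]
  sin_zero := by simp [pruferAmplitude_zero, hq.sinAngle_zero]
  sin_zero' := by simp [pruferAmplitude_zero, hq.sinAngle_zero]

theorem sinAngle_pos (l : ℝ) {x : ℝ} (hx : 0 < x) : 0 < sinAngle q l x :=
  (hq.isPruferAngle_sinAngle l).lt_of_level hq.smooth.continuous Real.sin_zero hx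
    (hq.sinAngle_zero l).ge

theorem sinAngle_lt_cosAngle (l : ℝ) {x : ℝ} (hx : 0 ≤ x) : sinAngle q l x < cosAngle q l x :=
  (hq.isPruferAngle_sinAngle l).lt_of_lt hq.smooth.continuous (hq.isPruferAngle_cosAngle l) le_rfl
    hx (by rw [hq.cosAngle_zero, hq.sinAngle_zero]; positivity)

/-- Adding `π` to a Prüfer angle gives another one for the same equation, and such angles keep their
order. With the lower bound by `sinAngle` this is the source of all interlacing. -/
theorem cosAngle_lt_sinAngle_add_pi (l : ℝ) {x : ℝ} (hx : 0 ≤ x) :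
    cosAngle q l x < sinAngle q l x + Real.pi :=
  (hq.isPruferAngle_cosAngle l).lt_of_lt hq.smooth.continuous (hq.isPruferAngle_sinAngle l).add_pi
    le_rfl hx (by rw [hq.cosAngle_zero, hq.sinAngle_zero]; linarith [Real.pi_pos])

theorem strictMono_pruferAngle (θ₀ : ℝ) : StrictMono fun l => pruferAngle q l θ₀ K :=
  fun l m hlm => (hq.pruferAngle_spec l θ₀).2.lt_of_param_lt hq.smooth.continuous
    (hq.pruferAngle_spec m θ₀).2 hlm hq.K_pos
    (by rw [(hq.pruferAngle_spec l θ₀).1, (hq.pruferAngle_spec m θ₀).1])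

theorem continuous_pruferAngle (θ₀ : ℝ) : Continuous fun l => pruferAngle q l θ₀ K := by
  have hQ : 0 ≤ Q := (hq.nonneg 0).trans (hq.le 0)
  have hK := hq.K_pos
  have key : ∀ M l m : ℝ, l ≤ m → |m| ≤ M →
      |pruferAngle q m θ₀ K - pruferAngle q l θ₀ K| ≤
        K * Real.exp ((M + Q + 1) * K) * (m - l) := fun M l m hlm hm => by
    have h1 := (hq.pruferAngle_spec l θ₀).2.sub_le_mul_exp hq (hq.pruferAngle_spec m θ₀).2 hlm
      (by rw [(hq.pruferAngle_spec l θ₀).1, (hq.pruferAngle_spec m θ₀).1])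
    have h2 := (hq.strictMono_pruferAngle θ₀).monotone hlm
    rw [abs_of_nonneg (sub_nonneg.2 h2)]
    refine h1.trans ?_
    have h3 : Real.exp ((|m| + Q + 1) * K) ≤ Real.exp ((M + Q + 1) * K) :=
      Real.exp_le_exp.2 (by nlinarith)
    have := mul_le_mul_of_nonneg_left h3 (mul_nonneg (sub_nonneg.2 hlm) hK.le)
    linarith
  refine continuous_iff_continuousAt.2 fun l => ?_
  set M := |l| + 1 with hM
  set C := K * Real.exp ((M + Q + 1) * K) with hC
  have hbd : ∀ᶠ m in 𝓝 l, |pruferAngle q m θ₀ K - pruferAngle q l θ₀ K| ≤ C * |m - l| := by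
    have : ∀ᶠ m : ℝ in 𝓝 l, |m| < M :=
      (continuous_abs.tendsto l).eventually (gt_mem_nhds (by simp [hM]))
    filter_upwards [this] with m hm
    rcases le_total l m with h | h
    · rw [abs_of_nonneg (sub_nonneg.2 h)]
      exact key M l m h hm.le
    · rw [abs_sub_comm, abs_sub_comm m l, abs_of_nonneg (sub_nonneg.2 h)]
      exact key M m l h (by simp [hM])
  rw [ContinuousAt, tendsto_iff_dist_tendsto_zero]
  have hlim : Tendsto (fun m => C * |m - l|) (𝓝 l) (𝓝 0) := by
    have : Continuous fun m => C * |m - l| := by fun_prop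
    simpa using this.tendsto l
  exact squeeze_zero' (Eventually.of_forall fun _ => dist_nonneg) hbd hlim

theorem exists_pruferAngle_eq {θ₀ : ℝ} (h0 : 0 ≤ θ₀) (h0' : Real.sin θ₀ * Real.cos θ₀ = 0) {y : ℝ}
    (hy : pruferAngle q 0 θ₀ K ≤ y) : ∃ l, pruferAngle q l θ₀ K = y := by
  have hK := hq.K_pos
  -- Chosen so that the growth bound `w K - π/2` exceeds `y` when `l = Q + w²`.
  set w := (|y| + Real.pi) / K with hw
  have hw0 : 0 < w := div_pos (by positivity) hK
  set L := Q + w ^ 2 with hL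
  have hgrow := (hq.pruferAngle_spec L θ₀).2.growth hw0
    (fun x => by have := hq.le x; linarith) hK.le
    (by rw [(hq.pruferAngle_spec L θ₀).1]; exact h0)
    (by rw [(hq.pruferAngle_spec L θ₀).1]; exact h0')
  have hyL : y ≤ pruferAngle q L θ₀ K := by
    refine le_trans ?_ hgrow
    have : w * K = |y| + Real.pi := by rw [hw]; field_simp
    have := le_abs_self y
    have := Real.pi_pos
    linarith
  have hQ : 0 ≤ Q := (hq.nonneg 0).trans (hq.le 0)
  obtain ⟨l, -, hl⟩ := intermediate_value_Icc (by positivity : (0 : ℝ) ≤ L)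
    (hq.continuous_pruferAngle θ₀).continuousOn ⟨hy, hyL⟩
  exact ⟨l, hl⟩

/-- As `q ≥ 0`, at `l = 0` the angle is still below the first target `π/2`; hence every `(j + 1)
π/2` is attained. -/
theorem cosAngle_le_pi_div_two : cosAngle q 0 K ≤ Real.pi / 2 :=
  (hq.isPruferAngle_cosAngle 0).le_pi_div_two hq.nonneg hq.K_pos.le (hq.cosAngle_zero 0).le

theorem exists_cosAngle_eq {y : ℝ} (hy : Real.pi / 2 ≤ y) : ∃ l, cosAngle q l K = y :=
  hq.exists_pruferAngle_eq (by positivity) (by simp) (hq.cosAngle_le_pi_div_two.trans hy)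

theorem exists_sinAngle_eq {y : ℝ} (hy : Real.pi / 2 ≤ y) : ∃ l, sinAngle q l K = y :=
  hq.exists_pruferAngle_eq le_rfl (by simp)
    ((hq.sinAngle_lt_cosAngle 0 hq.K_pos.le).le.trans (hq.cosAngle_le_pi_div_two.trans hy))

end IsEvenPotential
end Lame

namespace Lame

/-! ### Sequences built from pairs -/

noncomputable section

/-- The sequence `min (u 0) (v 0), max (u 0) (v 0), min (u 1) (v 1), max (u 1) (v 1), …`. -/
def pairSeq (u v : ℕ → ℝ) (i : ℕ) : ℝ :=
  if Even i then min (u (i / 2)) (v (i / 2)) else max (u (i / 2)) (v (i / 2))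

/-- The `j`-th eigenvalue whose eigenfunction is the even fundamental solution. -/
def cosEigenvalue (q : ℝ → ℝ) (K : ℝ) (j : ℕ) : ℝ :=
  Classical.epsilon fun l => cosAngle q l K = (j + 1) * (Real.pi / 2)

/-- The `j`-th eigenvalue whose eigenfunction is the odd fundamental solution. -/
def sinEigenvalue (q : ℝ → ℝ) (K : ℝ) (j : ℕ) : ℝ :=
  Classical.epsilon fun l => sinAngle q l K = (j + 1) * (Real.pi / 2)

/-- The periodic eigenvalues. -/
def periodicEigenvalue (q : ℝ → ℝ) (K : ℝ) : ℕ → ℝ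
  | 0 => cosEigenvalue q K 0
  | i + 1 => pairSeq (fun n => cosEigenvalue q K (2 * n + 2))
      (fun n => sinEigenvalue q K (2 * n + 1)) i

/-- The antiperiodic eigenvalues. -/
def antiperiodicEigenvalue (q : ℝ → ℝ) (K : ℝ) : ℕ → ℝ :=
  pairSeq (fun n => cosEigenvalue q K (2 * n + 1)) fun n => sinEigenvalue q K (2 * n)

end

theorem pairSeq_even (u v : ℕ → ℝ) (n : ℕ) : pairSeq u v (2 * n) = min (u n) (v n) := by
  simp [pairSeq]

theorem pairSeq_odd (u v : ℕ → ℝ) (n : ℕ) : pairSeq u v (2 * n + 1) = max (u n) (v n) := by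
  have h1 : (2 * n + 1) / 2 = n := by omega
  simp [pairSeq, h1]

theorem tendsto_pairSeq {u v : ℕ → ℝ} (hu : Tendsto u atTop atTop) (hv : Tendsto v atTop atTop) :
    Tendsto (pairSeq u v) atTop atTop := by
  have hdiv : Tendsto (fun i : ℕ => i / 2) atTop atTop :=
    Nat.tendsto_div_const_atTop two_ne_zero
  refine tendsto_atTop.2 fun M => ?_
  filter_upwards [(hu.comp hdiv).eventually_ge_atTop M, (hv.comp hdiv).eventually_ge_atTop M]
    with i h1 h2
  simp only [Function.comp] at h1 h2
  unfold pairSeq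
  split_ifs
  · exact le_min h1 h2
  · exact le_max_of_le_left h1

-- Consecutive pairs are strictly separated, so a value occurs within a single pair, once for each
-- member equal to it.
open Classical in
theorem encard_pairSeq {u v : ℕ → ℝ} (h : ∀ n, max (u n) (v n) < min (u (n + 1)) (v (n + 1)))
    (μ : ℝ) : {i | pairSeq u v i = μ}.encard =
      (((if ∃ n, u n = μ then 1 else 0) + (if ∃ n, v n = μ then 1 else 0) : ℕ) : ℕ∞) := by
  have hsep : ∀ m n, m < n → max (u m) (v m) < min (u n) (v n) := fun m n hmn => by
    induction n, hmn using Nat.le_induction with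
    | base => exact h m
    | succ n _ ih => exact (ih.trans_le min_le_max).trans (h n)
  have huniq : ∀ m n, (u m = μ ∨ v m = μ) → (u n = μ ∨ v n = μ) → m = n := by
    have aux : ∀ m n, m < n → (u m = μ ∨ v m = μ) → (u n = μ ∨ v n = μ) → False := by
      intro m n hmn h1 h2
      have := hsep m n hmn
      rw [max_lt_iff, lt_min_iff, lt_min_iff] at this
      obtain ⟨⟨a1, a2⟩, a3, a4⟩ := this
      rcases h1 with h1 | h1 <;> rcases h2 with h2 | h2 <;> linarith
    intro m n h1 h2
    rcases lt_trichotomy m n with h | h | h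
    · exact (aux m n h h1 h2).elim
    · exact h
    · exact (aux n m h h2 h1).elim
  have hval : ∀ i, pairSeq u v i = μ → u (i / 2) = μ ∨ v (i / 2) = μ := fun i hi => by
    unfold pairSeq at hi
    split_ifs at hi
    · rcases min_choice (u (i / 2)) (v (i / 2)) with h | h <;> rw [h] at hi <;> simp [hi]
    · rcases max_choice (u (i / 2)) (v (i / 2)) with h | h <;> rw [h] at hi <;> simp [hi]
  have hmem : ∀ n, (u n = μ ∨ v n = μ) → ∀ i, pairSeq u v i = μ →
      i = 2 * n ∨ i = 2 * n + 1 := fun n hn i hi => by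
    have := huniq n (i / 2) hn (hval i hi)
    omega
  by_cases h1 : ∃ n, u n = μ
  · obtain ⟨n, hn⟩ := h1
    rw [if_pos ⟨n, hn⟩]
    by_cases h2 : ∃ n, v n = μ
    · obtain ⟨m, hm⟩ := h2
      obtain rfl := huniq n m (Or.inl hn) (Or.inr hm)
      rw [if_pos ⟨n, hm⟩]
      have : {i | pairSeq u v i = μ} = {2 * n, 2 * n + 1} := by
        ext i
        simp only [mem_ofPred_eq, mem_insert_iff, mem_singleton_iff]
        refine ⟨hmem n (Or.inl hn) i, ?_⟩
        rintro (rfl | rfl)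
        · rw [pairSeq_even, hn, hm, min_self]
        · rw [pairSeq_odd, hn, hm, max_self]
      rw [this, encard_pair (by omega)]; norm_num
    · rw [if_neg h2]
      have hvn : v n ≠ μ := fun h => h2 ⟨n, h⟩
      rw [← hn] at hvn
      rcases hvn.lt_or_gt with hlt | hlt
      · have : {i | pairSeq u v i = μ} = {2 * n + 1} := by
          ext i
          simp only [mem_ofPred_eq, mem_singleton_iff]
          constructor
          · intro hi
            rcases hmem n (Or.inl hn) i hi with rfl | rfl
            · rw [pairSeq_even, min_eq_right hlt.le] at hi
              exact absurd hi (by rw [← hn]; exact hlt.ne)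
            · rfl
          · rintro rfl
            rw [pairSeq_odd, max_eq_left hlt.le, hn]
        rw [this, encard_singleton]; norm_num
      · have : {i | pairSeq u v i = μ} = {2 * n} := by
          ext i
          simp only [mem_ofPred_eq, mem_singleton_iff]
          constructor
          · intro hi
            rcases hmem n (Or.inl hn) i hi with rfl | rfl
            · rfl
            · rw [pairSeq_odd, max_eq_right hlt.le] at hi
              exact absurd hi (by rw [← hn]; exact hlt.ne')
          · rintro rfl
            rw [pairSeq_even, min_eq_left hlt.le, hn]
        rw [this, encard_singleton]; norm_num
  · rw [if_neg h1]
    by_cases h2 : ∃ n, v n = μ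
    · obtain ⟨n, hn⟩ := h2
      rw [if_pos ⟨n, hn⟩]
      have hvn : u n ≠ μ := fun h => h1 ⟨n, h⟩
      rw [← hn] at hvn
      rcases hvn.lt_or_gt with hlt | hlt
      · have : {i | pairSeq u v i = μ} = {2 * n + 1} := by
          ext i
          simp only [mem_ofPred_eq, mem_singleton_iff]
          constructor
          · intro hi
            rcases hmem n (Or.inr hn) i hi with rfl | rfl
            · rw [pairSeq_even, min_eq_left hlt.le] at hi
              exact absurd hi (by rw [← hn]; exact hlt.ne)
            · rfl
          · rintro rfl
            rw [pairSeq_odd, max_eq_right hlt.le, hn]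
        rw [this, encard_singleton]; norm_num
      · have : {i | pairSeq u v i = μ} = {2 * n} := by
          ext i
          simp only [mem_ofPred_eq, mem_singleton_iff]
          constructor
          · intro hi
            rcases hmem n (Or.inr hn) i hi with rfl | rfl
            · rfl
            · rw [pairSeq_odd, max_eq_left hlt.le] at hi
              exact absurd hi (by rw [← hn]; exact hlt.ne')
          · rintro rfl
            rw [pairSeq_even, min_eq_right hlt.le, hn]
        rw [this, encard_singleton]; norm_num
    · rw [if_neg h2]
      have : {i | pairSeq u v i = μ} = ∅ := by
        refine eq_empty_of_forall_notMem fun i hi => ?_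
        rcases hval i hi with h | h
        · exact h1 ⟨_, h⟩
        · exact h2 ⟨_, h⟩
      rw [this, encard_empty]; norm_num

theorem periodicEigenvalue_succ (q : ℝ → ℝ) (K : ℝ) (i : ℕ) :
    periodicEigenvalue q K (i + 1) = pairSeq (fun n => cosEigenvalue q K (2 * n + 2))
      (fun n => sinEigenvalue q K (2 * n + 1)) i := rfl

theorem periodicEigenvalue_odd (q : ℝ → ℝ) (K : ℝ) (n : ℕ) :
    periodicEigenvalue q K (2 * n + 1) =
      min (cosEigenvalue q K (2 * n + 2)) (sinEigenvalue q K (2 * n + 1)) := by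
  rw [periodicEigenvalue_succ, pairSeq_even]

theorem periodicEigenvalue_even (q : ℝ → ℝ) (K : ℝ) (n : ℕ) :
    periodicEigenvalue q K (2 * n + 2) =
      max (cosEigenvalue q K (2 * n + 2)) (sinEigenvalue q K (2 * n + 1)) := by
  rw [periodicEigenvalue_succ, pairSeq_odd]

theorem antiperiodicEigenvalue_even (q : ℝ → ℝ) (K : ℝ) (n : ℕ) :
    antiperiodicEigenvalue q K (2 * n) =
      min (cosEigenvalue q K (2 * n + 1)) (sinEigenvalue q K (2 * n)) :=
  pairSeq_even _ _ n

theorem antiperiodicEigenvalue_odd (q : ℝ → ℝ) (K : ℝ) (n : ℕ) :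
    antiperiodicEigenvalue q K (2 * n + 1) =
      max (cosEigenvalue q K (2 * n + 1)) (sinEigenvalue q K (2 * n)) :=
  pairSeq_odd _ _ n

/-! ### Interlacing of the four families of eigenvalues, and the bands. -/

namespace IsEvenPotential

variable {q : ℝ → ℝ} {K Q : ℝ} (hq : IsEvenPotential q K Q)
include hq

theorem cosAngle_cosEigenvalue (j : ℕ) :
    cosAngle q (cosEigenvalue q K j) K = (j + 1) * (Real.pi / 2) := by
  refine Classical.epsilon_spec (p := fun l => cosAngle q l K = (j + 1) * (Real.pi / 2))
    (hq.exists_cosAngle_eq ?_)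
  have : (0 : ℝ) ≤ j := j.cast_nonneg
  nlinarith [Real.pi_pos]

theorem sinAngle_sinEigenvalue (j : ℕ) :
    sinAngle q (sinEigenvalue q K j) K = (j + 1) * (Real.pi / 2) := by
  refine Classical.epsilon_spec (p := fun l => sinAngle q l K = (j + 1) * (Real.pi / 2))
    (hq.exists_sinAngle_eq ?_)
  have : (0 : ℝ) ≤ j := j.cast_nonneg
  nlinarith [Real.pi_pos]

theorem lt_cosEigenvalue_iff {l : ℝ} {j : ℕ} :
    l < cosEigenvalue q K j ↔ cosAngle q l K < (j + 1) * (Real.pi / 2) := by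
  rw [← hq.cosAngle_cosEigenvalue j]
  exact ((hq.strictMono_pruferAngle _).lt_iff_lt).symm

theorem cosEigenvalue_lt_iff {l : ℝ} {j : ℕ} :
    cosEigenvalue q K j < l ↔ (j + 1) * (Real.pi / 2) < cosAngle q l K := by
  rw [← hq.cosAngle_cosEigenvalue j]
  exact ((hq.strictMono_pruferAngle _).lt_iff_lt).symm

theorem lt_sinEigenvalue_iff {l : ℝ} {j : ℕ} :
    l < sinEigenvalue q K j ↔ sinAngle q l K < (j + 1) * (Real.pi / 2) := by
  rw [← hq.sinAngle_sinEigenvalue j]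
  exact ((hq.strictMono_pruferAngle _).lt_iff_lt).symm

theorem sinEigenvalue_lt_iff {l : ℝ} {j : ℕ} :
    sinEigenvalue q K j < l ↔ (j + 1) * (Real.pi / 2) < sinAngle q l K := by
  rw [← hq.sinAngle_sinEigenvalue j]
  exact ((hq.strictMono_pruferAngle _).lt_iff_lt).symm

theorem cosEigenvalue_eq_iff {l : ℝ} {j : ℕ} :
    cosEigenvalue q K j = l ↔ cosAngle q l K = (j + 1) * (Real.pi / 2) := by
  rw [← hq.cosAngle_cosEigenvalue j]
  exact ((hq.strictMono_pruferAngle _).injective.eq_iff).symm.trans eq_comm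

theorem sinEigenvalue_eq_iff {l : ℝ} {j : ℕ} :
    sinEigenvalue q K j = l ↔ sinAngle q l K = (j + 1) * (Real.pi / 2) := by
  rw [← hq.sinAngle_sinEigenvalue j]
  exact ((hq.strictMono_pruferAngle _).injective.eq_iff).symm.trans eq_comm

theorem cosEigenvalue_lt_succ (j : ℕ) : cosEigenvalue q K j < cosEigenvalue q K (j + 1) := by
  rw [hq.cosEigenvalue_lt_iff, hq.cosAngle_cosEigenvalue]
  push_cast
  nlinarith [Real.pi_pos]

theorem sinEigenvalue_lt_succ (j : ℕ) : sinEigenvalue q K j < sinEigenvalue q K (j + 1) := by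
  rw [hq.sinEigenvalue_lt_iff, hq.sinAngle_sinEigenvalue]
  push_cast
  nlinarith [Real.pi_pos]

theorem cosEigenvalue_lt_sinEigenvalue (j : ℕ) : cosEigenvalue q K j < sinEigenvalue q K j := by
  rw [hq.cosEigenvalue_lt_iff, ← hq.sinAngle_sinEigenvalue]
  exact hq.sinAngle_lt_cosAngle _ hq.K_pos.le

/-- The shift by two reflects that the angle of `c` exceeds that of `s` by less than `π`, two steps
of `π/2`. -/
theorem sinEigenvalue_lt_cosEigenvalue (j : ℕ) :
    sinEigenvalue q K j < cosEigenvalue q K (j + 2) := by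
  rw [hq.lt_cosEigenvalue_iff]
  refine (hq.cosAngle_lt_sinAngle_add_pi _ hq.K_pos.le).trans_eq ?_
  rw [hq.sinAngle_sinEigenvalue]
  push_cast
  ring

/-- The pairs `{cosEigenvalue (j + 1), sinEigenvalue j}` are the edges of the gaps, and successive
gaps are separated by nondegenerate bands. The parity of `j` decides whether a pair is periodic or
antiperiodic. -/
theorem max_lt_min (j : ℕ) : max (cosEigenvalue q K (j + 1)) (sinEigenvalue q K j) <
    min (cosEigenvalue q K (j + 2)) (sinEigenvalue q K (j + 1)) := by
  rw [max_lt_iff, lt_min_iff, lt_min_iff]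
  exact ⟨⟨hq.cosEigenvalue_lt_succ _, hq.cosEigenvalue_lt_sinEigenvalue _⟩,
    hq.sinEigenvalue_lt_cosEigenvalue _, hq.sinEigenvalue_lt_succ _⟩

theorem max_lt_min_add_two (j : ℕ) : max (cosEigenvalue q K (j + 1)) (sinEigenvalue q K j) <
    min (cosEigenvalue q K (j + 3)) (sinEigenvalue q K (j + 2)) :=
  ((hq.max_lt_min j).trans_le min_le_max).trans (hq.max_lt_min (j + 1))

theorem tendsto_cosEigenvalue : Tendsto (cosEigenvalue q K) atTop atTop := by
  refine tendsto_atTop.2 fun M => ?_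
  have hlim : Tendsto (fun j : ℕ => ((j : ℝ) + 1) * (Real.pi / 2)) atTop atTop :=
    (tendsto_natCast_atTop_atTop.atTop_add tendsto_const_nhds).atTop_mul_const (by positivity)
  filter_upwards [hlim.eventually_gt_atTop (cosAngle q M K)] with j hj
  exact (hq.lt_cosEigenvalue_iff.2 hj).le

theorem tendsto_sinEigenvalue : Tendsto (sinEigenvalue q K) atTop atTop := by
  refine tendsto_atTop.2 fun M => ?_
  have hlim : Tendsto (fun j : ℕ => ((j : ℝ) + 1) * (Real.pi / 2)) atTop atTop :=
    (tendsto_natCast_atTop_atTop.atTop_add tendsto_const_nhds).atTop_mul_const (by positivity)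
  filter_upwards [hlim.eventually_gt_atTop (sinAngle q M K)] with j hj
  exact (hq.lt_sinEigenvalue_iff.2 hj).le

theorem cosAngle_pos (l : ℝ) : 0 < cosAngle q l K :=
  (hq.sinAngle_pos l hq.K_pos).trans (hq.sinAngle_lt_cosAngle l hq.K_pos.le)

omit hq in
theorem cos_eq_zero_iff_of_pos {x : ℝ} (hx : 0 < x) :
    Real.cos x = 0 ↔ ∃ n : ℕ, x = ((2 * n : ℕ) + 1 : ℝ) * (Real.pi / 2) := by
  rw [Real.cos_eq_zero_iff]
  constructor
  · rintro ⟨k, rfl⟩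
    have hk : 0 ≤ k := by
      by_contra h
      have : (k : ℝ) ≤ -1 := by exact_mod_cast (by omega : k ≤ -1)
      nlinarith [Real.pi_pos]
    lift k to ℕ using hk
    exact ⟨k, by push_cast; ring⟩
  · rintro ⟨n, rfl⟩
    exact ⟨n, by push_cast; ring⟩

omit hq in
theorem sin_eq_zero_iff_of_pos {x : ℝ} (hx : 0 < x) :
    Real.sin x = 0 ↔ ∃ n : ℕ, x = ((2 * n + 1 : ℕ) + 1 : ℝ) * (Real.pi / 2) := by
  rw [Real.sin_eq_zero_iff]
  constructor
  · rintro ⟨k, rfl⟩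
    have hk : 0 < k := by
      by_contra h
      have : (k : ℝ) ≤ 0 := by exact_mod_cast (by omega : k ≤ 0)
      nlinarith [Real.pi_pos]
    lift k to ℕ using hk.le
    refine ⟨k - 1, ?_⟩
    have : 2 * (k - 1) + 1 + 1 = 2 * k := by omega
    rw [← Nat.cast_add_one, this]
    push_cast; ring
  · rintro ⟨n, rfl⟩
    exact ⟨n + 1, by push_cast; ring⟩

/-- Even indices for `c` are the odd multiples of `π/2`, where `c' K = 0`; odd indices for `s` are
the multiples of `π`, where `s K = 0`. -/
theorem finrank_periodic (l : ℝ) [Decidable (∃ n, cosEigenvalue q K (2 * n) = l)]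
    [Decidable (∃ n, sinEigenvalue q K (2 * n + 1) = l)] :
    Module.finrank ℝ (floquetSolutions q (2 * K) 1 l) =
      (if ∃ n, cosEigenvalue q K (2 * n) = l then 1 else 0) +
      (if ∃ n, sinEigenvalue q K (2 * n + 1) = l then 1 else 0) := by
  classical
  have F := hq.isFundamental l
  rw [F.finrank_floquetSolutions hq (by norm_num)]
  refine congrArg₂ (· + ·) (if_congr ?_ rfl rfl) (if_congr ?_ rfl rfl)
  · rw [F.cos_mem_periodic_iff hq, mul_eq_zero, or_iff_right (pruferAmplitude_pos q l _ K).ne',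
      cos_eq_zero_iff_of_pos (hq.cosAngle_pos l)]
    simp only [hq.cosEigenvalue_eq_iff]
  · rw [F.sin_mem_periodic_iff hq, mul_eq_zero, or_iff_right (pruferAmplitude_pos q l _ K).ne',
      sin_eq_zero_iff_of_pos (hq.sinAngle_pos l hq.K_pos)]
    simp only [hq.sinEigenvalue_eq_iff]

theorem finrank_antiperiodic (l : ℝ) [Decidable (∃ n, cosEigenvalue q K (2 * n + 1) = l)]
    [Decidable (∃ n, sinEigenvalue q K (2 * n) = l)] :
    Module.finrank ℝ (floquetSolutions q (2 * K) (-1) l) =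
      (if ∃ n, cosEigenvalue q K (2 * n + 1) = l then 1 else 0) +
      (if ∃ n, sinEigenvalue q K (2 * n) = l then 1 else 0) := by
  classical
  have F := hq.isFundamental l
  rw [F.finrank_floquetSolutions hq (by norm_num)]
  refine congrArg₂ (· + ·) (if_congr ?_ rfl rfl) (if_congr ?_ rfl rfl)
  · rw [F.cos_mem_antiperiodic_iff hq, mul_eq_zero,
      or_iff_right (pruferAmplitude_pos q l _ K).ne', sin_eq_zero_iff_of_pos (hq.cosAngle_pos l)]
    simp only [hq.cosEigenvalue_eq_iff]
  · rw [F.sin_mem_antiperiodic_iff hq, mul_eq_zero,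
      or_iff_right (pruferAmplitude_pos q l _ K).ne',
      cos_eq_zero_iff_of_pos (hq.sinAngle_pos l hq.K_pos)]
    simp only [hq.sinEigenvalue_eq_iff]

theorem cosEigenvalue_zero_lt {j : ℕ} : cosEigenvalue q K 0 < cosEigenvalue q K (j + 1) ∧
    cosEigenvalue q K 0 < sinEigenvalue q K j := by
  have h1 : StrictMono (cosEigenvalue q K) := strictMono_nat_of_lt_succ hq.cosEigenvalue_lt_succ
  refine ⟨h1 (Nat.succ_pos j), ?_⟩
  exact (h1.monotone (Nat.zero_le j)).trans_lt (hq.cosEigenvalue_lt_sinEigenvalue j)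

theorem isHillSequence : IsHillSequence q (2 * K) (periodicEigenvalue q K)
    (antiperiodicEigenvalue q K) where
  periodic μ := by
    classical
    have hu : ∀ n : ℕ, cosEigenvalue q K 0 < cosEigenvalue q K (2 * n + 2) := fun n =>
      (hq.cosEigenvalue_zero_lt (j := 2 * n + 1)).1
    have hv : ∀ n : ℕ, cosEigenvalue q K 0 < sinEigenvalue q K (2 * n + 1) := fun n =>
      (hq.cosEigenvalue_zero_lt (j := 2 * n + 1)).2
    have hpair := encard_pairSeq (u := fun n => cosEigenvalue q K (2 * n + 2))
      (v := fun n => sinEigenvalue q K (2 * n + 1)) (fun n => hq.max_lt_min_add_two (2 * n + 1)) μ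
    have hset := periodicEigenvalue_succ q K
    have h0 : periodicEigenvalue q K 0 = cosEigenvalue q K 0 := rfl
    have hgt : ∀ i, cosEigenvalue q K 0 < periodicEigenvalue q K (i + 1) := fun i => by
      rw [hset, pairSeq]
      split_ifs
      · exact lt_min (hu _) (hv _)
      · exact lt_max_of_lt_left (hu _)
    rw [hq.finrank_periodic]
    -- The lowest eigenvalue has no partner and lies below all pairs; apart from it the sequence is
    -- a shifted pair sequence.
    by_cases hμ : cosEigenvalue q K 0 = μ
    · have h1 : {n | periodicEigenvalue q K n = μ} = {0} := by
        ext i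
        cases i with
        | zero => simp [h0, hμ]
        | succ i => simp [← hμ, (hgt i).ne']
      have h2 : ¬ ∃ n, sinEigenvalue q K (2 * n + 1) = μ := by
        rintro ⟨n, hn⟩
        have := hv n
        linarith
      rw [h1, if_pos ⟨0, hμ⟩, if_neg h2, encard_singleton]; norm_num
    · have h1 : {n | periodicEigenvalue q K n = μ} =
          Nat.succ '' {i | pairSeq (fun n => cosEigenvalue q K (2 * n + 2))
            (fun n => sinEigenvalue q K (2 * n + 1)) i = μ} := by
        ext i
        cases i with
        | zero => simp [h0, hμ]
        | succ i => simp [hset]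
      rw [h1, Nat.succ_injective.encard_image, hpair]
      have h2 : (∃ n, cosEigenvalue q K (2 * n) = μ) ↔ ∃ n, cosEigenvalue q K (2 * n + 2) = μ := by
        constructor
        · rintro ⟨n, hn⟩
          cases n with
          | zero => exact absurd hn hμ
          | succ n => exact ⟨n, hn⟩
        · rintro ⟨n, hn⟩
          exact ⟨n + 1, hn⟩
      simp only [h2]
  antiperiodic μ := by
    classical
    rw [hq.finrank_antiperiodic]
    exact encard_pairSeq (fun n => hq.max_lt_min_add_two (2 * n)) μ
  periodic_lt_antiperiodic n := by
    rw [antiperiodicEigenvalue_even]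
    cases n with
    | zero => exact lt_min (hq.cosEigenvalue_zero_lt (j := 0)).1 (hq.cosEigenvalue_zero_lt (j := 0)).2
    | succ n =>
      rw [show 2 * (n + 1) = 2 * n + 2 by ring, periodicEigenvalue_even]
      exact hq.max_lt_min (2 * n + 1)
  antiperiodic_le n := by
    rw [antiperiodicEigenvalue_even, antiperiodicEigenvalue_odd]
    exact min_le_max
  antiperiodic_lt_periodic n := by
    rw [antiperiodicEigenvalue_odd, periodicEigenvalue_odd]
    exact hq.max_lt_min (2 * n)
  periodic_le n := by
    rw [periodicEigenvalue_odd, periodicEigenvalue_even]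
    exact min_le_max
  periodic_tendsto := by
    refine (tendsto_add_atTop_iff_nat 1).1 ?_
    have h1 : Tendsto (fun n : ℕ => 2 * n + 2) atTop atTop :=
      tendsto_atTop_mono (fun n => by simp only [id]; omega) tendsto_id
    have h2 : Tendsto (fun n : ℕ => 2 * n + 1) atTop atTop :=
      tendsto_atTop_mono (fun n => by simp only [id]; omega) tendsto_id
    have h3 : Tendsto (fun n : ℕ => cosEigenvalue q K (2 * n + 2)) atTop atTop :=
      hq.tendsto_cosEigenvalue.comp h1
    have h4 : Tendsto (fun n : ℕ => sinEigenvalue q K (2 * n + 1)) atTop atTop :=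
      hq.tendsto_sinEigenvalue.comp h2
    exact tendsto_pairSeq h3 h4
  antiperiodic_tendsto := by
    have h1 : Tendsto (fun n : ℕ => 2 * n + 1) atTop atTop :=
      tendsto_atTop_mono (fun n => by simp only [id]; omega) tendsto_id
    have h2 : Tendsto (fun n : ℕ => 2 * n) atTop atTop :=
      tendsto_atTop_mono (fun n => by simp only [id]; omega) tendsto_id
    have h3 : Tendsto (fun n : ℕ => cosEigenvalue q K (2 * n + 1)) atTop atTop :=
      hq.tendsto_cosEigenvalue.comp h1
    have h4 : Tendsto (fun n : ℕ => sinEigenvalue q K (2 * n)) atTop atTop :=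
      hq.tendsto_sinEigenvalue.comp h2
    exact tendsto_pairSeq h3 h4

omit hq in
/-- The `j + 1`-st gap lies between the eigenvalues of index `j + 1` and `j`. -/
theorem spectralGap_eq (j : ℕ) :
    spectralGap (periodicEigenvalue q K) (antiperiodicEigenvalue q K) (j + 1) =
      Ioo (min (cosEigenvalue q K (j + 1)) (sinEigenvalue q K j))
        (max (cosEigenvalue q K (j + 1)) (sinEigenvalue q K j)) := by
  rcases Nat.even_or_odd' j with ⟨n, rfl | rfl⟩
  · rw [spectralGap, if_pos (by simp), Nat.add_sub_cancel, antiperiodicEigenvalue_even,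
      antiperiodicEigenvalue_odd]
  · rw [spectralGap, if_neg (by rw [Nat.not_odd_iff_even]; exact ⟨n + 1, by ring⟩),
      Nat.add_sub_cancel, periodicEigenvalue_odd, periodicEigenvalue_even]

-- Shifting both angles by `nπ` preserves the product, which reduces the sign discussion to a fixed
-- range of quadrants.
omit hq in
theorem cos_mul_sin_sub_nat_mul_pi (a b : ℝ) (n : ℕ) :
    Real.cos a * Real.sin b = Real.cos (a - n * Real.pi) * Real.sin (b - n * Real.pi) := by
  rw [Real.cos_sub_nat_mul_pi, Real.sin_sub_nat_mul_pi]
  have : ((-1 : ℝ) ^ n) * (-1) ^ n = 1 := by rw [← mul_pow]; simp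
  linear_combination (-(Real.cos a * Real.sin b)) * this

/-- Half the discriminant is at most `1` in absolute value exactly on the bands. -/
theorem abs_discr_le_one_iff {l : ℝ} {c c' s s' : ℝ → ℝ} (F : IsFundamental q l c c' s s') :
    |c K * s' K + c' K * s K| ≤ 1 ↔ cosEigenvalue q K 0 ≤ l ∧
      ∀ j, l ∉ Ioo (min (cosEigenvalue q K (j + 1)) (sinEigenvalue q K j))
        (max (cosEigenvalue q K (j + 1)) (sinEigenvalue q K j)) := by
  have G := hq.isFundamental l
  have hc := F.eq_lincomb G.cos K
  have hc' := F.eq_lincomb' G.cos K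
  have hs := F.eq_lincomb G.sin K
  have hs' := F.eq_lincomb' G.sin K
  rw [G.cos_zero, G.cos_zero', one_mul, zero_mul, add_zero] at hc hc'
  rw [G.sin_zero, G.sin_zero', one_mul, zero_mul, zero_add] at hs hs'
  have w := F.wronskian K
  rw [← hc, ← hc', ← hs, ← hs'] at w ⊢
  have hr1 := pruferAmplitude_pos q l (cosAngle q l) K
  have hr2 := pruferAmplitude_pos q l (sinAngle q l) K
  set r₁ := pruferAmplitude q l (cosAngle q l) K
  set r₂ := pruferAmplitude q l (sinAngle q l) K
  have hr := mul_pos hr1 hr2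
  have A1 := hq.sinAngle_pos l hq.K_pos
  have A2 := hq.sinAngle_lt_cosAngle l hq.K_pos.le
  have A3 := hq.cosAngle_lt_sinAngle_add_pi l hq.K_pos.le
  have hE0 : cosEigenvalue q K 0 ≤ l ↔ Real.pi / 2 ≤ cosAngle q l K := by
    rw [← not_lt, hq.lt_cosEigenvalue_iff, not_lt]; norm_num
  -- In terms of the angles at `K`, the index `j + 1` of the even family turns into the level `(j +
  -- 2) π/2`. The two other combinations of inequalities would need one eigenvalue both above and
  -- below `l`.
  have hgap : ∀ j, l ∈ Ioo (min (cosEigenvalue q K (j + 1)) (sinEigenvalue q K j))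
        (max (cosEigenvalue q K (j + 1)) (sinEigenvalue q K j)) ↔
      ((j + 2) * (Real.pi / 2) < cosAngle q l K ∧ sinAngle q l K < (j + 1) * (Real.pi / 2)) ∨
      ((j + 1) * (Real.pi / 2) < sinAngle q l K ∧ cosAngle q l K < (j + 2) * (Real.pi / 2)) := by
    intro j
    have e1 := hq.cosEigenvalue_lt_iff (l := l) (j := j + 1)
    have e2 := hq.lt_cosEigenvalue_iff (l := l) (j := j + 1)
    have e3 := hq.sinEigenvalue_lt_iff (l := l) (j := j)
    have e4 := hq.lt_sinEigenvalue_iff (l := l) (j := j)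
    have hj : ((j + 1 : ℕ) : ℝ) + 1 = j + 2 := by push_cast; ring
    rw [hj] at e1 e2
    rw [mem_Ioo, min_lt_iff, lt_max_iff, ← e1, ← e2, ← e3, ← e4]
    constructor
    · rintro ⟨h1 | h1, h2 | h2⟩
      · linarith
      · exact Or.inl ⟨h1, h2⟩
      · exact Or.inr ⟨h1, h2⟩
      · linarith
    · rintro (h | h)
      · exact ⟨Or.inl h.1, Or.inr h.2⟩
      · exact ⟨Or.inr h.1, Or.inl h.2⟩
  rw [hE0]
  simp only [hgap]
  clear hgap hE0
  -- The Wronskian `c s' - c' s = 1` turns `d = c s' + c' s` into `1 + 2 c' s` and `2 c s' - 1`, so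
  -- `|d| ≤ 1` means `c' s ≤ 0 ≤ c s'`. What remains is a matter of quadrants for `0 < y < x < y +
  -- π`.
  have hiff : |r₁ * Real.sin (cosAngle q l K) * (r₂ * Real.cos (sinAngle q l K)) +
      r₁ * Real.cos (cosAngle q l K) * (r₂ * Real.sin (sinAngle q l K))| ≤ 1 ↔
      Real.cos (cosAngle q l K) * Real.sin (sinAngle q l K) ≤ 0 ∧
      0 ≤ Real.cos (sinAngle q l K) * Real.sin (cosAngle q l K) := by
    rw [abs_le]
    constructor
    · rintro ⟨h1, h2⟩
      constructor
      · by_contra h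
        have := mul_pos hr (not_le.1 h)
        nlinarith
      · by_contra h
        have := mul_pos hr (neg_pos.2 (not_le.1 h))
        nlinarith
    · rintro ⟨h1, h2⟩
      have e1 := mul_nonneg hr.le (neg_nonneg.2 h1)
      have e2 := mul_nonneg hr.le h2
      constructor <;> nlinarith
  rw [hiff]
  clear hiff hc hc' hs hs' w
  generalize cosAngle q l K = x at *
  generalize sinAngle q l K = y at *
  have hπ := Real.pi_pos
  constructor
  · rintro ⟨h1, h2⟩
    refine ⟨?_, fun j hj => ?_⟩
    · by_contra h
      have := mul_pos (Real.cos_pos_of_mem_Ioo (x := x) ⟨by linarith, by linarith⟩)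
        (Real.sin_pos_of_pos_of_lt_pi A1 (by linarith))
      linarith
    · rcases Nat.even_or_odd' j with ⟨n, rfl | rfl⟩
      · rw [cos_mul_sin_sub_nat_mul_pi y x n] at h2
        push_cast at hj
        rcases hj with hj | hj
        · have e1 := Real.cos_pos_of_mem_Ioo (x := y - n * Real.pi)
            ⟨by nlinarith, by nlinarith⟩
          have e2 := Real.sin_pos_of_pos_of_lt_pi (x := x - n * Real.pi - Real.pi)
            (by nlinarith) (by nlinarith)
          rw [Real.sin_sub_pi] at e2
          nlinarith
        · have e1 := Real.cos_neg_of_pi_div_two_lt_of_lt (x := y - n * Real.pi)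
            (by nlinarith) (by nlinarith)
          have e2 := Real.sin_pos_of_pos_of_lt_pi (x := x - n * Real.pi)
            (by nlinarith) (by nlinarith)
          nlinarith
      · rw [cos_mul_sin_sub_nat_mul_pi x y n] at h1
        push_cast at hj
        rcases hj with hj | hj
        · have e1 := Real.sin_pos_of_pos_of_lt_pi (x := y - n * Real.pi)
            (by nlinarith) (by nlinarith)
          have e2 := Real.cos_pos_of_mem_Ioo (x := x - n * Real.pi - Real.pi - Real.pi)
            ⟨by nlinarith, by nlinarith⟩
          rw [Real.cos_sub_pi, Real.cos_sub_pi, neg_neg] at e2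
          nlinarith
        · have e1 := Real.sin_pos_of_pos_of_lt_pi (x := y - n * Real.pi - Real.pi)
            (by nlinarith) (by nlinarith)
          have e2 := Real.cos_pos_of_mem_Ioo (x := x - n * Real.pi - Real.pi)
            ⟨by nlinarith, by nlinarith⟩
          rw [Real.sin_sub_pi] at e1
          rw [Real.cos_sub_pi] at e2
          nlinarith
  · rintro ⟨h1, h2⟩
    -- `j` is the quadrant of `y`. Not being in gap `j` (or above the lowest eigenvalue if `j = 0`)
    -- gives `x ≥ (j + 1) π/2`; not being in gap `j + 1` gives `x ≤ (j + 2) π/2`, unless `y` sits on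
    -- its quadrant boundary.
    obtain ⟨j, hj1, hj2⟩ : ∃ j : ℕ, j * (Real.pi / 2) < y ∧ y ≤ (j + 1) * (Real.pi / 2) := by
      have hpos : 0 < ⌈y / (Real.pi / 2)⌉₊ := Nat.ceil_pos.2 (by positivity)
      refine ⟨⌈y / (Real.pi / 2)⌉₊ - 1, ?_, ?_⟩
      · rw [← lt_div_iff₀ (by positivity)]
        exact Nat.lt_ceil.1 (by omega)
      · rw [← div_le_iff₀ (by positivity), Nat.cast_sub hpos]
        have := Nat.le_ceil (y / (Real.pi / 2))
        push_cast; linarith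
    have hx1 : (j + 1) * (Real.pi / 2) ≤ x := by
      cases j with
      | zero => simpa using h1
      | succ i =>
        have := h2 i
        push_cast at hj1 hj2 ⊢
        by_contra hcon
        exact this (Or.inr ⟨hj1, by linarith⟩)
    have hx2 : x ≤ (j + 2) * (Real.pi / 2) ∨ y = (j + 1) * (Real.pi / 2) := by
      by_contra! hcon
      exact h2 j (Or.inl ⟨hcon.1, lt_of_le_of_ne hj2 hcon.2⟩)
    rcases Nat.even_or_odd' j with ⟨n, rfl | rfl⟩
    · rw [cos_mul_sin_sub_nat_mul_pi x y n, cos_mul_sin_sub_nat_mul_pi y x n]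
      push_cast at hj1 hj2 hx1 hx2
      have e1 := Real.sin_nonneg_of_nonneg_of_le_pi (x := y - n * Real.pi)
        (by nlinarith) (by nlinarith)
      have e2 := Real.cos_nonpos_of_pi_div_two_le_of_le (x := x - n * Real.pi)
        (by nlinarith) (by nlinarith)
      refine ⟨mul_nonpos_of_nonpos_of_nonneg e2 e1, ?_⟩
      rcases hx2 with hx2 | hx2
      · have e3 := Real.cos_nonneg_of_mem_Icc (x := y - n * Real.pi)
          ⟨by nlinarith, by nlinarith⟩
        have e4 := Real.sin_nonneg_of_nonneg_of_le_pi (x := x - n * Real.pi)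
          (by nlinarith) (by nlinarith)
        exact mul_nonneg e3 e4
      · rw [show y - n * Real.pi = Real.pi / 2 by rw [hx2]; ring, Real.cos_pi_div_two]; simp
    · rw [cos_mul_sin_sub_nat_mul_pi x y n, cos_mul_sin_sub_nat_mul_pi y x n]
      push_cast at hj1 hj2 hx1 hx2
      have e3 := Real.cos_nonpos_of_pi_div_two_le_of_le (x := y - n * Real.pi)
          (by nlinarith) (by nlinarith)
      have e4 := Real.sin_nonneg_of_nonneg_of_le_pi (x := x - n * Real.pi - Real.pi)
          (by nlinarith) (by nlinarith)
      rw [Real.sin_sub_pi] at e4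
      refine ⟨?_, by nlinarith⟩
      rcases hx2 with hx2 | hx2
      · have e1 := Real.sin_nonneg_of_nonneg_of_le_pi (x := y - n * Real.pi)
          (by nlinarith) (by nlinarith)
        have e2 := Real.cos_nonneg_of_mem_Icc (x := x - n * Real.pi - Real.pi)
          ⟨by nlinarith, by nlinarith⟩
        rw [Real.cos_sub_pi] at e2
        nlinarith
      · rw [show y - n * Real.pi = Real.pi by rw [hx2]; ring, Real.sin_pi]; simp

end IsEvenPotential
end Lame

namespace Lame

/-! ### Jacobi elliptic functions -/

noncomputable section

/-- The Jacobi elliptic function `cn(x, k) = cos (am(x, k))`. -/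
def jacobiCn (k x : ℝ) : ℝ := Real.cos (jacobiAm k x)

/-- The Jacobi elliptic function `dn(x, k)`. -/
def jacobiDn (k x : ℝ) : ℝ := Real.sqrt (1 - k ^ 2 * jacobiSn k x ^ 2)

end

theorem contDiff_succ_of_hasDerivAt {E : Type*} [NormedAddCommGroup E] [NormedSpace ℝ E]
    {f f' : ℝ → E} {n : ℕ} (h : ∀ x, HasDerivAt f (f' x) x)
    (hf : ContDiff ℝ n f') : ContDiff ℝ (n + 1 : ℕ) f := by
  push_cast
  rw [contDiff_succ_iff_deriv]
  refine ⟨fun x => (h x).differentiableAt, by simp, ?_⟩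
  rwa [show deriv f = f' from funext fun x => (h x).deriv]

theorem ellipticK_pos {k : ℝ} (h0 : 0 < k) (h1 : k < 1) : 0 < ellipticK k := by
  refine intervalIntegral.intervalIntegral_pos_of_pos
    ((ellipticF_integrand_continuous h0 h1).intervalIntegrable _ _) (fun θ => ?_) (by positivity)
  exact one_div_pos.2 (Real.sqrt_pos.2 (ellipticF_radicand_pos h0 h1 θ))

theorem ellipticF_zero (k : ℝ) : ellipticF k 0 = 0 := by simp [ellipticF]

theorem ellipticF_neg (k φ : ℝ) : ellipticF k (-φ) = -ellipticF k φ := by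
  have h := intervalIntegral.integral_comp_neg (a := 0) (b := φ)
    (fun θ : ℝ => 1 / Real.sqrt (1 - k ^ 2 * Real.sin θ ^ 2))
  simp only [Real.sin_neg, neg_sq, neg_zero] at h
  rw [ellipticF, ellipticF, intervalIntegral.integral_symm, ← h]

section

variable {k : ℝ} (h0 : 0 < k) (h1 : k < 1)
include h0 h1

theorem ellipticF_add_pi (φ : ℝ) : ellipticF k (φ + Real.pi) = ellipticF k φ + 2 * ellipticK k := by
  have hint : ∀ a b, IntervalIntegrable
      (fun θ : ℝ => 1 / Real.sqrt (1 - k ^ 2 * Real.sin θ ^ 2)) volume a b := fun a b =>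
    (ellipticF_integrand_continuous h0 h1).intervalIntegrable _ _
  have hper : Function.Periodic
      (fun θ : ℝ => 1 / Real.sqrt (1 - k ^ 2 * Real.sin θ ^ 2)) Real.pi := fun θ => by
    simp [Real.sin_add_pi]
  have e1 := intervalIntegral.integral_add_adjacent_intervals (hint 0 φ) (hint φ (φ + Real.pi))
  have e2 := hper.intervalIntegral_add_eq φ (-(Real.pi / 2))
  have e3 := intervalIntegral.integral_add_adjacent_intervals (hint (-(Real.pi / 2)) 0)
    (hint 0 (-(Real.pi / 2) + Real.pi))
  have e4 := ellipticF_neg k (Real.pi / 2)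
  rw [ellipticF, intervalIntegral.integral_symm, neg_inj] at e4
  rw [show -(Real.pi / 2) + Real.pi = Real.pi / 2 by ring, e4] at e3
  rw [show -(Real.pi / 2) + Real.pi = Real.pi / 2 by ring] at e2
  have hK : ∫ θ in (0 : ℝ)..(Real.pi / 2), 1 / Real.sqrt (1 - k ^ 2 * Real.sin θ ^ 2) =
    ellipticK k := rfl
  have hF : ∫ θ in (0 : ℝ)..φ, 1 / Real.sqrt (1 - k ^ 2 * Real.sin θ ^ 2) = ellipticF k φ := rfl
  have hF' : ellipticF k (Real.pi / 2) = ellipticK k := rfl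
  change ∫ θ in (0 : ℝ)..(φ + Real.pi), 1 / Real.sqrt (1 - k ^ 2 * Real.sin θ ^ 2) = _
  linarith

theorem strictMono_ellipticF : StrictMono (ellipticF k) := by
  refine strictMono_of_deriv_pos fun φ => ?_
  rw [(ellipticF_hasDerivAt h0 h1 φ).deriv]
  exact one_div_pos.2 (Real.sqrt_pos.2 (ellipticF_radicand_pos h0 h1 φ))

theorem jacobiAm_ellipticF (φ : ℝ) : jacobiAm k (ellipticF k φ) = φ :=
  Function.leftInverse_invFun (ellipticF_bijective h0 h1).1 φ

theorem jacobiAm_eq {x φ : ℝ} (h : ellipticF k φ = x) : jacobiAm k x = φ := by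
  rw [← h, jacobiAm_ellipticF h0 h1]

theorem jacobiAm_zero : jacobiAm k 0 = 0 := jacobiAm_eq h0 h1 (ellipticF_zero k)

theorem jacobiAm_ellipticK : jacobiAm k (ellipticK k) = Real.pi / 2 := jacobiAm_eq h0 h1 rfl

theorem jacobiAm_neg (x : ℝ) : jacobiAm k (-x) = -jacobiAm k x :=
  jacobiAm_eq h0 h1 (by rw [ellipticF_neg, ellipticF_jacobiAm h0 h1])

theorem jacobiAm_add (x : ℝ) : jacobiAm k (x + 2 * ellipticK k) = jacobiAm k x + Real.pi :=
  jacobiAm_eq h0 h1 (by rw [ellipticF_add_pi h0 h1, ellipticF_jacobiAm h0 h1])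

theorem strictMono_jacobiAm : StrictMono (jacobiAm k) := fun x y hxy => by
  rwa [← (strictMono_ellipticF h0 h1).lt_iff_lt, ellipticF_jacobiAm h0 h1,
    ellipticF_jacobiAm h0 h1]

theorem continuous_jacobiAm : Continuous (jacobiAm k) :=
  (strictMono_jacobiAm h0 h1).monotone.continuous_of_surjective
    fun φ => ⟨ellipticF k φ, jacobiAm_ellipticF h0 h1 φ⟩

theorem hasDerivAt_jacobiAm (x : ℝ) : HasDerivAt (jacobiAm k) (jacobiDn k x) x := by
  have hpos := Real.sqrt_pos.2 (ellipticF_radicand_pos h0 h1 (jacobiAm k x))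
  have := HasDerivAt.of_local_left_inverse (continuous_jacobiAm h0 h1).continuousAt
    (ellipticF_hasDerivAt h0 h1 (jacobiAm k x)) (one_div_pos.2 hpos).ne'
    (Eventually.of_forall fun y => ellipticF_jacobiAm h0 h1 y)
  rwa [one_div, inv_inv] at this

theorem jacobiDn_pos (x : ℝ) : 0 < jacobiDn k x :=
  Real.sqrt_pos.2 (ellipticF_radicand_pos h0 h1 (jacobiAm k x))

theorem jacobiDn_sq (x : ℝ) : jacobiDn k x ^ 2 = 1 - k ^ 2 * jacobiSn k x ^ 2 :=
  Real.sq_sqrt (ellipticF_radicand_pos h0 h1 (jacobiAm k x)).le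

omit h0 h1 in
theorem jacobiCn_sq (x : ℝ) : jacobiCn k x ^ 2 = 1 - jacobiSn k x ^ 2 := by
  rw [jacobiCn, jacobiSn, Real.cos_sq']

theorem hasDerivAt_jacobiSn (x : ℝ) :
    HasDerivAt (jacobiSn k) (jacobiCn k x * jacobiDn k x) x :=
  (hasDerivAt_jacobiAm h0 h1 x).sin

theorem hasDerivAt_jacobiCn (x : ℝ) :
    HasDerivAt (jacobiCn k) (-jacobiSn k x * jacobiDn k x) x :=
  (hasDerivAt_jacobiAm h0 h1 x).cos

theorem hasDerivAt_jacobiDn (x : ℝ) :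
    HasDerivAt (jacobiDn k) (-k ^ 2 * jacobiSn k x * jacobiCn k x) x := by
  have h := ((((hasDerivAt_jacobiSn h0 h1 x).fun_pow 2).const_mul (k ^ 2)).const_sub 1).sqrt
    (ellipticF_radicand_pos h0 h1 (jacobiAm k x)).ne'
  convert! h using 1
  have hd := (jacobiDn_pos h0 h1 x).ne'
  change _ = _ / (2 * jacobiDn k x)
  rw [eq_div_iff (by positivity)]
  push_cast
  ring

/-- `sn`, `cn`, `dn` form a closed differential system with polynomial right hand sides, so they
gain one derivative simultaneously. -/
theorem contDiff_jacobi (n : ℕ) :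
    ContDiff ℝ n (jacobiSn k) ∧ ContDiff ℝ n (jacobiCn k) ∧ ContDiff ℝ n (jacobiDn k) := by
  induction n with
  | zero =>
    simp only [Nat.cast_zero, contDiff_zero]
    exact ⟨continuous_iff_continuousAt.2 fun x => (hasDerivAt_jacobiSn h0 h1 x).continuousAt,
      continuous_iff_continuousAt.2 fun x => (hasDerivAt_jacobiCn h0 h1 x).continuousAt,
      continuous_iff_continuousAt.2 fun x => (hasDerivAt_jacobiDn h0 h1 x).continuousAt⟩
  | succ n ih =>
    obtain ⟨i1, i2, i3⟩ := ih
    exact ⟨contDiff_succ_of_hasDerivAt (hasDerivAt_jacobiSn h0 h1) (i2.mul i3),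
      contDiff_succ_of_hasDerivAt (hasDerivAt_jacobiCn h0 h1) (i1.neg.mul i3),
      contDiff_succ_of_hasDerivAt (hasDerivAt_jacobiDn h0 h1) ((contDiff_const.mul i1).mul i2)⟩

theorem isEvenPotential_lamePotential (m : ℕ) :
    IsEvenPotential (lamePotential m k) (ellipticK k) (m * (m + 1) * k ^ 2) where
  K_pos := ellipticK_pos h0 h1
  smooth := contDiff_infty.2 fun n => contDiff_const.mul ((contDiff_jacobi h0 h1 n).1.pow 2)
  even x := by simp [lamePotential, jacobiSn, jacobiAm_neg h0 h1]
  periodic x := by simp [lamePotential, jacobiSn, jacobiAm_add h0 h1, Real.sin_add_pi]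
  nonneg x := by unfold lamePotential; positivity
  le x := by
    have : jacobiSn k x ^ 2 ≤ 1 := Real.sin_sq_le_one _
    exact mul_le_of_le_one_right (by positivity) this

theorem jacobiAm_mem_Ioo {x : ℝ} (hx : x ∈ Ioo 0 (ellipticK k)) :
    jacobiAm k x ∈ Ioo 0 (Real.pi / 2) := by
  rw [← jacobiAm_zero h0 h1, ← jacobiAm_ellipticK h0 h1]
  exact ⟨strictMono_jacobiAm h0 h1 hx.1, strictMono_jacobiAm h0 h1 hx.2⟩

theorem jacobiSn_pos {x : ℝ} (hx : x ∈ Ioo 0 (ellipticK k)) : 0 < jacobiSn k x := by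
  have := jacobiAm_mem_Ioo h0 h1 hx
  exact Real.sin_pos_of_pos_of_lt_pi this.1 (by linarith [this.2, Real.pi_pos])

theorem jacobiCn_pos {x : ℝ} (hx : x ∈ Ioo 0 (ellipticK k)) : 0 < jacobiCn k x := by
  have := jacobiAm_mem_Ioo h0 h1 hx
  exact Real.cos_pos_of_mem_Ioo ⟨by linarith [this.1, Real.pi_pos], this.2⟩

theorem jacobiSn_zero : jacobiSn k 0 = 0 := by simp [jacobiSn, jacobiAm_zero h0 h1]

theorem jacobiCn_ellipticK : jacobiCn k (ellipticK k) = 0 := by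
  simp [jacobiCn, jacobiAm_ellipticK h0 h1]

theorem jacobiSn_ellipticK : jacobiSn k (ellipticK k) = 1 := by
  simp [jacobiSn, jacobiAm_ellipticK h0 h1]

/-- `sn ^ 2` is strictly increasing on `[0, K]`. -/
theorem strictMonoOn_jacobiSn_sq :
    StrictMonoOn (fun x => jacobiSn k x ^ 2) (Icc 0 (ellipticK k)) := by
  refine strictMonoOn_of_deriv_pos (convex_Icc _ _) (fun x _ =>
    ((hasDerivAt_jacobiSn h0 h1 x).fun_pow 2).continuousAt.continuousWithinAt) fun x hx => ?_
  rw [interior_Icc] at hx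
  rw [((hasDerivAt_jacobiSn h0 h1 x).fun_pow 2).deriv]
  have h1' := jacobiSn_pos h0 h1 hx
  have h2 := jacobiCn_pos h0 h1 hx
  have h3 := jacobiDn_pos h0 h1 x
  simp only [Nat.add_one_sub_one, pow_one]
  positivity

end
end Lame

namespace Lame

open Polynomial

/-! ### Closed gaps: products of solutions -/

theorem IsPruferAngle.exists_sin_ne_zero {q θ : ℝ → ℝ} {l a b : ℝ} (h : IsPruferAngle q l θ)
    (hab : a < b) : ∃ x ∈ Ioo a b, Real.sin (θ x) ≠ 0 := by
  by_contra! hs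
  obtain ⟨x, hx⟩ := nonempty_Ioo.2 hab
  have hev : (fun x => Real.sin (θ x)) =ᶠ[𝓝 x] fun _ => 0 := by
    filter_upwards [Ioo_mem_nhds hx.1 hx.2] with y hy using hs y hy
  have h1 := (h x).sin.unique ((hasDerivAt_const x (0 : ℝ)).congr_of_eventuallyEq hev)
  have h2 := Real.sin_sq_add_cos_sq (θ x)
  rw [hs x hx] at h1 h2
  simp only [ne_eq, OfNat.ofNat_ne_zero, not_false_eq_true, zero_pow, mul_zero, add_zero,
    mul_one, zero_add] at h1 h2
  rw [h1] at h2
  norm_num at h2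

/-- A third order differential operator lowering the degree of polynomials of degree at most `m`. -/
noncomputable def thirdOrderOp (α₁ α₂ α₃ β₀ β₁ β₂ γ₀ γ₁ δ : ℝ) : ℝ[X] →ₗ[ℝ] ℝ[X] where
  toFun F := (C α₁ * X + C α₂ * X ^ 2 + C α₃ * X ^ 3) * derivative (derivative (derivative F)) +
    (C β₀ + C β₁ * X + C β₂ * X ^ 2) * derivative (derivative F) +
    (C γ₀ + C γ₁ * X) * derivative F + C δ * F
  map_add' F G := by simp only [map_add]; ring
  map_smul' c F := by simp only [derivative_smul, RingHom.id_apply]; simp only [smul_eq_C_mul]; ring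

/-- Only the terms with equal powers of `X` and of the derivative can reach the top degree; when
their sum vanishes the degree drops. -/
theorem coeff_thirdOrderOp {α₁ α₂ α₃ β₀ β₁ β₂ γ₀ γ₁ δ : ℝ} {F : ℝ[X]} {N : ℕ}
    (h : ∀ j, N < j → F.coeff j = 0) :
    (thirdOrderOp α₁ α₂ α₃ β₀ β₁ β₂ γ₀ γ₁ δ F).coeff N =
      (α₃ * N * (N - 1) * (N - 2) + β₂ * N * (N - 1) + γ₁ * N + δ) * F.coeff N := by
  simp only [thirdOrderOp, LinearMap.coe_mk, AddHom.coe_mk, coeff_add, add_mul, mul_assoc,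
    coeff_C_mul]
  rcases N with _ | _ | _ | n
  · simp [coeff_derivative, h]
  · simp [coeff_X_mul, coeff_X_pow_mul', coeff_derivative, h]
  · simp [coeff_X_mul, coeff_X_pow_mul', coeff_derivative, h]; ring
  · simp [coeff_X_mul, coeff_X_pow_mul', coeff_derivative, h]; ring

/-- The operator maps a space of dimension `m + 1` into one of dimension `m`, so it has a kernel. -/
theorem exists_thirdOrderOp_eq_zero {α₁ α₂ α₃ β₀ β₁ β₂ γ₀ γ₁ δ : ℝ} {m : ℕ}
    (h : α₃ * m * (m - 1) * (m - 2) + β₂ * m * (m - 1) + γ₁ * m + δ = 0) :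
    ∃ F : ℝ[X], F ≠ 0 ∧ F.natDegree ≤ m ∧ thirdOrderOp α₁ α₂ α₃ β₀ β₁ β₂ γ₀ γ₁ δ F = 0 := by
  have hmap : ∀ F ∈ degreeLT ℝ (m + 1), thirdOrderOp α₁ α₂ α₃ β₀ β₁ β₂ γ₀ γ₁ δ F ∈ degreeLT ℝ m := by
    intro F hF
    rw [mem_degreeLT, degree_lt_iff_coeff_zero] at hF ⊢
    intro N hN
    rw [coeff_thirdOrderOp fun j hj => hF j (by omega)]
    rcases hN.eq_or_lt with rfl | hN
    · rw [h, zero_mul]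
    · rw [hF N (by omega), mul_zero]
  let T : degreeLT ℝ (m + 1) →ₗ[ℝ] degreeLT ℝ m :=
    (thirdOrderOp α₁ α₂ α₃ β₀ β₁ β₂ γ₀ γ₁ δ).restrict hmap
  have := (degreeLTEquiv ℝ (m + 1)).symm.finiteDimensional
  have := (degreeLTEquiv ℝ m).symm.finiteDimensional
  have hker : LinearMap.ker T ≠ ⊥ := by
    refine LinearMap.ker_ne_bot_of_finrank_lt ?_
    rw [(degreeLTEquiv ℝ (m + 1)).finrank_eq, (degreeLTEquiv ℝ m).finrank_eq]
    simp
  obtain ⟨⟨F, hF⟩, hF1, hF2⟩ := (Submodule.ne_bot_iff _).1 hker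
  refine ⟨F, fun h => hF2 (Subtype.ext h), ?_, ?_⟩
  · rw [mem_degreeLT] at hF
    exact Nat.lt_succ_iff.1 ((natDegree_lt_iff_degree_lt fun h => hF2 (Subtype.ext h)).2 hF)
  · exact congrArg Subtype.val (LinearMap.mem_ker.1 hF1)

/-- Solutions of the equation `y''' = 4 V y' + 2 V' y` satisfied by products of solutions. -/
structure IsProductSol (V V' y y₁ y₂ : ℝ → ℝ) : Prop where
  deriv : ∀ x, HasDerivAt y (y₁ x) x
  deriv₁ : ∀ x, HasDerivAt y₁ (y₂ x) x
  deriv₂ : ∀ x, HasDerivAt y₂ (4 * V x * y₁ x + 2 * V' x * y x) x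

/-- For solutions `f`, `g` the expression `y f' g' - y' (f g)' / 2 + (y'' / 2 - (q - l) y) f g` is
conserved. Its instances for the pairs `cc`, `cs`, `ss` combine to `y` times the squared Wronskian;
`y' 0 = 0` kills the mixed term. -/
theorem IsFundamental.productSol_eq {q : ℝ → ℝ} {l : ℝ} {c c' s s' V' y y₁ y₂ : ℝ → ℝ}
    (F : IsFundamental q l c c' s s') (hV : ∀ x, HasDerivAt q (V' x) x)
    (hy : IsProductSol (fun x => q x - l) V' y y₁ y₂) (h0 : y₁ 0 = 0) :
    ∃ α β : ℝ, ∀ x, y x = α * c x ^ 2 + β * s x ^ 2 := by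
  have key : ∀ f f' g g' : ℝ → ℝ, IsSol q l f f' → IsSol q l g g' → ∀ x,
      y x * (f' x * g' x) - y₁ x * ((f x * g' x + f' x * g x) / 2) +
        (y₂ x / 2 - (q x - l) * y x) * (f x * g x) =
      y 0 * (f' 0 * g' 0) - y₁ 0 * ((f 0 * g' 0 + f' 0 * g 0) / 2) +
        (y₂ 0 / 2 - (q 0 - l) * y 0) * (f 0 * g 0) := by
    intro f f' g g' hf hg x
    have hd : ∀ x, HasDerivAt (fun x => y x * (f' x * g' x) -
        y₁ x * ((f x * g' x + f' x * g x) / 2) +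
        (y₂ x / 2 - (q x - l) * y x) * (f x * g x)) 0 x := fun x => by
      have d1 := (hy.deriv x).fun_mul ((hf.deriv' x).fun_mul (hg.deriv' x))
      have d2 := (hy.deriv₁ x).fun_mul ((((hf.deriv x).fun_mul (hg.deriv' x)).fun_add
        ((hf.deriv' x).fun_mul (hg.deriv x))).div_const 2)
      have d3 := (((hy.deriv₂ x).div_const 2).fun_sub
        (((hV x).sub_const l).fun_mul (hy.deriv x))).fun_mul ((hf.deriv x).fun_mul (hg.deriv x))
      convert! (d1.fun_sub d2).fun_add d3 using 1
      ring
    exact is_const_of_deriv_eq_zero (fun x => (hd x).differentiableAt) (fun x => (hd x).deriv) x 0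
  have hcs := key _ _ _ _ F.cos F.sin
  have hcc := key _ _ _ _ F.cos F.cos
  have hss := key _ _ _ _ F.sin F.sin
  simp only [F.cos_zero, F.cos_zero', F.sin_zero, F.sin_zero', h0] at hcs hcc hss
  refine ⟨y 0, y₂ 0 / 2 - (q 0 - l) * y 0, fun x => ?_⟩
  have w := F.wronskian x
  have e1 := hcs x
  have e2 := hcc x
  have e3 := hss x
  have w2 : (c x * s' x - c' x * s x) ^ 2 = 1 := by rw [w]; norm_num
  linear_combination (c x ^ 2) * e3 - 2 * (c x * s x) * e1 + (s x ^ 2) * e2 - y x * w2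

theorem card_le_natDegree_of_roots {F : ℝ[X]} (S : Finset ℝ) (e : ℝ → ℕ)
    (h : ∀ t ∈ S, e t ≤ F.rootMultiplicity t) (h0 : ∀ t ∈ S, 1 ≤ e t) :
    ∑ t ∈ S, e t ≤ F.natDegree := by
  classical
  refine le_trans ?_ (card_roots' F)
  rw [← Multiset.toFinset_sum_count_eq]
  refine (Finset.sum_le_sum fun t ht => ?_).trans
    (Finset.sum_le_sum_of_subset (f := fun t => F.roots.count t) fun t ht => ?_)
  · rw [count_roots]; exact h t ht
  · rw [Multiset.mem_toFinset, ← Multiset.count_pos, count_roots]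
    exact (h0 t ht).trans (h t ht)

section

variable {k : ℝ} (h0 : 0 < k) (h1 : k < 1)
include h0 h1

theorem hasDerivAt_eval_jacobiSn_sq (P : ℝ[X]) (x : ℝ) :
    HasDerivAt (fun x => P.eval (jacobiSn k x ^ 2))
      ((derivative P).eval (jacobiSn k x ^ 2) *
        (2 * (jacobiSn k x * jacobiCn k x * jacobiDn k x))) x := by
  convert! (P.hasDerivAt (jacobiSn k x ^ 2)).comp x
    ((hasDerivAt_jacobiSn h0 h1 x).fun_pow 2) using 1
  push_cast; ring

theorem hasDerivAt_jacobi_prod (x : ℝ) :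
    HasDerivAt (fun x => jacobiSn k x * jacobiCn k x * jacobiDn k x)
      (1 - 2 * (1 + k ^ 2) * jacobiSn k x ^ 2 + 3 * k ^ 2 * (jacobiSn k x ^ 2) ^ 2) x := by
  convert! ((hasDerivAt_jacobiSn h0 h1 x).fun_mul (hasDerivAt_jacobiCn h0 h1 x)).fun_mul
    (hasDerivAt_jacobiDn h0 h1 x) using 1
  have hC := jacobiCn_sq (k := k) x
  have hD := jacobiDn_sq h0 h1 x
  generalize jacobiSn k x = S at *
  generalize jacobiCn k x = C at *
  generalize jacobiDn k x = D at *
  linear_combination (-D ^ 2 + k ^ 2 * S ^ 2) * hC + (-1 + 2 * S ^ 2) * hD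

/-- A polynomial in `sn ^ 2` solving the equation of the products of solutions. -/
theorem exists_polynomial_productSol (m : ℕ) (l : ℝ) :
    ∃ F : ℝ[X], F ≠ 0 ∧ F.natDegree ≤ m ∧ ∃ V' y₁ y₂ : ℝ → ℝ,
      (∀ x, HasDerivAt (lamePotential m k) (V' x) x) ∧
      (∀ x, y₁ x = (derivative F).eval (jacobiSn k x ^ 2) *
        (2 * (jacobiSn k x * jacobiCn k x * jacobiDn k x))) ∧
      IsProductSol (fun x => lamePotential m k x - l) V'
        (fun x => F.eval (jacobiSn k x ^ 2)) y₁ y₂ := by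
  set M : ℝ := m * (m + 1) * k ^ 2 with hM
  -- The coefficients come from substituting `t = sn²` in `y''' = 4 (q - l) y' + 2 q' y` and
  -- cancelling `t' = 2 sn cn dn`; the top coefficient vanishes at degree `m` because `M = m (m + 1)
  -- k²`.
  obtain ⟨F, hF0, hFm, hF⟩ := exists_thirdOrderOp_eq_zero (m := m) (α₁ := 4)
    (α₂ := -4 * (1 + k ^ 2)) (α₃ := 4 * k ^ 2) (β₀ := 6) (β₁ := -12 * (1 + k ^ 2))
    (β₂ := 18 * k ^ 2) (γ₀ := -4 * (1 + k ^ 2) + 4 * l) (γ₁ := 12 * k ^ 2 - 4 * M) (δ := -2 * M)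
    (by rw [hM]; ring)
  have hE : ∀ t : ℝ, (4 * t - 4 * (1 + k ^ 2) * t ^ 2 + 4 * k ^ 2 * t ^ 3) *
      (derivative (derivative (derivative F))).eval t +
      (6 - 12 * (1 + k ^ 2) * t + 18 * k ^ 2 * t ^ 2) * (derivative (derivative F)).eval t +
      (-4 * (1 + k ^ 2) + 4 * l + (12 * k ^ 2 - 4 * M) * t) * (derivative F).eval t -
      2 * M * F.eval t = 0 := fun t => by
    have := congrArg (eval t) hF
    simp only [thirdOrderOp, LinearMap.coe_mk, AddHom.coe_mk, eval_add, eval_mul, eval_C, eval_X,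
      eval_pow, eval_zero] at this
    linear_combination this
  refine ⟨F, hF0, hFm, fun x => M * (2 * (jacobiSn k x * jacobiCn k x * jacobiDn k x)), _,
    fun x => (derivative (derivative F)).eval (jacobiSn k x ^ 2) *
      (4 * (jacobiSn k x ^ 2 * (1 - jacobiSn k x ^ 2) * (1 - k ^ 2 * jacobiSn k x ^ 2))) +
      (derivative F).eval (jacobiSn k x ^ 2) *
      (2 * (1 - 2 * (1 + k ^ 2) * jacobiSn k x ^ 2 + 3 * k ^ 2 * (jacobiSn k x ^ 2) ^ 2)),
    fun x => ?_, fun x => rfl, ⟨hasDerivAt_eval_jacobiSn_sq h0 h1 F, fun x => ?_, fun x => ?_⟩⟩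
  · convert! ((hasDerivAt_jacobiSn h0 h1 x).fun_pow 2).const_mul M using 1
    push_cast; ring
  · convert! (hasDerivAt_eval_jacobiSn_sq h0 h1 (derivative F) x).fun_mul
      ((hasDerivAt_jacobi_prod h0 h1 x).const_mul 2) using 1
    have hC := jacobiCn_sq (k := k) x
    have hD := jacobiDn_sq h0 h1 x
    rw [← hC, ← hD]
    ring
  · have ht := (hasDerivAt_jacobiSn h0 h1 x).fun_pow 2
    have hp := ((ht.fun_mul (ht.const_sub 1)).fun_mul
      ((ht.const_mul (k ^ 2)).const_sub 1)).const_mul 4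
    have hp' := (((ht.const_mul (2 * (1 + k ^ 2))).const_sub 1).fun_add
      ((ht.fun_pow 2).const_mul (3 * k ^ 2))).const_mul 2
    convert! ((hasDerivAt_eval_jacobiSn_sq h0 h1 (derivative (derivative F)) x).fun_mul hp).fun_add
      ((hasDerivAt_eval_jacobiSn_sq h0 h1 (derivative F) x).fun_mul hp') using 1
    have := hE (jacobiSn k x ^ 2)
    have hV : lamePotential m k x = M * jacobiSn k x ^ 2 := rfl
    rw [hV]
    push_cast
    linear_combination (-(2 * (jacobiSn k x * jacobiCn k x * jacobiDn k x))) * this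

/-- A simple gap edge with even eigenfunction belongs to one of the first `m` gaps. -/
theorem le_of_cosEigenvalue_ne_sinEigenvalue {m j : ℕ}
    (hne : cosEigenvalue (lamePotential m k) (ellipticK k) (j + 1) ≠
      sinEigenvalue (lamePotential m k) (ellipticK k) j) : j + 1 ≤ m := by
  have hq := isEvenPotential_lamePotential h0 h1 m
  set q := lamePotential m k
  set K := ellipticK k
  set l := cosEigenvalue q K (j + 1) with hl
  have hK := hq.K_pos
  have hπ := Real.pi_pos
  have hθK : cosAngle q l K = (j + 2) * (Real.pi / 2) := by
    rw [hl, hq.cosAngle_cosEigenvalue]; push_cast; ring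
  have hφK : sinAngle q l K ≠ (j + 1) * (Real.pi / 2) := fun h =>
    hne (hq.sinEigenvalue_eq_iff.2 h).symm
  have F := hq.isFundamental l
  set r := pruferAmplitude q l (cosAngle q l)
  set r' := pruferAmplitude q l (sinAngle q l)
  have hcos : Real.sin (cosAngle q l K) * Real.cos (cosAngle q l K) = 0 := by
    have : Real.sin (2 * cosAngle q l K) = 0 := by
      rw [hθK, show 2 * ((j + 2) * (Real.pi / 2)) = ((j + 2 : ℕ) : ℝ) * Real.pi by
        push_cast; ring]
      exact Real.sin_nat_mul_pi _
    rw [Real.sin_two_mul] at this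
    linarith
  -- Between `j π/2` and `(j + 2) π/2` the only multiple of `π/2` is `(j + 1) π/2`, excluded because
  -- the two edges differ.
  have hsin : Real.sin (sinAngle q l K) * Real.cos (sinAngle q l K) ≠ 0 := by
    intro h
    have h2 : Real.sin (2 * sinAngle q l K) = 0 := by rw [Real.sin_two_mul]; linarith
    obtain ⟨i, hi⟩ := Real.sin_eq_zero_iff.1 h2
    have A2 := hq.sinAngle_lt_cosAngle l hK.le
    have A3 := hq.cosAngle_lt_sinAngle_add_pi l hK.le
    have e1 : (i : ℝ) < j + 2 := by
      by_contra hcon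
      nlinarith [not_lt.1 hcon]
    have e2 : (j : ℝ) < i := by
      by_contra hcon
      nlinarith [not_lt.1 hcon]
    have e3 : i = j + 1 := by
      have e1' : i < j + 2 := by exact_mod_cast e1
      have e2' : (j : ℤ) < i := by exact_mod_cast e2
      omega
    rw [e3] at hi
    push_cast at hi
    exact hφK (by linarith)
  obtain ⟨P, hP0, hPm, V', y₁, y₂, hV', hy₁, hy⟩ := exists_polynomial_productSol h0 h1 m l
  obtain ⟨α, β, hαβ⟩ := F.productSol_eq hV' hy (by rw [hy₁, jacobiSn_zero h0 h1]; ring)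
  have hy₁' : ∀ x, y₁ x = α * (2 * (r x * Real.sin (cosAngle q l x)) *
      (r x * Real.cos (cosAngle q l x))) + β * (2 * (r' x * Real.sin (sinAngle q l x)) *
      (r' x * Real.cos (sinAngle q l x))) := fun x => by
    have d1 := ((F.cos.deriv x).fun_pow 2).const_mul α
    have d2 := ((F.sin.deriv x).fun_pow 2).const_mul β
    have d3 := hy.deriv x
    rw [show (fun x => P.eval (jacobiSn k x ^ 2)) = _ from funext hαβ] at d3
    rw [d3.unique (d1.fun_add d2)]
    push_cast; ring
  -- The derivative of `P(sn²)` vanishes at `K` since `cn K = 0`; `c c'` vanishes there too, but `s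
  -- s'` does not.
  have hβ : β = 0 := by
    have h := hy₁' K
    rw [hy₁, jacobiCn_ellipticK h0 h1] at h
    have hr' := pruferAmplitude_pos q l (sinAngle q l) K
    have h2 : β * (2 * r' K ^ 2 * (Real.sin (sinAngle q l K) * Real.cos (sinAngle q l K))) = 0 := by
      linear_combination -h - α * (2 * r K ^ 2) * hcos
    exact (mul_eq_zero.1 h2).resolve_right (mul_ne_zero (by positivity) hsin)
  subst hβ
  have hroot : ∀ x, Real.sin (cosAngle q l x) = 0 → P.eval (jacobiSn k x ^ 2) = 0 := fun x hx => by
    have := hαβ x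
    simp only [hx, mul_zero, zero_mul, add_zero, ne_eq, OfNat.ofNat_ne_zero, not_false_eq_true,
      zero_pow] at this
    exact this
  have hroot' : ∀ x ∈ Ioo 0 K, Real.sin (cosAngle q l x) = 0 →
      (derivative P).eval (jacobiSn k x ^ 2) = 0 := fun x hx hx0 => by
    have h := hy₁' x
    rw [hx0, hy₁] at h
    simp only [mul_zero, zero_mul, add_zero] at h
    refine (mul_eq_zero.1 h).resolve_right ?_
    have := jacobiSn_pos h0 h1 hx
    have := jacobiCn_pos h0 h1 hx
    have := jacobiDn_pos h0 h1 x
    positivity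
  have hcont := (hq.isPruferAngle_cosAngle l).continuous
  -- The angle of `c` runs from `π/2` to `(j + 2) π/2` and so passes `(i + 1) π` in the interior
  -- exactly for `2 i < j`. Each such zero of `c` is a double root of `P`.
  have hz : ∀ i : ℕ, 2 * i < j → ∃ x ∈ Ioo 0 K, cosAngle q l x = (i + 1) * Real.pi := fun i hi => by
    refine intermediate_value_Ioo hK.le hcont.continuousOn ?_
    rw [hq.cosAngle_zero, hθK]
    have : (2 * i + 1 : ℝ) ≤ j := by exact_mod_cast hi
    have : (0 : ℝ) ≤ i := i.cast_nonneg
    constructor <;> nlinarith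
  choose! z hz1 hz2 using hz
  have hzsin : ∀ i : ℕ, 2 * i < j → Real.sin (cosAngle q l (z i)) = 0 := fun i hi => by
    rw [hz2 i hi, ← Nat.cast_add_one]; exact Real.sin_nat_mul_pi _
  have hSK : jacobiSn k K = 1 := jacobiSn_ellipticK h0 h1
  have hmono := strictMonoOn_jacobiSn_sq h0 h1
  have hinj : InjOn (fun i => jacobiSn k (z i) ^ 2) {i | 2 * i < j} := fun i hi i' hi' h => by
    have h2 := hmono.injOn (Ioo_subset_Icc_self (hz1 i hi)) (Ioo_subset_Icc_self (hz1 i' hi')) h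
    have h3 := hz2 i hi
    rw [h2, hz2 i' hi'] at h3
    have := mul_right_cancel₀ hπ.ne' h3
    exact_mod_cast (add_right_cancel this).symm
  set I := Finset.range ((j + 1) / 2) with hI
  have hIj : ∀ i ∈ I, 2 * i < j := fun i hi => by rw [hI, Finset.mem_range] at hi; omega
  have hlt1 : ∀ i ∈ I, jacobiSn k (z i) ^ 2 < 1 := fun i hi => by
    have := hmono (Ioo_subset_Icc_self (hz1 i (hIj i hi))) ⟨hK.le, le_rfl⟩ (hz1 i (hIj i hi)).2
    simp only [hSK, one_pow] at this
    exact this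
  set S := I.image fun i => jacobiSn k (z i) ^ 2 with hS
  have hScard : S.card = (j + 1) / 2 := by
    rw [hS, Finset.card_image_of_injOn (fun i hi i' hi' h => hinj (hIj i hi) (hIj i' hi') h), hI,
      Finset.card_range]
  have hS2 : ∀ t ∈ S, 2 ≤ P.rootMultiplicity t := fun t ht => by
    obtain ⟨i, hi, rfl⟩ := Finset.mem_image.1 ht
    exact (one_lt_rootMultiplicity_iff_isRoot hP0).2 ⟨hroot _ (hzsin i (hIj i hi)),
      hroot' _ (hz1 i (hIj i hi)) (hzsin i (hIj i hi))⟩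
  -- For even `j` there is one more root `t = 1`, from the zero of `c` at `K`, counted once since
  -- `sn²` is stationary there. In both cases the total is `j + 1`.
  rcases Nat.even_or_odd' j with ⟨n, hn | hn⟩
  · have h1S : (1 : ℝ) ∉ S := fun h => by
      obtain ⟨i, hi, h⟩ := Finset.mem_image.1 h
      exact (hlt1 i hi).ne h
    have hK0 : P.eval 1 = 0 := by
      have := hroot K (by
        rw [hθK, hn, show (((2 * n : ℕ) : ℝ) + 2) * (Real.pi / 2) = ((n + 1 : ℕ) : ℝ) * Real.pi by
          push_cast; ring]
        exact Real.sin_nat_mul_pi _)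
      rwa [hSK, one_pow] at this
    have := card_le_natDegree_of_roots (insert 1 S) (fun t => if t = 1 then 1 else 2)
      (fun t ht => by
        split_ifs with h
        · rw [h]; exact (rootMultiplicity_pos hP0).2 hK0
        · exact hS2 t ((Finset.mem_insert.1 ht).resolve_left h))
      (fun t _ => by split_ifs <;> norm_num)
    rw [Finset.sum_insert h1S, if_pos rfl, Finset.sum_congr rfl (g := fun _ => 2)
      (fun t ht => if_neg (by rintro rfl; exact h1S ht)), Finset.sum_const, hScard] at this
    simp only [smul_eq_mul] at this
    omega
  · have := card_le_natDegree_of_roots S (fun _ => 2) hS2 (fun _ _ => by norm_num)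
    rw [Finset.sum_const, hScard] at this
    simp only [smul_eq_mul] at this
    omega

end
end Lame

namespace Lame

open Polynomial

/-! ### Open gaps: Lamé functions -/

/-- A second order differential operator preserving the polynomials of degree at most `d`. -/
noncomputable def secondOrderOp (α₁ α₂ α₃ β₀ β₁ β₂ γ₀ γ₁ : ℝ) : ℝ[X] →ₗ[ℝ] ℝ[X] where
  toFun P := (C α₁ * X + C α₂ * X ^ 2 + C α₃ * X ^ 3) * derivative (derivative P) +
    (C β₀ + C β₁ * X + C β₂ * X ^ 2) * derivative P + (C γ₀ + C γ₁ * X) * P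
  map_add' F G := by simp only [map_add]; ring
  map_smul' c F := by
    simp only [derivative_smul, RingHom.id_apply]
    simp only [smul_eq_C_mul]
    ring

theorem coeff_secondOrderOp_succ {α₁ α₂ α₃ β₀ β₁ β₂ γ₀ γ₁ : ℝ} {P : ℝ[X]} {N : ℕ}
    (h : ∀ j, N < j → P.coeff j = 0) :
    (secondOrderOp α₁ α₂ α₃ β₀ β₁ β₂ γ₀ γ₁ P).coeff (N + 1) =
      (α₃ * N * (N - 1) + β₂ * N + γ₁) * P.coeff N := by
  simp only [secondOrderOp, LinearMap.coe_mk, AddHom.coe_mk, coeff_add, add_mul, mul_assoc,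
    coeff_C_mul]
  rcases N with _ | _ | n
  · simp [coeff_X_pow_mul', coeff_derivative, h]
  · simp [coeff_X_mul, coeff_X_pow_mul', coeff_derivative, h]
  · simp [coeff_X_mul, coeff_X_pow_mul', coeff_derivative, h]; ring

/-- The Fredholm alternative: the condition on `d` makes the polynomials of degree at most `d` an
invariant finite-dimensional space. -/
theorem secondOrderOp_dichotomy {α₁ α₂ α₃ β₀ β₁ β₂ γ₀ γ₁ : ℝ} {d : ℕ}
    (h : α₃ * d * (d - 1) + β₂ * d + γ₁ = 0) :
    (∃ P : ℝ[X], P ≠ 0 ∧ secondOrderOp α₁ α₂ α₃ β₀ β₁ β₂ γ₀ γ₁ P = 0) ∨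
    ∀ R : ℝ[X], R.natDegree ≤ d → ∃ P, secondOrderOp α₁ α₂ α₃ β₀ β₁ β₂ γ₀ γ₁ P = R := by
  have hmap : ∀ F ∈ degreeLT ℝ (d + 1),
      secondOrderOp α₁ α₂ α₃ β₀ β₁ β₂ γ₀ γ₁ F ∈ degreeLT ℝ (d + 1) := by
    intro F hF
    rw [mem_degreeLT, degree_lt_iff_coeff_zero] at hF ⊢
    intro N hN
    obtain ⟨M, rfl⟩ : ∃ M, N = M + 1 := ⟨N - 1, by omega⟩
    rw [coeff_secondOrderOp_succ fun j hj => hF j (by omega)]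
    rcases (Nat.le_of_succ_le_succ hN).eq_or_lt with rfl | hM
    · rw [h, zero_mul]
    · rw [hF M hM, mul_zero]
  let T : degreeLT ℝ (d + 1) →ₗ[ℝ] degreeLT ℝ (d + 1) :=
    (secondOrderOp α₁ α₂ α₃ β₀ β₁ β₂ γ₀ γ₁).restrict hmap
  have := (degreeLTEquiv ℝ (d + 1)).symm.finiteDimensional
  by_cases hker : LinearMap.ker T = ⊥
  · right
    intro R hR
    have hRmem : R ∈ degreeLT ℝ (d + 1) :=
      mem_degreeLT.2 (degree_le_natDegree.trans_lt (by exact_mod_cast Nat.lt_succ_of_le hR))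
    obtain ⟨P, hP⟩ := (LinearMap.injective_iff_surjective.1 (LinearMap.ker_eq_bot.1 hker)) ⟨R, hRmem⟩
    exact ⟨P, congrArg Subtype.val hP⟩
  · left
    obtain ⟨⟨P, hP⟩, hP1, hP2⟩ := (Submodule.ne_bot_iff _).1 hker
    exact ⟨P, fun h => hP2 (Subtype.ext h), congrArg Subtype.val (LinearMap.mem_ker.1 hP1)⟩

/-- Sine and product change sign at the same points `π, …, nπ` and are both nonnegative to the left
of `π`. -/
theorem sin_mul_prod_nonneg (n : ℕ) {θ : ℝ} (h0 : 0 ≤ θ) (h1 : θ ≤ (n + 1) * Real.pi) :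
    0 ≤ Real.sin θ * ∏ i ∈ Finset.range n, ((i + 1) * Real.pi - θ) := by
  induction n with
  | zero =>
    simp only [Finset.range_zero, Finset.prod_empty, mul_one]
    exact Real.sin_nonneg_of_nonneg_of_le_pi h0 (by simpa using h1)
  | succ n ih =>
    rcases le_or_gt θ ((n + 1) * Real.pi) with h | h
    · rw [Finset.prod_range_succ, ← mul_assoc]
      exact mul_nonneg (ih h) (sub_nonneg.2 h)
    · have e1 : ∏ i ∈ Finset.range (n + 1), ((i + 1) * Real.pi - θ) =
          (-1) ^ (n + 1) * ∏ i ∈ Finset.range (n + 1), (θ - (i + 1) * Real.pi) := by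
        rw [← Finset.card_range (n + 1), ← Finset.prod_const, Finset.card_range,
          ← Finset.prod_mul_distrib]
        exact Finset.prod_congr rfl fun i _ => by ring
      have e2 : Real.sin (θ - (n + 1 : ℕ) * Real.pi) = (-1) ^ (n + 1) * Real.sin θ :=
        Real.sin_sub_nat_mul_pi _ _
      have e3 : 0 ≤ Real.sin (θ - (n + 1 : ℕ) * Real.pi) := by
        refine Real.sin_nonneg_of_nonneg_of_le_pi ?_ ?_ <;> push_cast at h1 ⊢ <;> nlinarith
      rw [e1, ← mul_assoc, mul_comm (Real.sin θ), ← e2]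
      refine mul_nonneg e3 (Finset.prod_nonneg fun i hi => ?_)
      have : (i : ℝ) ≤ n := by exact_mod_cast Nat.lt_succ_iff.1 (Finset.mem_range.1 hi)
      nlinarith [Real.pi_pos]

noncomputable section

/-- The factor `sn ^ a * cn ^ b * dn ^ e` of a Lamé function. -/
def lameFactor (k : ℝ) (a b e : ℕ) (x : ℝ) : ℝ :=
  jacobiSn k x ^ a * jacobiCn k x ^ b * jacobiDn k x ^ e

/-- The derivative of `lameFactor k a b e` for `a b e ≤ 1`. -/
def lameFactorDeriv (k : ℝ) (a b e : ℕ) (x : ℝ) : ℝ :=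
  a * (jacobiCn k x * jacobiDn k x) * jacobiCn k x ^ b * jacobiDn k x ^ e -
  b * jacobiSn k x ^ a * (jacobiSn k x * jacobiDn k x) * jacobiDn k x ^ e -
  e * k ^ 2 * jacobiSn k x ^ a * jacobiCn k x ^ b * (jacobiSn k x * jacobiCn k x)

end

section

variable {k : ℝ} (h0 : 0 < k) (h1 : k < 1)
include h0 h1

theorem hasDerivAt_lameFactor {a b e : ℕ} (ha : a ≤ 1) (hb : b ≤ 1) (he : e ≤ 1) (x : ℝ) :
    HasDerivAt (lameFactor k a b e) (lameFactorDeriv k a b e x) x := by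
  have hS := hasDerivAt_jacobiSn h0 h1 x
  have hC := hasDerivAt_jacobiCn h0 h1 x
  have hD := hasDerivAt_jacobiDn h0 h1 x
  convert! ((hS.fun_pow a).fun_mul (hC.fun_pow b)).fun_mul (hD.fun_pow e) using 1
  unfold lameFactorDeriv
  interval_cases a <;> interval_cases b <;> interval_cases e <;> simp <;> ring

theorem hasDerivAt_lameFactorDeriv {a b e : ℕ} (ha : a ≤ 1) (hb : b ≤ 1) (he : e ≤ 1) (x : ℝ) :
    HasDerivAt (lameFactorDeriv k a b e) (lameFactor k a b e x *
      (a * (-(1 + k ^ 2) + 2 * k ^ 2 * jacobiSn k x ^ 2) + b * (-1 + 2 * k ^ 2 * jacobiSn k x ^ 2) +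
        e * (-k ^ 2 + 2 * k ^ 2 * jacobiSn k x ^ 2) - 2 * a * b * (1 - k ^ 2 * jacobiSn k x ^ 2) -
        2 * a * e * k ^ 2 * (1 - jacobiSn k x ^ 2) + 2 * b * e * k ^ 2 * jacobiSn k x ^ 2)) x := by
  have hS := hasDerivAt_jacobiSn h0 h1 x
  have hC := hasDerivAt_jacobiCn h0 h1 x
  have hD := hasDerivAt_jacobiDn h0 h1 x
  convert! (((((hC.fun_mul hD).const_mul (a : ℝ)).fun_mul (hC.fun_pow b)).fun_mul
    (hD.fun_pow e)).fun_sub ((((hS.fun_pow a).const_mul (b : ℝ)).fun_mul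
    (hS.fun_mul hD)).fun_mul (hD.fun_pow e))).fun_sub ((((hS.fun_pow a).const_mul
    ((e : ℝ) * k ^ 2)).fun_mul (hC.fun_pow b)).fun_mul (hS.fun_mul hC)) using 1
  unfold lameFactor
  have eC := jacobiCn_sq (k := k) x
  have eD := jacobiDn_sq h0 h1 x
  generalize jacobiSn k x = S at *
  generalize jacobiCn k x = C at *
  generalize jacobiDn k x = D at *
  interval_cases a <;> interval_cases b <;> interval_cases e <;> simp <;> grind

/-- Multiplied by `sn cn dn`, the logarithmic derivative of the factor is a polynomial in `sn²`;
this makes the cross term of the Lamé equation polynomial. -/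
theorem lameFactorDeriv_mul {a b e : ℕ} (ha : a ≤ 1) (hb : b ≤ 1) (he : e ≤ 1) (x : ℝ) :
    lameFactorDeriv k a b e x * (jacobiSn k x * jacobiCn k x * jacobiDn k x) =
      lameFactor k a b e x * (a * ((1 - jacobiSn k x ^ 2) * (1 - k ^ 2 * jacobiSn k x ^ 2)) -
        b * (jacobiSn k x ^ 2 * (1 - k ^ 2 * jacobiSn k x ^ 2)) -
        e * k ^ 2 * (jacobiSn k x ^ 2 * (1 - jacobiSn k x ^ 2))) := by
  rw [← jacobiCn_sq (k := k) x, ← jacobiDn_sq h0 h1 x]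
  unfold lameFactorDeriv lameFactor
  interval_cases a <;> interval_cases b <;> interval_cases e <;> simp <;> ring

end

noncomputable section

/-- The Lamé equation for `lameFactor k a b e * P(sn ^ 2)` as an operator on `P`. -/
def lamePolyOp (k : ℝ) (m : ℕ) (l : ℝ) (a b e : ℕ) : ℝ[X] →ₗ[ℝ] ℝ[X] :=
  secondOrderOp 4 (-4 * (1 + k ^ 2)) (4 * k ^ 2) (2 + 4 * a)
    (-4 * (1 + k ^ 2) - 4 * (a * (1 + k ^ 2) + b + e * k ^ 2))
    (6 * k ^ 2 + 4 * k ^ 2 * (a + b + e))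
    (-a * (1 + k ^ 2) - b - e * k ^ 2 - 2 * a * b - 2 * a * e * k ^ 2 + l)
    (2 * k ^ 2 * (a + b + e) + 2 * k ^ 2 * (a * b + a * e + b * e) - m * (m + 1) * k ^ 2)

/-- The function `lameFactor k a b e * P(sn ^ 2)`. -/
def lameFunction (k : ℝ) (a b e : ℕ) (P : ℝ[X]) (x : ℝ) : ℝ :=
  lameFactor k a b e x * P.eval (jacobiSn k x ^ 2)

/-- The derivative of `lameFunction`. -/
def lameFunctionDeriv (k : ℝ) (a b e : ℕ) (P : ℝ[X]) (x : ℝ) : ℝ :=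
  lameFactorDeriv k a b e x * P.eval (jacobiSn k x ^ 2) +
    lameFactor k a b e x * ((derivative P).eval (jacobiSn k x ^ 2) *
      (2 * (jacobiSn k x * jacobiCn k x * jacobiDn k x)))

end

section

variable {k : ℝ} (h0 : 0 < k) (h1 : k < 1)
include h0 h1

theorem hasDerivAt_lameFunction {a b e : ℕ} (ha : a ≤ 1) (hb : b ≤ 1) (he : e ≤ 1) (P : ℝ[X])
    (x : ℝ) : HasDerivAt (lameFunction k a b e P) (lameFunctionDeriv k a b e P x) x :=
  (hasDerivAt_lameFactor h0 h1 ha hb he x).fun_mul (hasDerivAt_eval_jacobiSn_sq h0 h1 P x)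

theorem hasDerivAt_lameFunctionDeriv {a b e : ℕ} (ha : a ≤ 1) (hb : b ≤ 1) (he : e ≤ 1) (m : ℕ)
    (l : ℝ) (P : ℝ[X]) (x : ℝ) : HasDerivAt (lameFunctionDeriv k a b e P)
      (lameFunction k a b e (lamePolyOp k m l a b e P) x +
        (lamePotential m k x - l) * lameFunction k a b e P x) x := by
  convert! ((hasDerivAt_lameFactorDeriv h0 h1 ha hb he x).fun_mul
    (hasDerivAt_eval_jacobiSn_sq h0 h1 P x)).fun_add
    ((hasDerivAt_lameFactor h0 h1 ha hb he x).fun_mul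
      ((hasDerivAt_eval_jacobiSn_sq h0 h1 (derivative P) x).fun_mul
        ((hasDerivAt_jacobi_prod h0 h1 x).const_mul 2))) using 1
  simp only [lameFunction, lamePolyOp, secondOrderOp, LinearMap.coe_mk, AddHom.coe_mk, eval_add,
    eval_mul, eval_C, eval_X, eval_pow, lamePotential]
  have hσ := lameFactorDeriv_mul h0 h1 ha hb he x
  have hp : (jacobiSn k x * jacobiCn k x * jacobiDn k x) ^ 2 =
      jacobiSn k x ^ 2 * (1 - jacobiSn k x ^ 2) * (1 - k ^ 2 * jacobiSn k x ^ 2) := by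
    rw [← jacobiCn_sq (k := k) x, ← jacobiDn_sq h0 h1 x]; ring
  linear_combination (-4 * (derivative P).eval (jacobiSn k x ^ 2)) * hσ -
    4 * lameFactor k a b e x * (derivative (derivative P)).eval (jacobiSn k x ^ 2) * hp

theorem isSol_lameFunction {a b e : ℕ} (ha : a ≤ 1) (hb : b ≤ 1) (he : e ≤ 1) {m : ℕ}
    {l : ℝ} {P : ℝ[X]} (hP : lamePolyOp k m l a b e P = 0) :
    IsSol (lamePotential m k) l (lameFunction k a b e P) (lameFunctionDeriv k a b e P) where
  deriv := hasDerivAt_lameFunction h0 h1 ha hb he P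
  deriv' x := by
    have := hasDerivAt_lameFunctionDeriv h0 h1 ha hb he m l P x
    rw [hP] at this
    simpa [lameFunction] using this

theorem lameFactor_pos (a b e : ℕ) {x : ℝ} (hx : x ∈ Ioo 0 (ellipticK k)) :
    0 < lameFactor k a b e x :=
  mul_pos (mul_pos (pow_pos (jacobiSn_pos h0 h1 hx) _) (pow_pos (jacobiCn_pos h0 h1 hx) _))
    (pow_pos (jacobiDn_pos h0 h1 x) _)

/-- An eigenfunction with at most `d` zeros in `(0, K)` forces the existence of a Lamé function. -/
theorem exists_lamePolynomial {m d a b e N : ℕ} (ha : a ≤ 1) (hb : b ≤ 1) (he : e ≤ 1)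
    (hm : m = 2 * d + a + b + e) (hN : N ≤ d) {l : ℝ} {θ : ℝ → ℝ}
    (hθ : IsPruferAngle (lamePotential m k) l θ) (hθ0 : θ 0 = (1 - a) * (Real.pi / 2))
    (hθK : θ (ellipticK k) = N * Real.pi + (1 + b) * (Real.pi / 2)) :
    ∃ P : ℝ[X], P ≠ 0 ∧ lamePolyOp k m l a b e P = 0 := by
  have hq := isEvenPotential_lamePotential h0 h1 m
  have hqc := hq.smooth.continuous
  have hK := hq.K_pos
  have hπ := Real.pi_pos
  have ha' : (a : ℝ) ≤ 1 := by exact_mod_cast ha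
  have hb' : (b : ℝ) ≤ 1 := by exact_mod_cast hb
  have ha0 : (0 : ℝ) ≤ a := a.cast_nonneg
  have hb0 : (0 : ℝ) ≤ b := b.cast_nonneg
  refine (secondOrderOp_dichotomy (d := d) ?_).resolve_right fun hsurj => ?_
  -- With `n = 2 d + a + b + e` the top coefficient is `k² (n (n + 1) - m (m + 1))`, using that `a`,
  -- `b`, `e` are idempotent.
  · rw [hm]
    push_cast
    have e1 : (a : ℝ) ^ 2 = a := by interval_cases a <;> norm_num
    have e2 : (b : ℝ) ^ 2 = b := by interval_cases b <;> norm_num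
    have e3 : (e : ℝ) ^ 2 = e := by interval_cases e <;> norm_num
    linear_combination -k ^ 2 * e1 - k ^ 2 * e2 - k ^ 2 * e3
  have hz : ∀ i : ℕ, i < N → ∃ x ∈ Ioo 0 (ellipticK k), θ x = (i + 1) * Real.pi := fun i hi => by
    refine intermediate_value_Ioo hK.le hθ.continuous.continuousOn ?_
    rw [hθ0, hθK]
    have : (i + 1 : ℝ) ≤ N := by exact_mod_cast hi
    have : (0 : ℝ) ≤ i := i.cast_nonneg
    constructor <;> nlinarith
  choose! z hz1 hz2 using hz
  -- A polynomial in `sn²` with exactly the sign changes of the eigenfunction on `(0, K)`. Its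
  -- degree is at most `d`, so surjectivity would make it a value of the operator.
  set R : ℝ[X] := ∏ i ∈ Finset.range N, (C (jacobiSn k (z i) ^ 2) - X) with hR
  have hRdeg : R.natDegree ≤ d := by
    refine le_trans ((natDegree_prod_le _ _).trans ?_) hN
    refine (Finset.sum_le_card_nsmul _ _ 1 fun i _ => ?_).trans (by simp)
    exact (natDegree_sub_le _ _).trans (by simp)
  obtain ⟨P, hP⟩ := hsurj R hRdeg
  have hP' : lamePolyOp k m l a b e P = R := hP
  have hψ := hθ.isSol hqc
  set r := pruferAmplitude (lamePotential m k) l θ with hr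
  have hrpos : ∀ x, 0 < r x := pruferAmplitude_pos _ _ _
  -- The Wronskian of the eigenfunction and the Lamé-type function of `P`. Its derivative has one
  -- sign on `(0, K)` by the choice of `R`, and it vanishes at both ends because `a` and `b` match
  -- the boundary conditions. So it is zero, which forces the eigenfunction to vanish.
  set H : ℝ → ℝ := fun x => r x * Real.cos (θ x) * lameFunction k a b e P x -
    r x * Real.sin (θ x) * lameFunctionDeriv k a b e P x with hH
  have hHd : ∀ x, HasDerivAt H (-(r x * Real.sin (θ x) * lameFunction k a b e R x)) x := fun x => by
    have h2 := hasDerivAt_lameFunctionDeriv h0 h1 ha hb he m l P x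
    rw [hP'] at h2
    convert! ((hψ.deriv' x).fun_mul (hasDerivAt_lameFunction h0 h1 ha hb he P x)).fun_sub
      ((hψ.deriv x).fun_mul h2) using 1
    ring
  have hmono := strictMonoOn_jacobiSn_sq h0 h1
  have hprod : ∀ x ∈ Ioo 0 (ellipticK k), 0 ≤ Real.sin (θ x) * R.eval (jacobiSn k x ^ 2) ∧
      (R.eval (jacobiSn k x ^ 2) = 0 → Real.sin (θ x) = 0) := by
    intro x hx
    have hsign : ∀ i < N, ((θ x = (i + 1) * Real.pi ∧ x = z i) ∨
        0 < (jacobiSn k (z i) ^ 2 - jacobiSn k x ^ 2) * ((i + 1) * Real.pi - θ x)) := by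
      intro i hi
      have hs : Real.sin ((i + 1) * Real.pi) = 0 := by
        rw [← Nat.cast_add_one]; exact Real.sin_nat_mul_pi _
      rcases lt_trichotomy x (z i) with hlt | heq | hgt
      · right
        refine mul_pos (sub_pos.2 (hmono (Ioo_subset_Icc_self hx)
          (Ioo_subset_Icc_self (hz1 i hi)) hlt)) (sub_pos.2 ?_)
        by_contra hcon
        exact (hθ.lt_of_level hqc hs hlt (not_lt.1 hcon)).ne' (hz2 i hi)
      · left
        exact ⟨by rw [heq, hz2 i hi], heq⟩
      · right
        refine mul_pos_of_neg_of_neg (sub_neg.2 (hmono (Ioo_subset_Icc_self (hz1 i hi))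
          (Ioo_subset_Icc_self hx) hgt)) (sub_neg.2 ?_)
        exact hθ.lt_of_level hqc hs hgt (hz2 i hi).ge
    have hev : R.eval (jacobiSn k x ^ 2) =
        ∏ i ∈ Finset.range N, (jacobiSn k (z i) ^ 2 - jacobiSn k x ^ 2) := by
      simp [hR, eval_prod]
    by_cases hsin : Real.sin (θ x) = 0
    · simp [hsin]
    have hpos : ∀ i ∈ Finset.range N,
        0 < (jacobiSn k (z i) ^ 2 - jacobiSn k x ^ 2) * ((i + 1) * Real.pi - θ x) := fun i hi => by
      refine (hsign i (Finset.mem_range.1 hi)).resolve_left fun h => hsin ?_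
      rw [h.1, ← Nat.cast_add_one]; exact Real.sin_nat_mul_pi _
    have hAB := Finset.prod_pos hpos
    rw [Finset.prod_mul_distrib, ← hev] at hAB
    have hθx0 : 0 ≤ θ x := by
      refine (hθ.lt_of_level hqc Real.sin_zero hx.1 ?_).le
      rw [hθ0]; exact mul_nonneg (by linarith) (by positivity)
    have hθxK : θ x ≤ (N + 1) * Real.pi := by
      by_contra hcon
      have hs : Real.sin ((N + 1) * Real.pi) = 0 := by
        rw [← Nat.cast_add_one]; exact Real.sin_nat_mul_pi _
      have := hθ.lt_of_level hqc hs hx.2 (not_le.1 hcon).le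
      rw [hθK] at this
      nlinarith
    have hB := sin_mul_prod_nonneg N hθx0 hθxK
    refine ⟨?_, fun h => ?_⟩
    · by_contra hcon
      have h3 := mul_nonneg hB hAB.le
      set A := R.eval (jacobiSn k x ^ 2)
      set B := ∏ i ∈ Finset.range N, ((i + 1) * Real.pi - θ x)
      have hB0 : B ≠ 0 := fun h => by rw [h, mul_zero] at hAB; exact lt_irrefl _ hAB
      have h4 : 0 < B ^ 2 := by positivity
      have := mul_pos_of_neg_of_neg (not_le.1 hcon) (neg_lt_zero.2 h4)
      nlinarith
    · rw [h, zero_mul] at hAB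
      exact absurd hAB (lt_irrefl _)
  have hH0 : H 0 = 0 := by
    have hS0 := jacobiSn_zero h0 h1
    simp only [hH, lameFunction, lameFunctionDeriv, lameFactor, lameFactorDeriv, hS0]
    interval_cases a
    · have : θ 0 = Real.pi / 2 := by rw [hθ0]; push_cast; ring
      simp [this]
    · have : θ 0 = 0 := by rw [hθ0]; push_cast; ring
      simp [this]
  have hHK : H (ellipticK k) = 0 := by
    have hCK := jacobiCn_ellipticK h0 h1
    simp only [hH, lameFunction, lameFunctionDeriv, lameFactor, lameFactorDeriv, hCK]
    interval_cases b
    · have : Real.cos (θ (ellipticK k)) = 0 := by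
        rw [hθK, add_comm, Real.cos_add_nat_mul_pi]; simp
      simp [this]
    · have : Real.sin (θ (ellipticK k)) = 0 := by
        rw [hθK, show (N * Real.pi + (1 + ((1 : ℕ) : ℝ)) * (Real.pi / 2)) =
          ((N + 1 : ℕ) : ℝ) * Real.pi by push_cast; ring]
        exact Real.sin_nat_mul_pi _
      simp [this]
  have hanti : AntitoneOn H (Icc 0 (ellipticK k)) := by
    refine antitoneOn_of_deriv_nonpos (convex_Icc _ _)
      (fun x _ => (hHd x).continuousAt.continuousWithinAt)
      (fun x _ => (hHd x).differentiableAt.differentiableWithinAt) fun x hx => ?_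
    rw [interior_Icc] at hx
    rw [(hHd x).deriv, neg_nonpos, lameFunction]
    have := mul_nonneg (mul_nonneg (hrpos x).le (lameFactor_pos h0 h1 a b e hx).le) (hprod x hx).1
    linarith
  have hHz : ∀ x ∈ Icc 0 (ellipticK k), H x = 0 := fun x hx => by
    have e1 := hanti ⟨le_rfl, hK.le⟩ hx hx.1
    have e2 := hanti hx ⟨hK.le, le_rfl⟩ hx.2
    linarith
  obtain ⟨x, hx, hxs⟩ := hθ.exists_sin_ne_zero hK
  have hev : H =ᶠ[𝓝 x] fun _ => 0 := by
    filter_upwards [Ioo_mem_nhds hx.1 hx.2] with y hy using hHz y (Ioo_subset_Icc_self hy)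
  have h3 := (hHd x).unique ((hasDerivAt_const x (0 : ℝ)).congr_of_eventuallyEq hev)
  rw [neg_eq_zero, lameFunction, mul_eq_zero, mul_eq_zero, mul_eq_zero] at h3
  rcases h3 with (h3 | h3) | h3 | h3
  · exact (hrpos x).ne' h3
  · exact hxs h3
  · exact (lameFactor_pos h0 h1 a b e hx).ne' h3
  · exact hxs ((hprod x hx).2 h3)

theorem eq_zero_of_lameFunction_eq_zero {a b e : ℕ} {P : ℝ[X]}
    (h : ∀ x, lameFunction k a b e P x = 0) : P = 0 := by
  have hK := ellipticK_pos h0 h1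
  refine eq_zero_of_infinite_isRoot P (Set.Infinite.mono
    (s := (fun x => jacobiSn k x ^ 2) '' Ioo 0 (ellipticK k)) ?_ ?_)
  · rintro _ ⟨x, hx, rfl⟩
    exact (mul_eq_zero.1 (h x)).resolve_left (lameFactor_pos h0 h1 a b e hx).ne'
  · exact (Ioo_infinite hK).image
      ((strictMonoOn_jacobiSn_sq h0 h1).injOn.mono Ioo_subset_Icc_self)

/-- An even and an odd Lamé function of complementary type cannot solve the same equation. -/
theorem not_lamePolynomial_pair {m b e : ℕ} (hb : b ≤ 1) (he : e ≤ 1) {l : ℝ} {P R : ℝ[X]}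
    (hP0 : P ≠ 0) (hR0 : R ≠ 0) (hP : lamePolyOp k m l 0 b e P = 0)
    (hR : lamePolyOp k m l 1 (1 - b) e R = 0) : False := by
  have hq := isEvenPotential_lamePotential h0 h1 m
  have F := hq.isFundamental l
  have f := isSol_lameFunction h0 h1 (Nat.zero_le 1) hb he hP
  have g := isSol_lameFunction h0 h1 le_rfl (Nat.sub_le 1 b) he hR
  have hS0 := jacobiSn_zero h0 h1
  have f0' : lameFunctionDeriv k 0 b e P 0 = 0 := by
    simp [lameFunctionDeriv, lameFactorDeriv, hS0]
  have g0 : lameFunction k 1 (1 - b) e R 0 = 0 := by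
    simp [lameFunction, lameFactor, hS0]
  have f0 : lameFunction k 0 b e P 0 ≠ 0 := fun h => hP0 <|
    eq_zero_of_lameFunction_eq_zero h0 h1 fun x => by rw [F.eq_lincomb f, h, f0']; ring
  have g0' : lameFunctionDeriv k 1 (1 - b) e R 0 ≠ 0 := fun h => hR0 <|
    eq_zero_of_lameFunction_eq_zero h0 h1 fun x => by rw [F.eq_lincomb g, h, g0]; ring
  set W := lameFunction k 0 b e P 0 * lameFunctionDeriv k 1 (1 - b) e R 0 with hW
  have hW0 : W ≠ 0 := mul_ne_zero f0 g0'
  -- The Wronskian of the two Lamé functions after taking out `dn ^ (2 e + 1)`; the factors `sn` and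
  -- `cn` combine to polynomials in `sn²` because the types in `sn` and `cn` are complementary.
  set U : ℝ[X] := 2 * X * (1 - X) * (P * derivative R - derivative P * R) +
    P * R * ((1 - X) - C (1 - 2 * (b : ℝ)) * X) with hU
  have hw : ∀ x, jacobiDn k x ^ (2 * e + 1) * U.eval (jacobiSn k x ^ 2) = W := fun x => by
    have h := f.wronskian_eq g x
    rw [f0', zero_mul, sub_zero] at h
    rw [hW, ← h]
    simp only [hU, eval_add, eval_mul, eval_sub, eval_X, eval_one, eval_C, lameFunction,
      lameFunctionDeriv, lameFactor, lameFactorDeriv, eval_ofNat]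
    have hC := jacobiCn_sq (k := k) x
    generalize jacobiSn k x = S at *
    generalize jacobiCn k x = Cx at *
    generalize jacobiDn k x = D at *
    rw [← hC]
    interval_cases b <;> interval_cases e <;> simp <;> grind
  -- Squaring removes the square root in `dn`. The left side has odd degree `2 e + 1 + 2 deg U`, the
  -- right side degree `0`.
  have hpoly : (1 - C (k ^ 2) * X) ^ (2 * e + 1) * U ^ 2 = C (W ^ 2) := by
    refine eq_of_infinite_eval_eq _ _ (Set.Infinite.mono
      (s := (fun x => jacobiSn k x ^ 2) '' Ioo 0 (ellipticK k)) ?_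
      ((Ioo_infinite hq.K_pos).image
        ((strictMonoOn_jacobiSn_sq h0 h1).injOn.mono Ioo_subset_Icc_self)))
    rintro _ ⟨x, hx, rfl⟩
    have hD := jacobiDn_sq h0 h1 x
    simp only [mem_ofPred_eq, eval_mul, eval_pow, eval_sub, eval_one, eval_C, eval_X]
    rw [← hD, ← hw x]
    ring
  have hUne : U ≠ 0 := by
    intro h
    rw [h] at hpoly
    simp only [ne_eq, OfNat.ofNat_ne_zero, not_false_eq_true, zero_pow, mul_zero] at hpoly
    exact hW0 (pow_eq_zero_iff two_ne_zero |>.1 (C_eq_zero.1 hpoly.symm))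
  have hlin : (1 - C (k ^ 2) * X : ℝ[X]).natDegree = 1 := by
    rw [show (1 - C (k ^ 2) * X : ℝ[X]) = C (-k ^ 2) * X + C 1 by simp; ring]
    exact natDegree_linear (by simp [h0.ne'])
  have hlin0 : (1 - C (k ^ 2) * X : ℝ[X]) ≠ 0 := fun h => by rw [h] at hlin; simp at hlin
  have hdeg := congrArg natDegree hpoly
  rw [natDegree_mul (pow_ne_zero _ hlin0) (pow_ne_zero _ hUne), natDegree_pow, natDegree_pow,
    natDegree_C, hlin] at hdeg
  omega

/-- The first `m` gaps are open. -/
theorem cosEigenvalue_ne_sinEigenvalue {m j : ℕ} (hj : j + 1 ≤ m) :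
    cosEigenvalue (lamePotential m k) (ellipticK k) (j + 1) ≠
      sinEigenvalue (lamePotential m k) (ellipticK k) j := by
  intro heq
  have hq := isEvenPotential_lamePotential h0 h1 m
  have hc := hq.cosAngle_cosEigenvalue (j + 1)
  have hs := hq.sinAngle_sinEigenvalue j
  rw [← heq] at hs
  set l := cosEigenvalue (lamePotential m k) (ellipticK k) (j + 1)
  -- `b` is dictated by the condition at `K`, and then `e` by the parity of `m - b`; `j + 1 ≤ m`
  -- gives `n ≤ d`.
  obtain ⟨b, n, hb, hjb⟩ : ∃ b n : ℕ, b ≤ 1 ∧ j + 1 = 2 * n + b :=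
    ⟨(j + 1) % 2, (j + 1) / 2, by omega, by omega⟩
  obtain ⟨e, d, he, hmd⟩ : ∃ e d : ℕ, e ≤ 1 ∧ m = 2 * d + b + e :=
    ⟨(m - b) % 2, (m - b) / 2, by omega, by omega⟩
  have hjb' : (j : ℝ) + 1 = 2 * n + b := by exact_mod_cast hjb
  obtain ⟨P, hP0, hP⟩ := exists_lamePolynomial h0 h1 (Nat.zero_le 1) hb he (d := d) (N := n)
    (by omega) (by omega) (hq.isPruferAngle_cosAngle l) (by rw [hq.cosAngle_zero]; simp)
    (by rw [hc]; push_cast; rw [hjb']; ring)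
  -- The odd solution satisfies the opposite condition at `K`, whence `1 - b` with the same `e`.
  -- Both `d + b` and `n + b` are positive because `1 ≤ j + 1 ≤ m`, so the subtractions are exact.
  obtain ⟨R, hR0, hR⟩ := exists_lamePolynomial h0 h1 (le_refl 1) (Nat.sub_le 1 b) he
    (d := d + b - 1) (N := n + b - 1) (by omega) (by omega) (hq.isPruferAngle_sinAngle l)
    (by rw [hq.sinAngle_zero]; simp) (by
      rw [hs, hjb', Nat.cast_sub (by omega), Nat.cast_sub hb]; push_cast; ring)
  exact not_lamePolynomial_pair h0 h1 hb he hP0 hR0 hP hR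

end
end Lame

namespace Lame

/-! ### Green's function of a hyperbolic equation -/

section

variable {E : Type*} [NormedAddCommGroup E] [InnerProductSpace ℝ E] [CompleteSpace E]

/-- The equation `α' = -κ α + g` has a solution bounded in `L²` by `κ⁻¹ g`. -/
theorem exists_hasDerivAt_neg_smul_add {κ : ℝ} (hκ : 0 < κ) {g : ℝ → E} (hg : Continuous g)
    (hc : HasCompactSupport g) :
    ∃ α : ℝ → E, (∀ x, HasDerivAt α (-κ • α x + g x) x) ∧ Integrable (fun x => ‖α x‖ ^ 2) ∧
      ∫ x, ‖α x‖ ^ 2 ≤ (κ⁻¹) ^ 2 * ∫ x, ‖g x‖ ^ 2 := by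
  obtain ⟨M, hM⟩ := hc.isCompact.isBounded.subset_closedBall (0 : ℝ)
  have hgM : ∀ x, x < -M → g x = 0 := fun x hx => by
    by_contra h
    have := hM (subset_tsupport g h)
    rw [mem_closedBall_zero_iff, Real.norm_eq_abs, abs_le] at this
    linarith [this.1]
  set α : ℝ → E := fun x => Real.exp (-κ * x) • ∫ y in (-M)..x, Real.exp (κ * y) • g y with hα
  have hcont : Continuous fun y => Real.exp (κ * y) • g y := by fun_prop
  have hd : ∀ x, HasDerivAt α (-κ • α x + g x) x := fun x => by
    have e1 : HasDerivAt (fun x => Real.exp (-κ * x)) (Real.exp (-κ * x) * (-κ * 1)) x :=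
      ((hasDerivAt_id x).const_mul (-κ)).exp
    have e2 := intervalIntegral.integral_hasDerivAt_right
      (hcont.intervalIntegrable (-M) x) (hcont.stronglyMeasurableAtFilter _ _) hcont.continuousAt
    convert! e1.smul e2 using 1
    have e3 : Real.exp (-κ * x) • Real.exp (κ * x) • g x = g x := by
      rw [smul_smul, ← Real.exp_add, show -κ * x + κ * x = 0 by ring, Real.exp_zero, one_smul]
    rw [e3, hα]
    module
  have hαc : Continuous α := continuous_iff_continuousAt.2 fun x => (hd x).continuousAt
  have hα0 : ∀ x ≤ -M, α x = 0 := fun x hx => by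
    have : ∫ y in (-M)..x, Real.exp (κ * y) • g y = 0 := by
      rw [intervalIntegral.integral_symm, neg_eq_zero]
      rw [intervalIntegral.integral_of_le hx, integral_Ioc_eq_integral_Ioo]
      refine setIntegral_eq_zero_of_forall_eq_zero fun y hy => ?_
      rw [hgM y hy.2, smul_zero]
    simp only [hα, this, smul_zero]
  have hgint : Integrable fun x => ‖g x‖ ^ 2 :=
    (memLp_two_iff_integrable_sq_norm hg.aestronglyMeasurable).1
      (hg.memLp_of_hasCompactSupport hc)
  have hαc2 : Continuous fun x => ‖α x‖ ^ 2 := by fun_prop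
  have hgc2 : Continuous fun x => ‖g x‖ ^ 2 := by fun_prop
  have hbound : ∀ a ≤ -M, ∀ b ≥ a, ∫ x in a..b, ‖α x‖ ^ 2 ≤ (κ⁻¹) ^ 2 * ∫ x, ‖g x‖ ^ 2 := by
    intro a ha b hb
    -- Energy estimate: by Young's inequality `2 ‖α‖ ‖g‖ ≤ κ ‖α‖² + κ⁻¹ ‖g‖²` this quantity
    -- decreases, and it is zero to the left of the support of `g`.
    set Ψ : ℝ → ℝ := fun x => ‖α x‖ ^ 2 + κ * (∫ y in a..x, ‖α y‖ ^ 2) -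
      κ⁻¹ * ∫ y in a..x, ‖g y‖ ^ 2 with hΨ
    have hΨd : ∀ x, HasDerivAt Ψ (2 * inner ℝ (α x) (-κ • α x + g x) + κ * ‖α x‖ ^ 2 -
        κ⁻¹ * ‖g x‖ ^ 2) x := fun x => by
      refine ((hd x).norm_sq.add (HasDerivAt.const_mul κ ?_)).sub (HasDerivAt.const_mul κ⁻¹ ?_)
      · exact intervalIntegral.integral_hasDerivAt_right
          (hαc2.intervalIntegrable _ _) (hαc2.stronglyMeasurableAtFilter _ _) hαc2.continuousAt
      · exact intervalIntegral.integral_hasDerivAt_right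
          (hgc2.intervalIntegrable _ _) (hgc2.stronglyMeasurableAtFilter _ _) hgc2.continuousAt
    have hanti : Antitone Ψ := by
      refine antitone_of_deriv_nonpos (fun x => (hΨd x).differentiableAt) fun x => ?_
      rw [(hΨd x).deriv, inner_add_right, inner_smul_right, real_inner_self_eq_norm_sq]
      have h1 := real_inner_le_norm (α x) (g x)
      have h2 : 2 * (‖α x‖ * ‖g x‖) ≤ κ * ‖α x‖ ^ 2 + κ⁻¹ * ‖g x‖ ^ 2 := by
        have h3 : 0 ≤ κ⁻¹ * (κ * ‖α x‖ - ‖g x‖) ^ 2 := by positivity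
        have h4 : κ⁻¹ * (κ * ‖α x‖ - ‖g x‖) ^ 2 =
            κ * ‖α x‖ ^ 2 + κ⁻¹ * ‖g x‖ ^ 2 - 2 * (‖α x‖ * ‖g x‖) := by
          field_simp; ring
        linarith
      linarith
    have h1 : Ψ b ≤ Ψ a := hanti hb
    have h2 : Ψ a = 0 := by simp [hΨ, hα0 a ha]
    have h3 : ∫ y in a..b, ‖g y‖ ^ 2 ≤ ∫ x, ‖g x‖ ^ 2 := by
      rw [intervalIntegral.integral_of_le hb]
      exact setIntegral_le_integral hgint (Eventually.of_forall fun x => sq_nonneg _)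
    have h4 : κ * ∫ x in a..b, ‖α x‖ ^ 2 ≤ κ⁻¹ * ∫ x, ‖g x‖ ^ 2 := by
      have := mul_le_mul_of_nonneg_left h3 (inv_pos.2 hκ).le
      have := sq_nonneg ‖α b‖
      simp only [hΨ] at h1 h2
      linarith
    have h5 := mul_le_mul_of_nonneg_left h4 (inv_pos.2 hκ).le
    rw [← mul_assoc, inv_mul_cancel₀ hκ.ne', one_mul] at h5
    rw [pow_two, mul_assoc]
    exact h5
  have ha : Tendsto (fun n : ℕ => -(|M| + n)) atTop atBot :=
    tendsto_neg_atTop_atBot.comp (tendsto_atTop_add_const_left _ _ tendsto_natCast_atTop_atTop)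
  have hb : Tendsto (fun n : ℕ => |M| + (n : ℝ)) atTop atTop :=
    tendsto_atTop_add_const_left _ _ tendsto_natCast_atTop_atTop
  have hbn : ∀ n : ℕ, ∫ x in (-(|M| + n : ℝ))..(|M| + n), ‖α x‖ ^ 2 ≤
      (κ⁻¹) ^ 2 * ∫ x, ‖g x‖ ^ 2 := fun n => by
    have := le_abs_self M
    have := abs_nonneg M
    have hn : (0 : ℝ) ≤ n := n.cast_nonneg
    exact hbound _ (by linarith) _ (by linarith)
  have hint : Integrable fun x => ‖α x‖ ^ 2 := by
    refine integrable_of_intervalIntegral_norm_bounded ((κ⁻¹) ^ 2 * ∫ x, ‖g x‖ ^ 2)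
      (fun n => (hαc2.integrableOn_Icc).mono_set Ioc_subset_Icc_self) ha hb
      (Eventually.of_forall fun n => ?_)
    simpa using hbn n
  exact ⟨α, hd, hint, le_of_tendsto (intervalIntegral_tendsto_integral hint ha hb)
    (Eventually.of_forall hbn)⟩

/-- The equation `β' = κ β - g` has a solution bounded in `L²` by `κ⁻¹ g`. -/
theorem exists_hasDerivAt_smul_sub {κ : ℝ} (hκ : 0 < κ) {g : ℝ → E} (hg : Continuous g)
    (hc : HasCompactSupport g) :
    ∃ β : ℝ → E, (∀ x, HasDerivAt β (κ • β x - g x) x) ∧ Integrable (fun x => ‖β x‖ ^ 2) ∧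
      ∫ x, ‖β x‖ ^ 2 ≤ (κ⁻¹) ^ 2 * ∫ x, ‖g x‖ ^ 2 := by
  obtain ⟨α, h1, h2, h3⟩ := exists_hasDerivAt_neg_smul_add hκ (hg.comp continuous_neg)
    (hc.comp_homeomorph (Homeomorph.neg ℝ))
  refine ⟨fun x => α (-x), fun x => ?_, h2.comp_neg, ?_⟩
  · convert! (h1 (-x)).scomp x (hasDerivAt_neg x) using 1
    simp only [Function.comp, neg_neg, neg_smul, one_smul]
    abel
  · have e1 : ∫ x, ‖α (-x)‖ ^ 2 = ∫ x, ‖α x‖ ^ 2 := integral_neg_eq_self (fun x => ‖α x‖ ^ 2) volume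
    have e2 : ∫ x, ‖g (-x)‖ ^ 2 = ∫ x, ‖g x‖ ^ 2 := integral_neg_eq_self (fun x => ‖g x‖ ^ 2) volume
    rw [e1]
    simp only [Function.comp] at h3
    rwa [e2] at h3

end

/-- The equation `-ψ'' + q ψ = l ψ` has a solution `f` decaying like `exp (-κ x)` and a solution
`g` decaying like `exp (κ x)`, with Wronskian `w`. -/
structure IsDichotomy (q : ℝ → ℝ) (l κ B w : ℝ) (f f' g g' : ℝ → ℝ) : Prop where
  κ_pos : 0 < κ
  w_ne : w ≠ 0
  sol : IsSol q l f f'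
  sol' : IsSol q l g g'
  wronskian : ∀ x, f x * g' x - f' x * g x = w
  bound : ∀ x, |Real.exp (κ * x) * f x| ≤ B
  bound' : ∀ x, |Real.exp (κ * x) * f' x| ≤ B
  bound_symm : ∀ x, |Real.exp (-κ * x) * g x| ≤ B
  bound_symm' : ∀ x, |Real.exp (-κ * x) * g' x| ≤ B

theorem norm_add_sq_le_of_abs_le {E : Type*} [NormedAddCommGroup E] [NormedSpace ℝ E] {B a b : ℝ}
    (ha : |a| ≤ B) (hb : |b| ≤ B) (u v : E) :
    ‖a • u + b • v‖ ^ 2 ≤ 2 * B ^ 2 * (‖u‖ ^ 2 + ‖v‖ ^ 2) := by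
  have h1 : ‖a • u + b • v‖ ≤ B * ‖u‖ + B * ‖v‖ := by
    refine (norm_add_le _ _).trans (add_le_add ?_ ?_) <;> rw [norm_smul, Real.norm_eq_abs]
    · exact mul_le_mul_of_nonneg_right ha (norm_nonneg _)
    · exact mul_le_mul_of_nonneg_right hb (norm_nonneg _)
  have h2 := pow_le_pow_left₀ (norm_nonneg _) h1 2
  nlinarith [sq_nonneg (B * ‖u‖ - B * ‖v‖)]

/-- Variation of constants with the exponentials split off: `u = p α + s β` with bounded `p`, `s`,
while `α` and `β` solve first order equations with damping `κ` in opposite directions. The `L²`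
bounds follow from theirs. -/
theorem IsDichotomy.exists_green {E : Type*} [NormedAddCommGroup E] [InnerProductSpace ℝ E]
    [CompleteSpace E] {q : ℝ → ℝ} {l κ B w : ℝ} {f f' g g' : ℝ → ℝ}
    (D : IsDichotomy q l κ B w f f' g g') {r : ℝ → E} (hr : Continuous r)
    (hc : HasCompactSupport r) :
    ∃ u u₁ : ℝ → E, (∀ x, HasDerivAt u (u₁ x) x) ∧
      (∀ x, HasDerivAt u₁ ((q x - l) • u x - r x) x) ∧
      Integrable (fun x => ‖u x‖ ^ 2) ∧ Integrable (fun x => ‖u₁ x‖ ^ 2) ∧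
      ∫ x, ‖u x‖ ^ 2 ≤ (2 * B ^ 2 * w⁻¹ * κ⁻¹) ^ 2 * ∫ x, ‖r x‖ ^ 2 ∧
      ∫ x, ‖u₁ x‖ ^ 2 ≤ (2 * B ^ 2 * w⁻¹ * κ⁻¹) ^ 2 * ∫ x, ‖r x‖ ^ 2 := by
  have hfc := D.sol.continuous
  have hgc := D.sol'.continuous
  have hfc' := D.sol.continuous'
  have hgc' := D.sol'.continuous'
  have hw := D.w_ne
  set p : ℝ → ℝ := fun x => Real.exp (κ * x) * f x with hp
  set p' : ℝ → ℝ := fun x => Real.exp (κ * x) * f' x with hp'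
  set s : ℝ → ℝ := fun x => Real.exp (-κ * x) * g x with hs
  set s' : ℝ → ℝ := fun x => Real.exp (-κ * x) * g' x with hs'
  have hpc : Continuous p := by fun_prop
  have hsc : Continuous s := by fun_prop
  have hpc' : Continuous p' := by fun_prop
  have hsc' : Continuous s' := by fun_prop
  have hexp : ∀ (ν x : ℝ), HasDerivAt (fun x => Real.exp (ν * x)) (Real.exp (ν * x) * (ν * 1)) x :=
    fun ν x => ((hasDerivAt_id x).const_mul ν).exp
  have hpd : ∀ x, HasDerivAt p (κ * p x + p' x) x := fun x => by
    convert! (hexp κ x).mul (D.sol.deriv x) using 1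
    simp only [hp, hp']; ring
  have hsd : ∀ x, HasDerivAt s (-κ * s x + s' x) x := fun x => by
    convert! (hexp (-κ) x).mul (D.sol'.deriv x) using 1
    simp only [hs, hs']; ring
  have hpd' : ∀ x, HasDerivAt p' (κ * p' x + (q x - l) * p x) x := fun x => by
    convert! (hexp κ x).mul (D.sol.deriv' x) using 1
    simp only [hp, hp']; ring
  have hsd' : ∀ x, HasDerivAt s' (-κ * s' x + (q x - l) * s x) x := fun x => by
    convert! (hexp (-κ) x).mul (D.sol'.deriv' x) using 1
    simp only [hs, hs']; ring
  have hW : ∀ x, p x * s' x - p' x * s x = w := fun x => by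
    rw [← D.wronskian x]
    have : Real.exp (κ * x) * Real.exp (-κ * x) = 1 := by
      rw [← Real.exp_add, show κ * x + -κ * x = 0 by ring, Real.exp_zero]
    simp only [hp, hp', hs, hs']
    linear_combination (f x * g' x - f' x * g x) * this
  have hB0 : 0 ≤ B := (abs_nonneg _).trans (D.bound 0)
  obtain ⟨α, hα, hαi, hαb⟩ := exists_hasDerivAt_neg_smul_add D.κ_pos
    (g := fun x => (w⁻¹ * s x) • r x) (by fun_prop) hc.smul_left
  obtain ⟨β, hβ, hβi, hβb⟩ := exists_hasDerivAt_smul_sub D.κ_pos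
    (g := fun x => (w⁻¹ * p x) • r x) (by fun_prop) hc.smul_left
  have hri : Integrable fun x => ‖r x‖ ^ 2 :=
    (memLp_two_iff_integrable_sq_norm hr.aestronglyMeasurable).1
      (hr.memLp_of_hasCompactSupport hc)
  have hrb : ∀ t : ℝ → ℝ, Continuous t → (∀ x, |t x| ≤ B) →
      ∫ x, ‖(w⁻¹ * t x) • r x‖ ^ 2 ≤ (w⁻¹ * B) ^ 2 * ∫ x, ‖r x‖ ^ 2 := fun t ht htB => by
    rw [← integral_const_mul]
    have hle : ∀ x, ‖(w⁻¹ * t x) • r x‖ ^ 2 ≤ (w⁻¹ * B) ^ 2 * ‖r x‖ ^ 2 := fun x => by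
      rw [norm_smul, mul_pow, Real.norm_eq_abs, sq_abs, mul_pow, mul_pow]
      have : t x ^ 2 ≤ B ^ 2 := sq_le_sq' (by linarith [(abs_le.1 (htB x)).1]) (abs_le.1 (htB x)).2
      gcongr
    refine integral_mono_of_nonneg (Eventually.of_forall fun x => sq_nonneg _)
      (hri.const_mul _) (Eventually.of_forall hle)
  have hαβ : (∫ x, ‖α x‖ ^ 2) + ∫ x, ‖β x‖ ^ 2 ≤
      2 * ((κ⁻¹) ^ 2 * ((w⁻¹ * B) ^ 2 * ∫ x, ‖r x‖ ^ 2)) := by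
    have e1 := hαb.trans (mul_le_mul_of_nonneg_left (hrb s hsc D.bound_symm) (sq_nonneg _))
    have e2 := hβb.trans (mul_le_mul_of_nonneg_left (hrb p hpc D.bound) (sq_nonneg _))
    linarith
  have hαc : Continuous α := continuous_iff_continuousAt.2 fun x => (hα x).continuousAt
  have hβc : Continuous β := continuous_iff_continuousAt.2 fun x => (hβ x).continuousAt
  have hfin : ∀ a b : ℝ → ℝ, Continuous a → Continuous b → (∀ x, |a x| ≤ B) → (∀ x, |b x| ≤ B) →
      Integrable (fun x => ‖a x • α x + b x • β x‖ ^ 2) ∧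
      ∫ x, ‖a x • α x + b x • β x‖ ^ 2 ≤ (2 * B ^ 2 * w⁻¹ * κ⁻¹) ^ 2 * ∫ x, ‖r x‖ ^ 2 := by
    intro a b ha hb haB hbB
    have hle : ∀ x, ‖a x • α x + b x • β x‖ ^ 2 ≤ 2 * B ^ 2 * (‖α x‖ ^ 2 + ‖β x‖ ^ 2) :=
      fun x => norm_add_sq_le_of_abs_le (haB x) (hbB x) _ _
    have hint := (hαi.add hβi).const_mul (2 * B ^ 2)
    refine ⟨hint.mono' (by fun_prop) (Eventually.of_forall fun x => ?_), ?_⟩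
    · rw [Real.norm_of_nonneg (sq_nonneg _)]; exact hle x
    · refine (integral_mono_of_nonneg (Eventually.of_forall fun x => sq_nonneg _) hint
        (Eventually.of_forall hle)).trans ?_
      rw [integral_const_mul, integral_add' hαi hβi]
      refine (mul_le_mul_of_nonneg_left hαβ (by positivity)).trans (le_of_eq ?_)
      ring
  have hu := hfin p s hpc hsc D.bound D.bound_symm
  have hu' := hfin p' s' hpc' hsc' D.bound' D.bound_symm'
  refine ⟨fun x => p x • α x + s x • β x, fun x => p' x • α x + s' x • β x, fun x => ?_,
    fun x => ?_, hu.1, hu'.1, hu.2, hu'.2⟩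
  · convert! ((hpd x).smul (hα x)).add ((hsd x).smul (hβ x)) using 1
    module
  · convert! ((hpd' x).smul (hα x)).add ((hsd' x).smul (hβ x)) using 1
    have h1 : w⁻¹ * (p x * s' x - p' x * s x) = 1 := by rw [hW, inv_mul_cancel₀ hw]
    have h2 : r x = (w⁻¹ * (p x * s' x - p' x * s x)) • r x := by rw [h1, one_smul]
    nth_rw 1 [h2]
    module

/-- A quasi-periodic function grows exponentially at the rate given by its multiplier. -/
theorem exists_bound_of_quasiperiodic {f : ℝ → ℝ} (hf : Continuous f) {T ρ ν : ℝ} (hT : 0 < T)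
    (hρ : |ρ| = Real.exp (ν * T)) (h : ∀ x, f (x + T) = ρ * f x) :
    ∃ B, ∀ x, |Real.exp (-ν * x) * f x| ≤ B := by
  have hper : Function.Periodic (fun x => |Real.exp (-ν * x) * f x|) T := fun x => by
    simp only [h, abs_mul, hρ, Real.abs_exp]
    rw [← mul_assoc, ← Real.exp_add]
    congr 2
    ring
  obtain ⟨B, hB⟩ := (hper.isBounded_of_continuous hT.ne' (by fun_prop)).bddAbove
  exact ⟨B, fun x => hB ⟨x, rfl⟩⟩

/-- The monodromy matrix is hyperbolic with multipliers `d ± √(d² - 1)` of product `1`. Its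
eigenvectors are `(σ, ±√(d² - 1))`, where `σ = 2 s s'` at `K` is nonzero because it divides `d² - 1
> 0`. -/
theorem IsEvenPotential.exists_dichotomy {q : ℝ → ℝ} {K Q l : ℝ} (hq : IsEvenPotential q K Q)
    {c c' s s' : ℝ → ℝ} (F : IsFundamental q l c c' s s')
    (hd : 1 < |c K * s' K + c' K * s K|) : ∃ κ B w f f' g g', IsDichotomy q l κ B w f f' g g' := by
  set d := c K * s' K + c' K * s K with hd_def
  have hT : 0 < 2 * K := by linarith [hq.K_pos]
  have hd2 : 0 < d ^ 2 - 1 := by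
    have := one_lt_pow₀ hd two_ne_zero
    rw [sq_abs] at this; linarith
  have hdet : d ^ 2 - 1 = 2 * (s K * s' K) * (2 * (c K * c' K)) := by
    rw [hd_def]
    linear_combination (c K * s' K - c' K * s K + 1) * F.wronskian K
  set δ := Real.sqrt (d ^ 2 - 1) with hδ
  have hδ0 : 0 < δ := Real.sqrt_pos.2 hd2
  have hδ2 : δ ^ 2 = d ^ 2 - 1 := Real.sq_sqrt hd2.le
  set σ := 2 * (s K * s' K) with hσ
  have hσ0 : σ ≠ 0 := fun h => by rw [hdet, h, zero_mul] at hd2; exact lt_irrefl _ hd2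
  have hfl : ∀ τ : ℝ, τ ^ 2 = d ^ 2 - 1 → ∀ x, (σ * c (x + 2 * K) + τ * s (x + 2 * K) =
      (d + τ) * (σ * c x + τ * s x)) ∧ (σ * c' (x + 2 * K) + τ * s' (x + 2 * K) =
      (d + τ) * (σ * c' x + τ * s' x)) := fun τ hτ x => by
    rw [F.cos_add hq, F.sin_add hq, F.cos_add' hq, F.sin_add' hq]
    rw [← hd_def, ← hσ]
    have : σ * (2 * (c K * c' K)) = τ ^ 2 := by rw [hτ, hdet]
    constructor
    · linear_combination s x * this
    · linear_combination s' x * this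
  have hsol : ∀ τ : ℝ, IsSol q l (fun x => σ * c x + τ * s x) fun x => σ * c' x + τ * s' x :=
    fun τ => F.cos.lincomb F.sin σ τ
  have main : ∀ τ : ℝ, τ ^ 2 = d ^ 2 - 1 → |d + τ| < 1 →
      ∃ κ B w f f' g g', IsDichotomy q l κ B w f f' g g' := by
    intro τ hτ hlt
    have hτ0 : τ ≠ 0 := fun h => by rw [h] at hτ; norm_num at hτ; linarith
    have hprod : (d + τ) * (d - τ) = 1 := by linear_combination -hτ
    have hne : d + τ ≠ 0 := fun h => by rw [h, zero_mul] at hprod; norm_num at hprod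
    have hpos : 0 < |d + τ| := abs_pos.2 hne
    set κ := -Real.log |d + τ| / (2 * K) with hκ
    have hκ0 : 0 < κ := div_pos (neg_pos.2 (Real.log_neg hpos hlt)) hT
    have hκT : -κ * (2 * K) = Real.log |d + τ| := by
      rw [hκ, ← neg_div, neg_neg, div_mul_cancel₀ _ hT.ne']
    have e1 : |d + τ| = Real.exp (-κ * (2 * K)) := by rw [hκT, Real.exp_log hpos]
    have e2 : |d + -τ| = Real.exp (κ * (2 * K)) := by
      have : |d + τ| * |d + -τ| = 1 := by rw [← abs_mul, ← sub_eq_add_neg, hprod, abs_one]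
      rw [eq_comm, show κ * (2 * K) = -(-κ * (2 * K)) by ring, Real.exp_neg, ← e1]
      exact (eq_inv_of_mul_eq_one_right this).symm
    have hτ' : (-τ) ^ 2 = d ^ 2 - 1 := by rw [neg_sq, hτ]
    have hs1 := hsol τ
    have hs2 := hsol (-τ)
    obtain ⟨B1, hB1⟩ := exists_bound_of_quasiperiodic hs1.continuous hT e1 fun x => (hfl τ hτ x).1
    obtain ⟨B2, hB2⟩ := exists_bound_of_quasiperiodic hs1.continuous' hT e1 fun x => (hfl τ hτ x).2
    obtain ⟨B3, hB3⟩ := exists_bound_of_quasiperiodic hs2.continuous hT e2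
      fun x => (hfl (-τ) hτ' x).1
    obtain ⟨B4, hB4⟩ := exists_bound_of_quasiperiodic hs2.continuous' hT e2
      fun x => (hfl (-τ) hτ' x).2
    rw [neg_neg] at hB1 hB2
    refine ⟨κ, max (max B1 B2) (max B3 B4), -2 * σ * τ, _, _, _, _, hκ0, ?_, hs1, hs2,
      fun x => ?_, fun x => ?_, fun x => ?_, fun x => ?_, fun x => ?_⟩
    · exact mul_ne_zero (mul_ne_zero (by norm_num) hσ0) hτ0
    · linear_combination (-2 * σ * τ) * F.wronskian x
    · exact (hB1 x).trans (by simp)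
    · exact (hB2 x).trans (by simp)
    · exact (hB3 x).trans (by simp)
    · exact (hB4 x).trans (by simp)
  -- The sign of `τ` is opposite to that of `d`, so that `d + τ` is the contracting multiplier.
  rcases lt_abs.1 hd with h | h
  · refine main (-δ) (by rw [neg_sq, hδ2]) ?_
    rw [abs_lt]
    have : δ < d := by nlinarith
    constructor <;> nlinarith
  · refine main δ hδ2 ?_
    rw [abs_lt]
    have : δ < -d := by nlinarith
    constructor <;> nlinarith

end Lame

namespace Lame

/-! ### Cutoff functions -/

/-- `χ` is a smooth cutoff function, equal to `1` on `[-N, N]` and to `0` outside `[-2 N, 2 N]`,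
whose derivatives `χ'` and `χ''` are at most `C / N`. -/
structure IsCutoff (C N : ℝ) (χ χ' χ'' : ℝ → ℝ) : Prop where
  smooth : ContDiff ℝ ∞ χ
  deriv : ∀ x, HasDerivAt χ (χ' x) x
  deriv' : ∀ x, HasDerivAt χ' (χ'' x) x
  continuous'' : Continuous χ''
  nonneg : ∀ x, 0 ≤ χ x
  le_one : ∀ x, χ x ≤ 1
  eq_one : ∀ x, |x| ≤ N → χ x = 1
  eq_zero : ∀ x, 2 * N < |x| → χ x = 0
  eq_zero' : ∀ x, 2 * N < |x| → χ' x = 0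
  eq_zero'' : ∀ x, 2 * N < |x| → χ'' x = 0
  bound' : ∀ x, |χ' x| ≤ C / N
  bound'' : ∀ x, |χ'' x| ≤ C / N

theorem hasCompactSupport_of_eq_zero {E : Type*} [Zero E] {f : ℝ → E} {M : ℝ}
    (h : ∀ x, M < |x| → f x = 0) : HasCompactSupport f := by
  refine HasCompactSupport.intro (isCompact_Icc (a := -M) (b := M)) fun x hx => h x ?_
  by_contra hle
  exact hx (abs_le.1 (not_lt.1 hle))

theorem IsCutoff.hasCompactSupport {C N : ℝ} {χ χ' χ'' : ℝ → ℝ} (h : IsCutoff C N χ χ' χ'') :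
    HasCompactSupport χ := hasCompactSupport_of_eq_zero h.eq_zero

theorem exists_isCutoff : ∃ C, 0 ≤ C ∧ ∀ N : ℝ, 1 ≤ N → ∃ χ χ' χ'', IsCutoff C N χ χ' χ'' := by
  let η : ContDiffBump (0 : ℝ) := ⟨1, 2, one_pos, one_lt_two⟩
  have hη : ContDiff ℝ ∞ η := η.contDiff
  have hη1 : ContDiff ℝ ∞ (deriv η) := ((contDiff_infty_iff_deriv).1 hη).2
  have hη2 : ContDiff ℝ ∞ (deriv (deriv η)) := ((contDiff_infty_iff_deriv).1 hη1).2
  have hc := η.hasCompactSupport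
  obtain ⟨C1, h1⟩ := hc.deriv.exists_bound_of_continuous hη1.continuous
  obtain ⟨C2, h2⟩ := hc.deriv.deriv.exists_bound_of_continuous hη2.continuous
  have hC1 : 0 ≤ C1 := (norm_nonneg _).trans (h1 0)
  have hC2 : 0 ≤ C2 := (norm_nonneg _).trans (h2 0)
  have hz : ∀ y : ℝ, 2 < |y| → η y = 0 ∧ deriv η y = 0 ∧ deriv (deriv η) y = 0 := fun y hy => by
    have h0 : ∀ z : ℝ, 2 < |z| → (η : ℝ → ℝ) z = 0 := fun z hz =>
      η.zero_of_le_dist (by rw [Real.dist_0_eq_abs]; exact hz.le)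
    have ho : ∀ z : ℝ, 2 < |z| → ∀ᶠ t in 𝓝 z, 2 < |t| := fun z hz =>
      (isOpen_lt continuous_const continuous_abs).mem_nhds hz
    have hd : ∀ z : ℝ, 2 < |z| → deriv η z = 0 := fun z hz => by
      have e : (η : ℝ → ℝ) =ᶠ[𝓝 z] fun _ => (0 : ℝ) := (ho z hz).mono h0
      rw [e.deriv_eq, deriv_const]
    refine ⟨h0 y hy, hd y hy, ?_⟩
    have e : deriv η =ᶠ[𝓝 y] fun _ => (0 : ℝ) := (ho y hy).mono hd
    rw [e.deriv_eq, deriv_const]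
  refine ⟨C1 + C2, add_nonneg hC1 hC2, fun N hN => ⟨fun x => η (x / N),
    fun x => deriv η (x / N) * (1 / N), fun x => deriv (deriv η) (x / N) * (1 / N) * (1 / N), ?_⟩⟩
  have hN0 : 0 < N := one_pos.trans_le hN
  have habs : ∀ x : ℝ, |x / N| = |x| / N := fun x => by rw [abs_div, abs_of_pos hN0]
  have hgt : ∀ x : ℝ, 2 * N < |x| → 2 < |x / N| := fun x hx => by
    rw [habs, lt_div_iff₀ hN0]; exact hx
  have hid : ∀ x, HasDerivAt (fun x => x / N) (1 / N) x := fun x => (hasDerivAt_id x).div_const N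
  have hN1 : 1 / N ≤ 1 := by rw [div_le_one hN0]; exact hN
  have hN2 : (0 : ℝ) ≤ 1 / N := by positivity
  refine ⟨hη.comp (contDiff_id.div_const N), fun x => ?_, fun x => ?_, ?_, fun x => η.nonneg,
    fun x => η.le_one, fun x hx => ?_, fun x hx => (hz _ (hgt x hx)).1, fun x hx => ?_,
    fun x hx => ?_, fun x => ?_, fun x => ?_⟩
  · exact HasDerivAt.comp (h₂ := η) x ((hη.differentiable (by simp)) (x / N)).hasDerivAt (hid x)
  · exact (((hη1.differentiable (by simp)) (x / N)).hasDerivAt.comp x (hid x)).mul_const _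
  · have := hη2.continuous
    fun_prop
  · refine η.one_of_mem_closedBall ?_
    rw [mem_closedBall_zero_iff, Real.norm_eq_abs, habs]
    exact (div_le_one hN0).2 hx
  · rw [(hz _ (hgt x hx)).2.1, zero_mul]
  · rw [(hz _ (hgt x hx)).2.2, zero_mul, zero_mul]
  · have h := h1 (x / N)
    rw [Real.norm_eq_abs] at h
    rw [abs_mul, abs_of_nonneg hN2, div_eq_mul_one_div (C1 + C2)]
    exact mul_le_mul_of_nonneg_right (h.trans (by linarith)) hN2
  · have h := h2 (x / N)
    rw [Real.norm_eq_abs] at h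
    rw [abs_mul, abs_mul, abs_of_nonneg hN2, div_eq_mul_one_div (C1 + C2)]
    refine mul_le_mul_of_nonneg_right ?_ hN2
    nlinarith [abs_nonneg (deriv (deriv η) (x / N))]

/-! ### Weak solutions in `L²` -/

noncomputable section

/-- The integral of `u` against the test function `φ`. -/
def testIntegral (φ : ℝ → ℝ) (u : L2) : ℂ := ∫ x, (φ x : ℂ) * u x

theorem memLp_ofReal {φ : ℝ → ℝ} (hφ : Continuous φ) (hc : HasCompactSupport φ) :
    MemLp (fun x => (φ x : ℂ)) 2 (volume : Measure ℝ) :=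
  Continuous.memLp_of_hasCompactSupport (by fun_prop) (hc.comp_left Complex.ofReal_zero)

theorem inner_toLp_ofReal {φ : ℝ → ℝ} (h : MemLp (fun x => (φ x : ℂ)) 2 (volume : Measure ℝ))
    (u : L2) : inner ℂ (h.toLp _) u = testIntegral φ u := by
  rw [L2.inner_def]
  refine integral_congr_ae ?_
  filter_upwards [h.coeFn_toLp] with x hx
  rw [hx, RCLike.inner_apply]
  simp [mul_comm]

section

variable {φ : ℝ → ℝ} (hφ : Continuous φ) (hc : HasCompactSupport φ)
include hφ hc

theorem testIntegral_sub (u v : L2) :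
    testIntegral φ (u - v) = testIntegral φ u - testIntegral φ v := by
  simp only [← inner_toLp_ofReal (memLp_ofReal hφ hc), inner_sub_right]

theorem testIntegral_add (u v : L2) :
    testIntegral φ (u + v) = testIntegral φ u + testIntegral φ v := by
  simp only [← inner_toLp_ofReal (memLp_ofReal hφ hc), inner_add_right]

theorem testIntegral_smul (z : ℂ) (u : L2) : testIntegral φ (z • u) = z * testIntegral φ u := by
  simp only [← inner_toLp_ofReal (memLp_ofReal hφ hc), inner_smul_right]

theorem tendsto_testIntegral {ι : Type*} {F : Filter ι} {u : ι → L2} {v : L2}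
    (h : Tendsto u F (𝓝 v)) :
    Tendsto (fun i => testIntegral φ (u i)) F (𝓝 (testIntegral φ v)) := by
  simp only [← inner_toLp_ofReal (memLp_ofReal hφ hc)]
  exact tendsto_const_nhds.inner h

end

theorem testIntegral_toLp (φ : ℝ → ℝ) {u : ℝ → ℂ} (h : MemLp u 2 (volume : Measure ℝ)) :
    testIntegral φ (h.toLp u) = ∫ x, (φ x : ℂ) * u x := by
  refine integral_congr_ae ?_
  filter_upwards [h.coeFn_toLp] with x hx
  rw [hx]

/-- `u` solves `-u'' + V u = f` weakly, and its weak derivative is `u₁`. -/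
def IsWeakSol (V : ℝ → ℝ) (u u₁ f : L2) : Prop :=
  HasWeakDeriv u u₁ ∧ ∀ φ : ℝ → ℝ, ContDiff ℝ ∞ φ → HasCompactSupport φ →
    testIntegral (deriv φ) u₁ = testIntegral φ f - testIntegral (fun x => φ x * V x) u

theorem HasWeakDeriv.sub {u v u₁ v₁ : L2} (h : HasWeakDeriv u u₁) (h' : HasWeakDeriv v v₁) :
    HasWeakDeriv (u - v) (u₁ - v₁) := by
  simpa [sub_eq_add_neg] using h.add (h'.smul (-1))

theorem HasWeakDeriv.of_tendsto {u u₁ : ℕ → L2} {v v₁ : L2} (h : ∀ n, HasWeakDeriv (u n) (u₁ n))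
    (hu : Tendsto u atTop (𝓝 v)) (hu₁ : Tendsto u₁ atTop (𝓝 v₁)) : HasWeakDeriv v v₁ :=
  fun φ hφ hc => tendsto_nhds_unique (tendsto_testIntegral (continuous_deriv_test hφ) hc.deriv hu)
    (((tendsto_testIntegral hφ.continuous hc hu₁).neg).congr fun n => (h n φ hφ hc).symm)

theorem IsWeakSol.sub {V : ℝ → ℝ} (hV : Continuous V) {u u₁ f v v₁ g : L2}
    (h : IsWeakSol V u u₁ f) (h' : IsWeakSol V v v₁ g) :
    IsWeakSol V (u - v) (u₁ - v₁) (f - g) := by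
  refine ⟨h.1.sub h'.1, fun φ hφ hc => ?_⟩
  rw [testIntegral_sub (continuous_deriv_test hφ) hc.deriv, testIntegral_sub hφ.continuous hc,
    testIntegral_sub (φ := fun x => φ x * V x) (hφ.continuous.mul hV) hc.mul_right, h.2 φ hφ hc,
    h'.2 φ hφ hc]
  ring

theorem IsWeakSol.of_tendsto {V : ℝ → ℝ} (hV : Continuous V) {u u₁ f : ℕ → L2} {v v₁ g : L2}
    (h : ∀ n, IsWeakSol V (u n) (u₁ n) (f n)) (hu : Tendsto u atTop (𝓝 v))
    (hu₁ : Tendsto u₁ atTop (𝓝 v₁)) (hf : Tendsto f atTop (𝓝 g)) : IsWeakSol V v v₁ g :=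
  ⟨HasWeakDeriv.of_tendsto (fun n => (h n).1) hu hu₁, fun φ hφ hc => tendsto_nhds_unique
    (tendsto_testIntegral (continuous_deriv_test hφ) hc.deriv hu₁)
    (((tendsto_testIntegral hφ.continuous hc hf).sub (tendsto_testIntegral
      (hφ.continuous.mul hV) hc.mul_right hu)).congr fun n => ((h n).2 φ hφ hc).symm)⟩

theorem memLp_mul_of_bounded {V : ℝ → ℝ} (hV : Continuous V) {B : ℝ} (hB : ∀ x, |V x| ≤ B)
    {u : ℝ → ℂ} (hu : MemLp u 2 (volume : Measure ℝ)) :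
    MemLp (fun x => (V x : ℂ) * u x) 2 (volume : Measure ℝ) := by
  refine hu.of_le_mul (c := B) ?_ (Eventually.of_forall fun x => ?_)
  · exact (Complex.continuous_ofReal.comp hV).aestronglyMeasurable.mul hu.1
  · rw [norm_mul, Complex.norm_real]
    exact mul_le_mul_of_nonneg_right (hB x) (norm_nonneg _)

/-- For bounded `q` the second weak derivative is determined by the equation. The weak form is
stable under `L²` limits of `u`, `u₁` and `f` alone. -/
theorem mem_hillGraph_iff {q : ℝ → ℝ} (hq : Continuous q) {B : ℝ} (hB : ∀ x, |q x| ≤ B) (l : ℝ)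
    (u f : L2) : (u, f + (l : ℂ) • u) ∈ hillGraph q ↔ ∃ u₁, IsWeakSol (fun x => q x - l) u u₁ f := by
  have hqu := memLp_mul_of_bounded hq hB (Lp.memLp u)
  have key : ∀ φ : ℝ → ℝ, Continuous φ → HasCompactSupport φ →
      testIntegral (fun x => φ x * (q x - l)) u =
        testIntegral φ (hqu.toLp _) - l * testIntegral φ u := fun φ hφ hc => by
    rw [← testIntegral_smul hφ hc, ← testIntegral_sub hφ hc]
    refine integral_congr_ae ?_
    filter_upwards [Lp.coeFn_sub (hqu.toLp _) ((l : ℂ) • u), Lp.coeFn_smul (l : ℂ) u,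
      hqu.coeFn_toLp] with x h1 h2 h3
    rw [h1, Pi.sub_apply, h2, h3, Pi.smul_apply, smul_eq_mul]
    push_cast
    ring
  constructor
  · rintro ⟨u₁, u₂, h1, h2, h3⟩
    refine ⟨u₁, h1, fun φ hφ hc => ?_⟩
    have e : u₂ = hqu.toLp _ - (f + (l : ℂ) • u) := by
      refine Lp.ext ?_
      filter_upwards [h3, Lp.coeFn_sub (hqu.toLp _) (f + (l : ℂ) • u), hqu.coeFn_toLp]
        with x a1 a2 a3
      rw [a2, Pi.sub_apply, a3]
      rw [a1]
      ring
    have h4 : testIntegral (deriv φ) u₁ = -testIntegral φ u₂ := h2 φ hφ hc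
    rw [h4, e, key φ hφ.continuous hc, testIntegral_sub hφ.continuous hc,
      testIntegral_add hφ.continuous hc, testIntegral_smul hφ.continuous hc]
    ring
  · rintro ⟨u₁, h1, h2⟩
    refine ⟨u₁, hqu.toLp _ - (f + (l : ℂ) • u), h1, fun φ hφ hc => ?_, ?_⟩
    · change testIntegral (deriv φ) u₁ = -testIntegral φ _
      rw [h2 φ hφ hc, key φ hφ.continuous hc, testIntegral_sub hφ.continuous hc,
        testIntegral_add hφ.continuous hc, testIntegral_smul hφ.continuous hc]
      ring
    · filter_upwards [Lp.coeFn_sub (hqu.toLp _) (f + (l : ℂ) • u), hqu.coeFn_toLp] with x a2 a3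
      simp only [a2, Pi.sub_apply, a3]
      ring

theorem integral_deriv_mul_eq_neg {φ : ℝ → ℝ} (hφ : ContDiff ℝ ∞ φ) (hc : HasCompactSupport φ)
    {u u₁ : ℝ → ℂ} (hu : ∀ x, HasDerivAt u (u₁ x) x) (hu₁ : Continuous u₁) :
    ∫ x, ((deriv φ x : ℝ) : ℂ) * u x = -∫ x, (φ x : ℂ) * u₁ x := by
  have huc : Continuous u := continuous_iff_continuousAt.2 fun x => (hu x).continuousAt
  have hφ' := continuous_deriv_test hφ
  have hφc := hφ.continuous
  have hcc : HasCompactSupport fun x => (φ x : ℂ) := hc.comp_left Complex.ofReal_zero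
  have hcc' : HasCompactSupport fun x => ((deriv φ x : ℝ) : ℂ) :=
    hc.deriv.comp_left Complex.ofReal_zero
  rw [integral_mul_deriv_eq_deriv_mul_of_integrable (u := fun x => (φ x : ℂ)) (v := u)
    (fun x _ => (hφ.differentiable (by simp) x).hasDerivAt.ofReal_comp) (fun x _ => hu x), neg_neg]
  · exact Continuous.integrable_of_hasCompactSupport (by fun_prop) hcc.mul_right
  · exact Continuous.integrable_of_hasCompactSupport (by fun_prop) hcc'.mul_right
  · exact Continuous.integrable_of_hasCompactSupport (by fun_prop) hcc.mul_right

theorem hasWeakDeriv_toLp {u u₁ : ℝ → ℂ} (hu : ∀ x, HasDerivAt u (u₁ x) x) (hu₁ : Continuous u₁)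
    (h : MemLp u 2 (volume : Measure ℝ)) (h₁ : MemLp u₁ 2 (volume : Measure ℝ)) :
    HasWeakDeriv (h.toLp u) (h₁.toLp u₁) := fun φ hφ hc => by
  change testIntegral (deriv φ) _ = -testIntegral φ _
  rw [testIntegral_toLp, testIntegral_toLp, integral_deriv_mul_eq_neg hφ hc hu hu₁]

theorem isWeakSol_toLp {V : ℝ → ℝ} (hV : Continuous V) {u u₁ f : ℝ → ℂ}
    (hu : ∀ x, HasDerivAt u (u₁ x) x) (hu₁ : ∀ x, HasDerivAt u₁ ((V x : ℂ) * u x - f x) x)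
    (hf : Continuous f) (h : MemLp u 2 (volume : Measure ℝ)) (h₁ : MemLp u₁ 2 (volume : Measure ℝ))
    (h₂ : MemLp f 2 (volume : Measure ℝ)) :
    IsWeakSol V (h.toLp u) (h₁.toLp u₁) (h₂.toLp f) := by
  have huc : Continuous u := continuous_iff_continuousAt.2 fun x => (hu x).continuousAt
  have huc₁ : Continuous u₁ := continuous_iff_continuousAt.2 fun x => (hu₁ x).continuousAt
  refine ⟨hasWeakDeriv_toLp hu huc₁ h h₁, fun φ hφ hc => ?_⟩
  have hφc := hφ.continuous
  have hcc : HasCompactSupport fun x => (φ x : ℂ) := hc.comp_left Complex.ofReal_zero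
  rw [testIntegral_toLp, testIntegral_toLp, testIntegral_toLp,
    integral_deriv_mul_eq_neg hφ hc hu₁ (by fun_prop), ← integral_neg, ← integral_sub]
  · congr 1
    ext x
    push_cast
    ring
  · exact Continuous.integrable_of_hasCompactSupport (by fun_prop) hcc.mul_right
  · refine Continuous.integrable_of_hasCompactSupport (by fun_prop) ?_
    simp only [Complex.ofReal_mul, mul_assoc]
    exact hcc.mul_right

/-- Green's identity: test the equation of `u` with the cut off function `χₙ h` and let `n → ∞`. The
terms with `χₙ'` and `χₙ''` disappear in the limit. It gives both uniqueness and symmetry of the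
resolvent. -/
theorem testIntegral_eq_of_isWeakSol {V : ℝ → ℝ} (hV : ContDiff ℝ ∞ V) {u u₁ f : L2}
    (S : IsWeakSol V u u₁ f) {h h' r : ℝ → ℝ} (hr : ContDiff ℝ ∞ r) (hrc : HasCompactSupport r)
    (hh : ∀ x, HasDerivAt h (h' x) x) (hh' : ∀ x, HasDerivAt h' (V x * h x - r x) x)
    (hm : MemLp h 2 (volume : Measure ℝ)) (hm' : MemLp h' 2 (volume : Measure ℝ)) :
    testIntegral r u = testIntegral h f := by
  obtain ⟨C, hC, hcut⟩ := exists_isCutoff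
  have hN : ∀ n : ℕ, (1 : ℝ) ≤ n + 1 := fun n => by
    have : (0 : ℝ) ≤ n := n.cast_nonneg
    linarith
  choose χ χ' χ'' hχ using fun n : ℕ => hcut (n + 1) (hN n)
  -- Test functions must be smooth; `h` is so by bootstrapping in its equation.
  have hhs : ContDiff ℝ ∞ h := by
    have : ∀ n : ℕ, ContDiff ℝ n h ∧ ContDiff ℝ n h' := fun n => by
      induction n with
      | zero => exact ⟨contDiff_zero.2 (continuous_iff_continuousAt.2 fun x => (hh x).continuousAt),
          contDiff_zero.2 (continuous_iff_continuousAt.2 fun x => (hh' x).continuousAt)⟩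
      | succ n ih => exact ⟨contDiff_succ_of_hasDerivAt hh ih.2, contDiff_succ_of_hasDerivAt hh'
          (((hV.of_le (mod_cast le_top)).mul ih.1).sub (hr.of_le (mod_cast le_top)))⟩
    exact contDiff_infty.2 fun n => (this n).1
  have hhc := hhs.continuous
  have hhc' : Continuous h' := continuous_iff_continuousAt.2 fun x => (hh' x).continuousAt
  have hrcont := hr.continuous
  have hχc : ∀ n, Continuous (χ n) := fun n => (hχ n).smooth.continuous
  have hχc' : ∀ n, Continuous (χ' n) := fun n =>
    continuous_iff_continuousAt.2 fun x => ((hχ n).deriv' x).continuousAt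
  have hχc'' : ∀ n, Continuous (χ'' n) := fun n => (hχ n).continuous''
  have hus := (Lp.memLp u)
  have hfs := (Lp.memLp f)
  have hrm : MemLp r 2 (volume : Measure ℝ) := hrcont.memLp_of_hasCompactSupport hrc
  have hzero : ∀ n, ∫ x, (((χ'' n x * h x + 2 * (χ' n x * h' x) - χ n x * r x : ℝ) : ℂ) * u x +
      ((χ n x * h x : ℝ) : ℂ) * f x) = 0 := fun n => by
    have hφ : ContDiff ℝ ∞ fun x => χ n x * h x := (hχ n).smooth.mul hhs
    have hφc : HasCompactSupport fun x => χ n x * h x := (hχ n).hasCompactSupport.mul_right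
    have hφ' : deriv (fun x => χ n x * h x) = fun x => χ' n x * h x + χ n x * h' x :=
      funext fun x => (((hχ n).deriv x).mul (hh x)).deriv
    have hφ'' : deriv (fun x => χ' n x * h x + χ n x * h' x) =
        fun x => χ'' n x * h x + χ' n x * h' x + (χ' n x * h' x + χ n x * (V x * h x - r x)) :=
      funext fun x => ((((hχ n).deriv' x).mul (hh x)).add (((hχ n).deriv x).mul (hh' x))).deriv
    have hs : ContDiff ℝ ∞ (deriv fun x => χ n x * h x) := (contDiff_infty_iff_deriv.1 hφ).2
    have e1 : testIntegral (deriv (deriv fun x => χ n x * h x)) u =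
      -testIntegral (deriv fun x => χ n x * h x) u₁ := S.1 _ hs hφc.deriv
    rw [S.2 _ hφ hφc, hφ', hφ''] at e1
    simp only [testIntegral] at e1
    have i1 := integrable_test_mul hφ.continuous hφc f
    have i2 := integrable_test_mul (φ := fun x => χ n x * h x * V x)
      (hφ.continuous.mul hV.continuous) hφc.mul_right u
    have hs2 : ContDiff ℝ ∞ (deriv (deriv fun x => χ n x * h x)) := (contDiff_infty_iff_deriv.1 hs).2
    have i3 := integrable_test_mul hs2.continuous hφc.deriv.deriv u
    rw [hφ', hφ''] at i3
    have e2 : ∫ x, (((χ'' n x * h x + 2 * (χ' n x * h' x) - χ n x * r x : ℝ) : ℂ) * u x +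
      ((χ n x * h x : ℝ) : ℂ) * f x) = ∫ x, ((((χ'' n x * h x + χ' n x * h' x +
        (χ' n x * h' x + χ n x * (V x * h x - r x)) : ℝ) : ℂ) * u x -
        ((χ n x * h x * V x : ℝ) : ℂ) * u x) + ((χ n x * h x : ℝ) : ℂ) * f x) := by
      congr 1
      ext x
      push_cast
      ring
    rw [e2]
    erw [integral_add (i3.sub i2) i1, integral_sub i3 i2]
    rw [e1]
    ring
  have hmul : ∀ {a : ℝ → ℝ} {v : L2}, MemLp a 2 (volume : Measure ℝ) →
      Integrable fun x => |a x| * ‖v x‖ := fun {a v} ha => ha.abs.integrable_mul (Lp.memLp v).norm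
  have hlim : Tendsto (fun n : ℕ => ∫ x, (((χ'' n x * h x + 2 * (χ' n x * h' x) - χ n x * r x : ℝ) :
      ℂ) * u x + ((χ n x * h x : ℝ) : ℂ) * f x)) atTop
      (𝓝 (∫ x, (-((r x : ℂ) * u x) + (h x : ℂ) * f x))) := by
    refine tendsto_integral_of_dominated_convergence
      (fun x => (C * (|h x| * ‖u x‖) + 2 * C * (|h' x| * ‖u x‖) + |r x| * ‖u x‖) + |h x| * ‖f x‖)
      (fun n => ?_) ?_ (fun n => Eventually.of_forall fun x => ?_)
      (Eventually.of_forall fun x => ?_)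
    · refine AEStronglyMeasurable.add (AEStronglyMeasurable.mul ?_ hus.1)
        (AEStronglyMeasurable.mul ?_ hfs.1)
      · exact Continuous.aestronglyMeasurable (by fun_prop)
      · exact Continuous.aestronglyMeasurable (by fun_prop)
    · exact ((((hmul hm).const_mul C).add ((hmul hm').const_mul (2 * C))).add (hmul hrm)).add
        (hmul hm)
    · have hCn : C / ((n : ℝ) + 1) ≤ C := div_le_self hC (hN n)
      have b1 := ((hχ n).bound'' x).trans hCn
      have b2 := ((hχ n).bound' x).trans hCn
      have b3 : |χ n x| ≤ 1 := by rw [abs_of_nonneg ((hχ n).nonneg x)]; exact (hχ n).le_one x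
      have c1 : |χ'' n x * h x + 2 * (χ' n x * h' x) - χ n x * r x| ≤
          C * |h x| + 2 * C * |h' x| + |r x| := by
        refine (abs_sub _ _).trans (add_le_add ((abs_add_le _ _).trans (add_le_add ?_ ?_)) ?_)
        · rw [abs_mul]; exact mul_le_mul_of_nonneg_right b1 (abs_nonneg _)
        · rw [abs_mul, abs_mul, abs_two, mul_assoc]
          have := mul_le_mul_of_nonneg_right b2 (abs_nonneg (h' x))
          linarith
        · rw [abs_mul]
          exact (mul_le_mul_of_nonneg_right b3 (abs_nonneg _)).trans_eq (one_mul _)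
      have c2 : |χ n x * h x| ≤ |h x| := by
        rw [abs_mul]
        exact (mul_le_mul_of_nonneg_right b3 (abs_nonneg _)).trans_eq (one_mul _)
      refine (norm_add_le _ _).trans (add_le_add ?_ ?_)
      · rw [norm_mul, Complex.norm_real, Real.norm_eq_abs]
        refine (mul_le_mul_of_nonneg_right c1 (norm_nonneg _)).trans_eq ?_
        ring
      · rw [norm_mul, Complex.norm_real, Real.norm_eq_abs]
        exact mul_le_mul_of_nonneg_right c2 (norm_nonneg _)
    · have ht : Tendsto (fun n : ℕ => C / ((n : ℝ) + 1)) atTop (𝓝 0) :=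
        tendsto_const_nhds.div_atTop (tendsto_atTop_add_const_right _ _ tendsto_natCast_atTop_atTop)
      have t1 : Tendsto (fun n => χ'' n x) atTop (𝓝 0) :=
        squeeze_zero_norm (fun n => (hχ n).bound'' x) ht
      have t2 : Tendsto (fun n => χ' n x) atTop (𝓝 0) :=
        squeeze_zero_norm (fun n => (hχ n).bound' x) ht
      have t3 : Tendsto (fun n => χ n x) atTop (𝓝 1) := by
        refine tendsto_const_nhds.congr' ?_
        filter_upwards [(tendsto_natCast_atTop_atTop (R := ℝ)).eventually_ge_atTop |x|] with n hn
        exact ((hχ n).eq_one x (hn.trans (by linarith))).symm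
      have t4 : Tendsto (fun n => χ'' n x * h x + 2 * (χ' n x * h' x) - χ n x * r x) atTop
          (𝓝 (0 * h x + 2 * (0 * h' x) - 1 * r x)) :=
        ((t1.mul_const _).add ((t2.mul_const _).const_mul 2)).sub (t3.mul_const _)
      have t5 := ((Complex.continuous_ofReal.tendsto _).comp t4).mul_const (u x)
      have t6 := ((Complex.continuous_ofReal.tendsto _).comp (t3.mul_const (h x))).mul_const (f x)
      convert! t5.add t6 using 2
      push_cast
      ring
  rw [show (fun n : ℕ => ∫ x, (((χ'' n x * h x + 2 * (χ' n x * h' x) - χ n x * r x : ℝ) :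
      ℂ) * u x + ((χ n x * h x : ℝ) : ℂ) * f x)) = fun _ => 0 from funext hzero] at hlim
  have hfin := tendsto_nhds_unique hlim tendsto_const_nhds
  have j1 : Integrable fun x => (r x : ℂ) * u x := integrable_test_mul hrcont hrc u
  have j2 : Integrable fun x => (h x : ℂ) * f x := by
    refine (hmul hm (v := f)).mono' ?_ (Eventually.of_forall fun x => ?_)
    · exact (Continuous.aestronglyMeasurable (by fun_prop)).mul hfs.1
    · rw [norm_mul, Complex.norm_real, Real.norm_eq_abs]
  rw [integral_add (f := fun x => -((r x : ℂ) * u x)) j1.neg j2, integral_neg] at hfin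
  simp only [testIntegral]
  linear_combination -hfin

end

end Lame

namespace Lame

/-! ### The resolvent -/

noncomputable section

theorem norm_toLp_sq {u : ℝ → ℂ} (h : MemLp u 2 (volume : Measure ℝ)) :
    ‖h.toLp u‖ ^ 2 = ∫ x, ‖u x‖ ^ 2 := by
  have h1 : ((‖h.toLp u‖ ^ 2 : ℝ) : ℂ) = ((∫ x, ‖u x‖ ^ 2 : ℝ) : ℂ) := by
    rw [← integral_complex_ofReal]
    have := inner_self_eq_norm_sq_to_K (𝕜 := ℂ) (h.toLp u)
    push_cast
    rw [← RCLike.ofReal_eq_complex_ofReal, ← this, L2.inner_def]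
    refine integral_congr_ae ?_
    filter_upwards [h.coeFn_toLp] with x hx
    rw [hx, inner_self_eq_norm_sq_to_K]
  exact_mod_cast h1

theorem eq_zero_of_testIntegral {v : L2} (h : ∀ φ : ℝ → ℝ, ContDiff ℝ ∞ φ → HasCompactSupport φ →
    testIntegral φ v = 0) : v = 0 := by
  have hloc : LocallyIntegrable (fun x => v x) volume :=
    (Lp.memLp v).locallyIntegrable (by norm_num)
  refine (Lp.eq_zero_iff_ae_eq_zero).2
    (ae_eq_zero_of_integral_contDiff_smul_eq_zero hloc fun φ hφ hc => ?_)
  simpa [testIntegral, Complex.real_smul] using h φ hφ hc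

theorem memLp_two_of_continuous {E : Type*} [NormedAddCommGroup E] {u : ℝ → E} (hu : Continuous u)
    (hi : Integrable fun x => ‖u x‖ ^ 2) : MemLp u 2 (volume : Measure ℝ) :=
  (memLp_two_iff_integrable_sq_norm hu.aestronglyMeasurable).2 hi

section

variable {q : ℝ → ℝ} {l κ B w : ℝ} {f f' g g' : ℝ → ℝ}

/-- A smooth compactly supported real right hand side has a classical solution in `L²`, which
represents the functional `f ↦ ∫ r u` on weak solutions. -/
theorem IsDichotomy.exists_real_green (D : IsDichotomy q l κ B w f f' g g') (hq : ContDiff ℝ ∞ q)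
    {r : ℝ → ℝ} (hr : ContDiff ℝ ∞ r) (hc : HasCompactSupport r) :
    ∃ (h : ℝ → ℝ) (hm : MemLp (fun x => (h x : ℂ)) 2 (volume : Measure ℝ)) (v₁ : L2),
      IsWeakSol (fun x => q x - l) (hm.toLp _) v₁
        ((memLp_ofReal hr.continuous hc).toLp _) ∧
      ∀ u u₁ p : L2, IsWeakSol (fun x => q x - l) u u₁ p → testIntegral r u = testIntegral h p := by
  obtain ⟨h, h', hh, hh', hi, hi', -, -⟩ := D.exists_green hr.continuous hc
  have hhc : Continuous h := continuous_iff_continuousAt.2 fun x => (hh x).continuousAt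
  have hhc' : Continuous h' := continuous_iff_continuousAt.2 fun x => (hh' x).continuousAt
  have hm := memLp_two_of_continuous hhc hi
  have hm' := memLp_two_of_continuous hhc' hi'
  have hV : ContDiff ℝ ∞ fun x => q x - l := hq.sub contDiff_const
  refine ⟨h, hm.ofReal, hm'.ofReal.toLp _, ?_, fun u u₁ p S => ?_⟩
  · refine isWeakSol_toLp hV.continuous (fun x => (hh x).ofReal_comp) (fun x => ?_)
      (Complex.continuous_ofReal.comp hr.continuous) _ _ _
    convert! (hh' x).ofReal_comp using 1
    rw [smul_eq_mul]
    push_cast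
    rfl
  · exact testIntegral_eq_of_isWeakSol hV S hr hc hh hh' hm hm'

/-- Uniqueness by duality: solving the equation with right hand side `φ` turns the integral of `φ u`
into one against zero. -/
theorem IsDichotomy.eq_zero_of_isWeakSol (D : IsDichotomy q l κ B w f f' g g')
    (hq : ContDiff ℝ ∞ q) {u u₁ : L2} (S : IsWeakSol (fun x => q x - l) u u₁ 0) : u = 0 := by
  refine eq_zero_of_testIntegral fun φ hφ hc => ?_
  obtain ⟨h, hm, -, -, H⟩ := D.exists_real_green hq hφ hc
  rw [H u u₁ 0 S, ← inner_toLp_ofReal hm, inner_zero_right]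

theorem IsDichotomy.exists_isWeakSol_toLp (D : IsDichotomy q l κ B w f f' g g')
    (hq : ContDiff ℝ ∞ q) {r : ℝ → ℂ} (hr : Continuous r) (hc : HasCompactSupport r)
    (hm : MemLp r 2 (volume : Measure ℝ)) :
    ∃ u u₁ : L2, IsWeakSol (fun x => q x - l) u u₁ (hm.toLp r) ∧
      ‖u‖ ≤ |2 * B ^ 2 * w⁻¹ * κ⁻¹| * ‖hm.toLp r‖ ∧
      ‖u₁‖ ≤ |2 * B ^ 2 * w⁻¹ * κ⁻¹| * ‖hm.toLp r‖ := by
  obtain ⟨h, h', hh, hh', hi, hi', hb, hb'⟩ := D.exists_green hr hc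
  have hhc : Continuous h := continuous_iff_continuousAt.2 fun x => (hh x).continuousAt
  have hhc' : Continuous h' := continuous_iff_continuousAt.2 fun x => (hh' x).continuousAt
  have hm₀ := memLp_two_of_continuous hhc hi
  have hm₁ := memLp_two_of_continuous hhc' hi'
  refine ⟨hm₀.toLp _, hm₁.toLp _, isWeakSol_toLp (hq.continuous.sub continuous_const) hh
    (fun x => ?_) hr _ _ _, ?_, ?_⟩
  · simpa [Complex.real_smul] using hh' x
  all_goals
    refine le_of_sq_le_sq ?_ (by positivity)
    rw [mul_pow, sq_abs, norm_toLp_sq, norm_toLp_sq]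
    assumption

/-- Density of smooth compactly supported right hand sides. By uniqueness, differences of solutions
obey the bound for the differences of the data, so solutions and derivatives are Cauchy. -/
theorem IsDichotomy.exists_isWeakSol (D : IsDichotomy q l κ B w f f' g g')
    (hq : ContDiff ℝ ∞ q) (p : L2) :
    ∃ u u₁ : L2, IsWeakSol (fun x => q x - l) u u₁ p ∧ ‖u‖ ≤ |2 * B ^ 2 * w⁻¹ * κ⁻¹| * ‖p‖ := by
  have hV : Continuous fun x => q x - l := hq.continuous.sub continuous_const
  set C := |2 * B ^ 2 * w⁻¹ * κ⁻¹| with hC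
  set T : Set L2 := {p | ∃ r : ℝ → ℂ, p =ᵐ[volume] r ∧ HasCompactSupport r ∧ ContDiff ℝ ∞ r}
  have hT : Dense T := Lp.dense_hasCompactSupport_contDiff (by norm_num)
  have hsol : ∀ p ∈ T, ∃ u u₁ : L2, IsWeakSol (fun x => q x - l) u u₁ p ∧
      ‖u‖ ≤ C * ‖p‖ ∧ ‖u₁‖ ≤ C * ‖p‖ := by
    rintro p ⟨r, hpr, hc, hr⟩
    have hm : MemLp r 2 (volume : Measure ℝ) := hr.continuous.memLp_of_hasCompactSupport hc
    have e : p = hm.toLp r := Lp.ext (hpr.trans hm.coeFn_toLp.symm)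
    rw [e]
    exact D.exists_isWeakSol_toLp hq hr.continuous hc hm
  have hsub : ∀ p ∈ T, ∀ p' ∈ T, p - p' ∈ T := by
    rintro p ⟨r, hpr, hc, hr⟩ p' ⟨r', hpr', hc', hr'⟩
    exact ⟨r - r', (Lp.coeFn_sub p p').trans (hpr.sub hpr'), hc.sub hc', hr.sub hr'⟩
  obtain ⟨P, hPT, hP⟩ := mem_closure_iff_seq_limit.1 (hT p)
  choose u u₁ hS hb hb' using fun n => hsol (P n) (hPT n)
  have hdiff : ∀ n m, ‖u n - u m‖ ≤ C * ‖P n - P m‖ ∧ ‖u₁ n - u₁ m‖ ≤ C * ‖P n - P m‖ := by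
    intro n m
    obtain ⟨v, v₁, S, b, b'⟩ := hsol _ (hsub _ (hPT n) _ (hPT m))
    have S' := ((hS n).sub hV (hS m)).sub hV S
    rw [sub_self] at S'
    have e := D.eq_zero_of_isWeakSol hq S'
    have S1 := S'.1
    rw [e] at S1
    rw [sub_eq_zero.1 e, sub_eq_zero.1 S1.eq_zero]
    exact ⟨b, b'⟩
  have hPc := hP.cauchySeq
  have hcauchy : ∀ v : ℕ → L2, (∀ n m, ‖v n - v m‖ ≤ C * ‖P n - P m‖) → CauchySeq v := by
    intro v hv
    rw [Metric.cauchySeq_iff] at hPc ⊢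
    intro ε hε
    have hC1 : 0 < C + 1 := by positivity
    obtain ⟨N, hN⟩ := hPc (ε / (C + 1)) (div_pos hε hC1)
    refine ⟨N, fun m hm n hn => ?_⟩
    have h1 := hN m hm n hn
    rw [dist_eq_norm, lt_div_iff₀ hC1] at h1
    rw [dist_eq_norm]
    have h2 := hv m n
    have h3 := norm_nonneg (P m - P n)
    nlinarith
  obtain ⟨v, hv⟩ := cauchySeq_tendsto_of_complete (hcauchy u fun n m => (hdiff n m).1)
  obtain ⟨v₁, hv₁⟩ := cauchySeq_tendsto_of_complete (hcauchy u₁ fun n m => (hdiff n m).2)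
  exact ⟨v, v₁, IsWeakSol.of_tendsto hV hS hv hv₁ hP,
    le_of_tendsto_of_tendsto' hv.norm (hP.norm.const_mul C) hb⟩

end

/-- `R` is a bounded everywhere defined two-sided inverse of `A - z`. -/
def IsResolvent {H : Type*} [NormedAddCommGroup H] [InnerProductSpace ℂ H] (A : H →ₗ.[ℂ] H) (z : ℂ)
    (R : H →L[ℂ] H) : Prop :=
  (∀ f : H, ∃ u : A.domain, (u : H) = R f ∧ A u - z • (u : H) = f) ∧
    ∀ u : A.domain, R (A u - z • (u : H)) = u

theorem notMem_unboundedSpectrum_iff {H : Type*} [NormedAddCommGroup H] [InnerProductSpace ℂ H]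
    (A : H →ₗ.[ℂ] H) (z : ℂ) : z ∉ unboundedSpectrum A ↔ ∃ R, IsResolvent A z R := by
  simp only [unboundedSpectrum, mem_ofPred_eq, not_not, IsResolvent]

/-- With `ζ = (z - l)⁻¹`, which is nonreal and so outside the spectrum of the self-adjoint `R`, the
resolvent at `z` is `ζ (ζ - R)⁻¹ R`. -/
theorem IsResolvent.exists_of_im_ne_zero {H : Type*} [NormedAddCommGroup H]
    [InnerProductSpace ℂ H] [CompleteSpace H] {A : H →ₗ.[ℂ] H} {l : ℝ} {R : H →L[ℂ] H}
    (hR : IsResolvent A l R) (hsa : IsSelfAdjoint R) {z : ℂ} (hz : z.im ≠ 0) :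
    ∃ R', IsResolvent A z R' := by
  have hne : z - l ≠ 0 := fun h => hz (by rw [sub_eq_zero.1 h, Complex.ofReal_im])
  have hζ : (z - l)⁻¹ ∉ spectrum ℂ R := fun hmem => by
    have h1 := congrArg Complex.im (hsa.mem_spectrum_eq_re hmem)
    rw [Complex.ofReal_im, Complex.inv_im] at h1
    have h2 : Complex.normSq (z - l) ≠ 0 := by simpa using hne
    rw [div_eq_zero_iff] at h1
    rcases h1 with h1 | h1
    · simp at h1; exact hz h1
    · exact h2 h1
  rw [spectrum.notMem_iff] at hζ
  obtain ⟨U, hU⟩ := hζ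
  set T : H →L[ℂ] H := ((U⁻¹ : (H →L[ℂ] H)ˣ) : H →L[ℂ] H) with hT
  have hUa : ∀ v : H, (U : H →L[ℂ] H) v = (z - l)⁻¹ • v - R v := fun v => by
    rw [hU]; simp [Algebra.algebraMap_eq_smul_one]
  have hUT : ∀ v : H, (z - l)⁻¹ • T v - R (T v) = v := fun v => by
    rw [← hUa, ← mul_apply_eq_comp, hT, U.mul_inv, one_apply_eq_self]
  have hTU : ∀ v : H, T ((z - l)⁻¹ • v - R v) = v := fun v => by
    rw [← hUa, ← mul_apply_eq_comp, hT, U.inv_mul, one_apply_eq_self]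
  refine ⟨(z - l)⁻¹ • (T * R), fun f => ?_, fun u => ?_⟩
  · set v := (z - l)⁻¹ • T (R f) with hv
    have hRv : R (f + (z - l) • v) = v := by
      have h1 := hUT (R f)
      rw [map_add, hv, smul_smul, mul_inv_cancel₀ hne, one_smul]
      rw [sub_eq_iff_eq_add] at h1
      exact h1.symm
    obtain ⟨u, hu, hAu⟩ := hR.1 (f + (z - l) • v)
    rw [hRv] at hu
    refine ⟨u, hu, ?_⟩
    rw [hu] at hAu ⊢
    rw [sub_eq_iff_eq_add] at hAu
    rw [hAu]
    module
  · have h1 : R (A u - z • (u : H)) = (u : H) - (z - l) • R u := by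
      rw [show A u - z • (u : H) = (A u - (l : ℂ) • (u : H)) - (z - l) • (u : H) by module, map_sub,
        map_smul, hR.2 u]
    rw [smul_apply, mul_apply_eq_comp, h1]
    have h2 : (u : H) - (z - l) • R u = (z - l) • ((z - l)⁻¹ • (u : H) - R u) := by
      rw [smul_sub, smul_smul, mul_inv_cancel₀ hne, one_smul]
    rw [h2, map_smul, hTU, smul_smul, inv_mul_cancel₀ hne, one_smul]

section

variable {q : ℝ → ℝ} {l κ B w Q : ℝ} {f f' g g' : ℝ → ℝ}

/-- Uniqueness makes the bounded solution map linear. Self-adjointness is checked against real test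
functions, where it is Green's identity. -/
theorem IsDichotomy.exists_resolvent (D : IsDichotomy q l κ B w f f' g g')
    (hq : ContDiff ℝ ∞ q) (hQ : ∀ x, |q x| ≤ Q) :
    ∃ R : L2 →L[ℂ] L2, IsResolvent (hillOperator q) l R ∧ IsSelfAdjoint R := by
  have hgr := fun u p => mem_hillGraph_iff hq.continuous hQ l u p
  have huniq : ∀ u v p : L2, (u, p + (l : ℂ) • u) ∈ hillGraph q →
      (v, p + (l : ℂ) • v) ∈ hillGraph q → u = v := fun u v p hu hv => by
    have h := (hillGraph q).sub_mem hu hv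
    rw [Prod.mk_sub_mk, show p + (l : ℂ) • u - (p + (l : ℂ) • v) = 0 + (l : ℂ) • (u - v) by module,
      hgr] at h
    obtain ⟨u₁, S⟩ := h
    exact sub_eq_zero.1 (D.eq_zero_of_isWeakSol hq S)
  choose S S₁ hS hSb using D.exists_isWeakSol hq
  have hSg : ∀ p, (S p, p + (l : ℂ) • S p) ∈ hillGraph q := fun p => (hgr _ _).2 ⟨S₁ p, hS p⟩
  let R₀ : L2 →ₗ[ℂ] L2 :=
    { toFun := S
      map_add' := fun p p' => by
        refine huniq _ _ (p + p') (hSg _) ?_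
        convert! (hillGraph q).add_mem (hSg p) (hSg p') using 1
        rw [Prod.mk_add_mk]
        congr 1
        module
      map_smul' := fun z p => by
        refine huniq _ _ (z • p) (hSg _) ?_
        convert! (hillGraph q).smul_mem z (hSg p) using 1
        rw [Prod.smul_mk, RingHom.id_apply]
        congr 1
        module }
  let R : L2 →L[ℂ] L2 := R₀.mkContinuous _ hSb
  have hRS : ∀ p, R p = S p := fun p => rfl
  refine ⟨R, ⟨fun p => ?_, fun u => ?_⟩, ?_⟩
  · have h := hSg p
    rw [← hillOperator_graph, LinearPMap.mem_graph_iff] at h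
    obtain ⟨u, hu, hAu⟩ := h
    refine ⟨u, hu, ?_⟩
    rw [hAu, hu]
    simp
  · refine huniq _ _ _ (hSg _) ?_
    rw [← hillOperator_graph, sub_add_cancel]
    exact (hillOperator q).mem_graph u
  · rw [ContinuousLinearMap.isSelfAdjoint_iff']
    ext1 p
    rw [← sub_eq_zero]
    refine eq_zero_of_testIntegral fun φ hφ hc => ?_
    obtain ⟨h, hm, v₁, hv, H⟩ := D.exists_real_green hq hφ hc
    have e1 : R ((memLp_ofReal hφ.continuous hc).toLp _) = hm.toLp _ :=
      huniq _ _ _ (hSg _) ((hgr _ _).2 ⟨v₁, hv⟩)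
    rw [testIntegral_sub hφ.continuous hc, hRS, H _ _ _ (hS p),
      ← inner_toLp_ofReal (memLp_ofReal hφ.continuous hc), ContinuousLinearMap.adjoint_inner_right,
      e1, inner_toLp_ofReal, sub_self]

end

end

end Lame

namespace Lame

/-! ### Bounded solutions and the spectrum -/

/-- `ψ` is a bounded nonzero solution of `-ψ'' + q ψ = l ψ`. -/
structure IsBoundedSol (q : ℝ → ℝ) (l M x₀ : ℝ) (ψ ψ' : ℝ → ℂ) : Prop where
  deriv : ∀ x, HasDerivAt ψ (ψ' x) x
  deriv' : ∀ x, HasDerivAt ψ' (((q x - l : ℝ) : ℂ) * ψ x) x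
  ne_zero : ψ x₀ ≠ 0
  bound : ∀ x, ‖ψ x‖ ≤ M
  bound' : ∀ x, ‖ψ' x‖ ≤ M

theorem exists_norm_le_of_norm_periodic {ψ : ℝ → ℂ} (h : Continuous ψ) {T : ℝ} (hT : T ≠ 0)
    (hp : ∀ x, ‖ψ (x + T)‖ = ‖ψ x‖) : ∃ M, ∀ x, ‖ψ x‖ ≤ M := by
  have hper : Function.Periodic (fun x => ‖ψ x‖) T := hp
  obtain ⟨B, hB⟩ := (hper.isBounded_of_continuous hT (by fun_prop)).bddAbove
  exact ⟨B, fun x => hB ⟨x, rfl⟩⟩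

/-- The multipliers `d ± i √(1 - d²)` lie on the unit circle, so a Floquet solution has periodic
modulus. The eigenvector `(σ, i √(1 - d²))` works unless `σ = 0`; then `s` itself is a Floquet
solution, with multiplier `d = ±1`. -/
theorem IsEvenPotential.exists_isBoundedSol {q : ℝ → ℝ} {K Q l : ℝ} (hq : IsEvenPotential q K Q)
    {c c' s s' : ℝ → ℝ} (F : IsFundamental q l c c' s s')
    (hd : |c K * s' K + c' K * s K| ≤ 1) : ∃ M x₀ ψ ψ', IsBoundedSol q l M x₀ ψ ψ' := by
  set d := c K * s' K + c' K * s K with hd_def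
  have hT : 2 * K ≠ 0 := by have := hq.K_pos; positivity
  have hd2 : 0 ≤ 1 - d ^ 2 := by
    have := pow_le_one₀ (abs_nonneg d) hd (n := 2)
    rw [sq_abs] at this; linarith
  have hdet : d ^ 2 - 1 = 2 * (s K * s' K) * (2 * (c K * c' K)) := by
    rw [hd_def]
    linear_combination (c K * s' K - c' K * s K + 1) * F.wronskian K
  set σ := 2 * (s K * s' K) with hσ
  have main : ∀ (a b : ℝ) (ρ : ℂ) (x₀ : ℝ), ‖ρ‖ = 1 →
      (∀ x, ((a * c (x + 2 * K) : ℝ) : ℂ) + (b * s (x + 2 * K) : ℝ) * Complex.I =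
        ρ * ((a * c x : ℝ) + (b * s x : ℝ) * Complex.I)) →
      (∀ x, ((a * c' (x + 2 * K) : ℝ) : ℂ) + (b * s' (x + 2 * K) : ℝ) * Complex.I =
        ρ * ((a * c' x : ℝ) + (b * s' x : ℝ) * Complex.I)) →
      ((a * c x₀ : ℝ) : ℂ) + (b * s x₀ : ℝ) * Complex.I ≠ 0 →
      ∃ M x₀ ψ ψ', IsBoundedSol q l M x₀ ψ ψ' := by
    intro a b ρ x₀ hρ h1 h2 h0
    have d1 : ∀ x, HasDerivAt (fun x => ((a * c x : ℝ) : ℂ) + (b * s x : ℝ) * Complex.I)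
        (((a * c' x : ℝ) : ℂ) + (b * s' x : ℝ) * Complex.I) x := fun x =>
      ((F.cos.deriv x).const_mul a).ofReal_comp.add
        (((F.sin.deriv x).const_mul b).ofReal_comp.mul_const _)
    have d2 : ∀ x, HasDerivAt (fun x => ((a * c' x : ℝ) : ℂ) + (b * s' x : ℝ) * Complex.I)
        (((q x - l : ℝ) : ℂ) * (((a * c x : ℝ) : ℂ) + (b * s x : ℝ) * Complex.I)) x := fun x => by
      convert! ((F.cos.deriv' x).const_mul a).ofReal_comp.add
        (((F.sin.deriv' x).const_mul b).ofReal_comp.mul_const _) using 1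
      push_cast
      ring
    obtain ⟨M, hM⟩ := exists_norm_le_of_norm_periodic
      (continuous_iff_continuousAt.2 fun x => (d1 x).continuousAt) hT
      (fun x => by rw [h1, norm_mul, hρ, one_mul])
    obtain ⟨M', hM'⟩ := exists_norm_le_of_norm_periodic
      (continuous_iff_continuousAt.2 fun x => (d2 x).continuousAt) hT
      (fun x => by rw [h2, norm_mul, hρ, one_mul])
    exact ⟨max M M', x₀, _, _, d1, d2, h0, fun x => (hM x).trans (le_max_left _ _),
      fun x => (hM' x).trans (le_max_right _ _)⟩
  have hfl : ∀ x, s (x + 2 * K) = σ * c x + d * s x ∧ s' (x + 2 * K) = σ * c' x + d * s' x :=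
    fun x => by
      rw [F.sin_add hq, F.sin_add' hq, ← hd_def, ← hσ]
      constructor <;> ring
  have hfl' : ∀ x, c (x + 2 * K) = d * c x + 2 * (c K * c' K) * s x ∧
      c' (x + 2 * K) = d * c' x + 2 * (c K * c' K) * s' x := fun x => by
    rw [F.cos_add hq, F.cos_add' hq, ← hd_def]
    constructor <;> ring
  by_cases h0 : σ = 0
  · have hd1 : d ^ 2 = 1 := by rw [h0, zero_mul] at hdet; linarith
    obtain ⟨x₀, hx₀⟩ : ∃ x, s x ≠ 0 := by
      by_contra! h
      have h1 : s = fun _ => 0 := funext h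
      have h2 := F.sin.deriv 0
      rw [h1] at h2
      have := h2.unique (hasDerivAt_const 0 (0 : ℝ))
      rw [F.sin_zero'] at this
      exact one_ne_zero this
    refine main 0 1 d x₀ ?_ (fun x => ?_) (fun x => ?_) ?_
    · rw [Complex.norm_real, Real.norm_eq_abs, ← sq_eq_sq₀ (abs_nonneg _) zero_le_one, sq_abs, hd1,
        one_pow]
    · rw [(hfl x).1, h0]; push_cast; ring
    · rw [(hfl x).2, h0]; push_cast; ring
    · simpa using hx₀
  · set δ := Real.sqrt (1 - d ^ 2) with hδ
    have hδ2 : δ ^ 2 = 1 - d ^ 2 := Real.sq_sqrt hd2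
    have hδc : σ * (2 * (c K * c' K)) + δ ^ 2 = 0 := by rw [hδ2, ← hdet]; ring
    have hδc' : (σ : ℂ) * (2 * (c K * c' K)) + δ ^ 2 = 0 := by exact_mod_cast hδc
    refine main σ δ (d + δ * Complex.I) 0 ?_ (fun x => ?_) (fun x => ?_) ?_
    · rw [Complex.norm_add_mul_I, hδ2]
      simp
    · rw [(hfl x).1, (hfl' x).1]
      push_cast
      linear_combination (s x : ℂ) * hδc' - (δ : ℂ) ^ 2 * s x * Complex.I_sq
    · rw [(hfl x).2, (hfl' x).2]
      push_cast
      linear_combination (s' x : ℂ) * hδc' - (δ : ℂ) ^ 2 * s' x * Complex.I_sq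
    · rw [F.cos_zero, F.sin_zero]
      simpa using h0

/-- A Weyl sequence: a resolvent would force `χₙ ψ` to tend to `0` in `L²`, since its image under
the operator minus `l` does, yet its norms stay above a positive constant. -/
theorem IsBoundedSol.mem_unboundedSpectrum {q : ℝ → ℝ} {l M x₀ Q : ℝ} {ψ ψ' : ℝ → ℂ}
    (h : IsBoundedSol q l M x₀ ψ ψ') (hq : ContDiff ℝ ∞ q) (hQ : ∀ x, |q x| ≤ Q) :
    (l : ℂ) ∈ unboundedSpectrum (hillOperator q) := by
  by_contra hmem
  obtain ⟨R, hR⟩ := (notMem_unboundedSpectrum_iff _ _).1 hmem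
  obtain ⟨C, hC, hcut⟩ := exists_isCutoff
  have hN : ∀ n : ℕ, (1 : ℝ) ≤ n + 1 := fun n => by
    have : (0 : ℝ) ≤ n := n.cast_nonneg
    linarith
  have hψc : Continuous ψ := continuous_iff_continuousAt.2 fun x => (h.deriv x).continuousAt
  have hψc' : Continuous ψ' := continuous_iff_continuousAt.2 fun x => (h.deriv' x).continuousAt
  choose χ χ' χ'' hχ using fun n : ℕ => hcut (n + 1) (hN n)
  have hχc : ∀ n, Continuous (χ n) := fun n => (hχ n).smooth.continuous
  have hχc' : ∀ n, Continuous (χ' n) := fun n =>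
    continuous_iff_continuousAt.2 fun x => ((hχ n).deriv' x).continuousAt
  have hχc'' : ∀ n, Continuous (χ'' n) := fun n => (hχ n).continuous''
  have hcs : ∀ n, HasCompactSupport fun x => (χ n x : ℂ) * ψ x := fun n =>
    HasCompactSupport.mul_right ((hχ n).hasCompactSupport.comp_left Complex.ofReal_zero)
  -- The error `χ'' ψ + 2 χ' ψ'` is at most `3 C M / N` on an interval of length `4 N`, with `N = n
  -- + 1`; hence the `36`.
  have hbound : ∀ n, ∫ x, ‖(χ n x : ℂ) * ψ x‖ ^ 2 ≤
      ‖R‖ ^ 2 * (36 * C ^ 2 * M ^ 2 / ((n : ℝ) + 1)) := by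
    intro n
    have hn : (0 : ℝ) < (n : ℝ) + 1 := one_pos.trans_le (hN n)
    set u : ℝ → ℂ := fun x => (χ n x : ℂ) * ψ x with hu
    set u₁ : ℝ → ℂ := fun x => (χ' n x : ℂ) * ψ x + (χ n x : ℂ) * ψ' x with hu₁
    set p : ℝ → ℂ := fun x => -((χ'' n x : ℂ) * ψ x + 2 * ((χ' n x : ℂ) * ψ' x)) with hp
    have hp0 : ∀ x, 2 * ((n : ℝ) + 1) < |x| → p x = 0 := fun x hx => by
      simp [hp, (hχ n).eq_zero' x hx, (hχ n).eq_zero'' x hx]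
    have hu₁0 : HasCompactSupport u₁ := hasCompactSupport_of_eq_zero
        (M := 2 * ((n : ℝ) + 1)) fun x hx => by
      simp [hu₁, (hχ n).eq_zero' x hx, (hχ n).eq_zero x hx]
    have hpc : Continuous p := by fun_prop
    have m0 : MemLp u 2 (volume : Measure ℝ) :=
      Continuous.memLp_of_hasCompactSupport (by fun_prop) (hcs n)
    have m1 : MemLp u₁ 2 (volume : Measure ℝ) :=
      Continuous.memLp_of_hasCompactSupport (by fun_prop) hu₁0
    have m2 : MemLp p 2 (volume : Measure ℝ) :=
      hpc.memLp_of_hasCompactSupport (hasCompactSupport_of_eq_zero hp0)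
    have S : IsWeakSol (fun x => q x - l) (m0.toLp u) (m1.toLp u₁) (m2.toLp p) := by
      refine isWeakSol_toLp (V := fun x => q x - l) (hq.continuous.sub continuous_const)
        (fun x => ?_) (fun x => ?_) hpc _ _ _
      · exact ((hχ n).deriv x).ofReal_comp.mul (h.deriv x)
      · convert! ((((hχ n).deriv' x).ofReal_comp.mul (h.deriv x)).add
          (((hχ n).deriv x).ofReal_comp.mul (h.deriv' x))) using 1
        simp only [hu, hp]
        ring
    have hmem := (mem_hillGraph_iff hq.continuous hQ l _ _).2 ⟨_, S⟩
    rw [← hillOperator_graph, LinearPMap.mem_graph_iff] at hmem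
    obtain ⟨v, hv, hAv⟩ := hmem
    have hRv := hR.2 v
    simp only at hv hAv
    rw [hAv, hv, add_sub_cancel_right] at hRv
    have h1 : ‖m0.toLp u‖ ≤ ‖R‖ * ‖m2.toLp p‖ := by rw [← hRv]; exact R.le_opNorm _
    have h2 := pow_le_pow_left₀ (norm_nonneg _) h1 2
    rw [mul_pow, norm_toLp_sq, norm_toLp_sq] at h2
    refine h2.trans (mul_le_mul_of_nonneg_left ?_ (sq_nonneg _))
    have hpb : ∀ x, ‖p x‖ ≤ 3 * (C / ((n : ℝ) + 1)) * M := fun x => by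
      have hCn : 0 ≤ C / ((n : ℝ) + 1) := by positivity
      rw [hp, norm_neg]
      refine (norm_add_le _ _).trans ?_
      rw [norm_mul, norm_mul, norm_mul, Complex.norm_real, Complex.norm_real, Complex.norm_ofNat]
      have e1 := mul_le_mul ((hχ n).bound'' x) (h.bound x) (norm_nonneg _) hCn
      have e2 := mul_le_mul ((hχ n).bound' x) (h.bound' x) (norm_nonneg _) hCn
      rw [← Real.norm_eq_abs] at e1 e2
      linarith
    have e3 : ∫ x, ‖p x‖ ^ 2 = ∫ x in Icc (-(2 * ((n : ℝ) + 1))) (2 * ((n : ℝ) + 1)), ‖p x‖ ^ 2 := by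
      refine (setIntegral_eq_integral_of_forall_compl_eq_zero fun x hx => ?_).symm
      rw [hp0 x, norm_zero, zero_pow two_ne_zero]
      by_contra hle
      exact hx (abs_le.1 (not_lt.1 hle))
    have e4 := norm_setIntegral_le_of_norm_le_const (μ := volume) (f := fun x => ‖p x‖ ^ 2)
      (s := Icc (-(2 * ((n : ℝ) + 1))) (2 * ((n : ℝ) + 1)))
      (C := (3 * (C / ((n : ℝ) + 1)) * M) ^ 2) (by simp) (fun x _ => by
        rw [norm_pow, norm_norm]
        exact pow_le_pow_left₀ (norm_nonneg _) (hpb x) 2)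
    rw [e3]
    refine (le_abs_self _).trans (e4.trans_eq ?_)
    rw [Real.volume_real_Icc_of_le (by linarith)]
    field_simp
    ring
  obtain ⟨n₀, hn₀⟩ := exists_nat_ge |x₀|
  have hpos : 0 < ∫ x, ‖(χ n₀ x : ℂ) * ψ x‖ ^ 2 := by
    refine Continuous.integral_pos_of_hasCompactSupport_nonneg_nonzero (x := x₀) (by fun_prop)
      ?_ (fun x => sq_nonneg _) ?_
    · exact (hcs n₀).comp_left (g := fun z : ℂ => ‖z‖ ^ 2) (by simp)
    · rw [(hχ n₀).eq_one x₀ (by linarith)]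
      simpa using h.ne_zero
  -- From this index on `χₙ` equals `1` on `[-2 (n₀ + 1), 2 (n₀ + 1)]`, outside which `χ n₀`
  -- vanishes.
  have hmono : ∀ n : ℕ, 2 * n₀ + 2 ≤ n →
      ∫ x, ‖(χ n₀ x : ℂ) * ψ x‖ ^ 2 ≤ ∫ x, ‖(χ n x : ℂ) * ψ x‖ ^ 2 := fun n hn => by
    have hint : ∀ k, Integrable fun x => ‖(χ k x : ℂ) * ψ x‖ ^ 2 := fun k =>
      Continuous.integrable_of_hasCompactSupport (by fun_prop)
        ((hcs k).comp_left (g := fun z : ℂ => ‖z‖ ^ 2) (by simp))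
    refine integral_mono (hint _) (hint _) fun x => ?_
    simp only [norm_mul, Complex.norm_real, Real.norm_eq_abs, mul_pow, sq_abs]
    refine mul_le_mul_of_nonneg_right ?_ (sq_nonneg _)
    refine pow_le_pow_left₀ ((hχ n₀).nonneg x) ?_ 2
    have hn' : 2 * (n₀ : ℝ) + 2 ≤ n := by exact_mod_cast hn
    rcases le_or_gt |x| (2 * ((n₀ : ℝ) + 1)) with hx | hx
    · rw [(hχ n).eq_one x (by linarith)]
      exact (hχ n₀).le_one x
    · rw [(hχ n₀).eq_zero x hx]
      exact (hχ n).nonneg x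
  have hlim : Tendsto (fun n : ℕ => ‖R‖ ^ 2 * (36 * C ^ 2 * M ^ 2 / ((n : ℝ) + 1))) atTop
      (𝓝 (‖R‖ ^ 2 * 0)) :=
    (tendsto_const_nhds.div_atTop
      (tendsto_atTop_add_const_right _ _ tendsto_natCast_atTop_atTop)).const_mul _
  rw [mul_zero] at hlim
  have := ge_of_tendsto hlim (eventually_atTop.2
    ⟨2 * n₀ + 2, fun n hn => (hmono n hn).trans (hbound n)⟩)
  linarith

/-- The spectrum of the Hill operator of an even potential is the half line from the
lowest periodic eigenvalue on, without the gaps. -/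
theorem IsEvenPotential.unboundedSpectrum_eq {q : ℝ → ℝ} {K Q : ℝ} (hq : IsEvenPotential q K Q) :
    unboundedSpectrum (hillOperator q) = Complex.ofReal '' {l | cosEigenvalue q K 0 ≤ l ∧
      ∀ j, l ∉ Ioo (min (cosEigenvalue q K (j + 1)) (sinEigenvalue q K j))
        (max (cosEigenvalue q K (j + 1)) (sinEigenvalue q K j))} := by
  have hQ : ∀ x, |q x| ≤ Q := fun x => by rw [abs_of_nonneg (hq.nonneg x)]; exact hq.le x
  have hres : ∀ l : ℝ, ¬ (cosEigenvalue q K 0 ≤ l ∧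
      ∀ j, l ∉ Ioo (min (cosEigenvalue q K (j + 1)) (sinEigenvalue q K j))
        (max (cosEigenvalue q K (j + 1)) (sinEigenvalue q K j))) →
      ∃ R, IsResolvent (hillOperator q) l R ∧ IsSelfAdjoint R := fun l hl => by
    have F := hq.isFundamental l
    rw [← hq.abs_discr_le_one_iff F, not_le] at hl
    obtain ⟨κ, B, w, f, f', g, g', D⟩ := hq.exists_dichotomy F hl
    exact D.exists_resolvent hq.smooth hQ
  ext z
  constructor
  · intro hz
    by_cases him : z.im = 0
    · have hzr : (z.re : ℂ) = z := Complex.ext rfl (by simp [him])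
      refine ⟨z.re, ?_, hzr⟩
      by_contra hcon
      obtain ⟨R, hR, -⟩ := hres z.re hcon
      rw [hzr] at hR
      exact (notMem_unboundedSpectrum_iff _ _).2 ⟨R, hR⟩ hz
    -- Any real point below the lowest eigenvalue serves as base point for the nonreal ones.
    · obtain ⟨R, hR, hsa⟩ := hres (cosEigenvalue q K 0 - 1) (fun h => by linarith [h.1])
      exact absurd hz ((notMem_unboundedSpectrum_iff _ _).2 (hR.exists_of_im_ne_zero hsa him))
  · rintro ⟨l, hl, rfl⟩
    have F := hq.isFundamental l
    obtain ⟨M, x₀, ψ, ψ', h⟩ := hq.exists_isBoundedSol F ((hq.abs_discr_le_one_iff F).2 hl)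
    exact h.mem_unboundedSpectrum hq.smooth hQ

end Lame

namespace Lame

/-! ### Coexistence -/

theorem IsFundamental.finite_floquetSolutions {q : ℝ → ℝ} {l : ℝ} {c c' s s' : ℝ → ℝ}
    (F : IsFundamental q l c c' s s') (T σ : ℝ) : Module.Finite ℝ (floquetSolutions q T σ l) := by
  have hle : floquetSolutions q T σ l ≤ Submodule.span ℝ {c, s} := fun ψ hψ => by
    have h := F.eq_lincomb (IsSol.of_mem_floquetSolutions hψ)
    exact Submodule.mem_span_pair.2 ⟨ψ 0, deriv ψ 0, by ext x; simp [h x]⟩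
  have : FiniteDimensional ℝ (Submodule.span ℝ ({c, s} : Set (ℝ → ℝ))) :=
    FiniteDimensional.span_of_finite ℝ (by simp)
  exact Submodule.finiteDimensional_of_le hle

/-- Dimension two requires both an even and an odd eigenfunction. Since `cosEigenvalue j <
sinEigenvalue j < cosEigenvalue (j + 2)`, the two indices can only be those of one closed gap. -/
theorem IsEvenPotential.exists_of_isCoexistencePoint {q : ℝ → ℝ} {K Q μ : ℝ}
    (hq : IsEvenPotential q K Q) (h : IsCoexistencePoint q (2 * K) μ) :
    ∃ j, cosEigenvalue q K (j + 1) = μ ∧ sinEigenvalue q K j = μ := by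
  classical
  have hmono : StrictMono (cosEigenvalue q K) := strictMono_nat_of_lt_succ hq.cosEigenvalue_lt_succ
  obtain ⟨i, j, hi, hj⟩ : ∃ i j, cosEigenvalue q K i = μ ∧ sinEigenvalue q K j = μ := by
    obtain ⟨σ, hσ, ψ₁, h₁, ψ₂, h₂, hli⟩ := h
    have hfin := (hq.isFundamental μ).finite_floquetSolutions (2 * K) σ
    have hli' : LinearIndependent ℝ
        ![(⟨ψ₁, h₁⟩ : floquetSolutions q (2 * K) σ μ), ⟨ψ₂, h₂⟩] := by
      refine LinearIndependent.of_comp (floquetSolutions q (2 * K) σ μ).subtype ?_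
      convert! hli using 1
      ext i
      fin_cases i <;> rfl
    have h2 := hli'.fintype_card_le_finrank
    rw [Fintype.card_fin] at h2
    rcases hσ with rfl | rfl
    · rw [hq.finrank_periodic] at h2
      split_ifs at h2 with a b
      · exact ⟨_, _, a.choose_spec, b.choose_spec⟩
      all_goals omega
    · rw [hq.finrank_antiperiodic] at h2
      split_ifs at h2 with a b
      · exact ⟨_, _, a.choose_spec, b.choose_spec⟩
      all_goals omega
  have h1 : ¬ i ≤ j := fun hle => by
    have := hmono.monotone hle
    have := hq.cosEigenvalue_lt_sinEigenvalue j
    linarith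
  have h2 : ¬ j + 2 ≤ i := fun hle => by
    have := hmono.monotone hle
    have := hq.sinEigenvalue_lt_cosEigenvalue j
    linarith
  obtain rfl : i = j + 1 := by omega
  exact ⟨j, hi, hj⟩

end Lame

/-! ### The spectrum, gaps and coexistence points of the Lamé operator. -/

theorem theorem2p1 (m : ℕ) (k : ℝ) (hk0 : 0 < k) (hk1 : k < 1) :
    ∃ a b : ℕ → ℝ,
      Lame.IsHillSequence (Lame.lamePotential m k) (2 * Lame.ellipticK k) a b ∧
      Lame.unboundedSpectrum (Lame.lameOperator m k) =
        Complex.ofReal '' (Set.Ici (a 0) \ ⋃ j : ℕ, ⋃ _ : 1 ≤ j, Lame.spectralGap a b j) ∧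
      (∀ j : ℕ, 1 ≤ j → ((Lame.spectralGap a b j).Nonempty ↔ j ≤ m)) ∧
      ∀ μ : ℝ, Lame.IsCoexistencePoint (Lame.lamePotential m k) (2 * Lame.ellipticK k) μ →
        μ ∈ Lame.infiniteBand (Lame.unboundedSpectrum (Lame.lameOperator m k)) := by
  have hq := Lame.isEvenPotential_lamePotential hk0 hk1 m
  have hspec := hq.unboundedSpectrum_eq
  set q := Lame.lamePotential m k with hq_def
  set K := Lame.ellipticK k with hK_def
  refine ⟨Lame.periodicEigenvalue q K, Lame.antiperiodicEigenvalue q K, hq.isHillSequence, ?_,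
    fun j hj => ?_, fun μ hμ y hy => ?_⟩
  · rw [Lame.lameOperator, hspec]
    congr 1
    ext l
    simp only [mem_ofPred_eq, Set.mem_sdiff, mem_Ici, mem_iUnion, not_exists]
    refine and_congr Iff.rfl ⟨fun h j hj => ?_, fun h j => ?_⟩
    · obtain ⟨i, rfl⟩ := Nat.exists_eq_add_of_le' hj
      rw [Lame.IsEvenPotential.spectralGap_eq]
      exact h i
    · have := h (j + 1) (Nat.le_add_left 1 j)
      rwa [Lame.IsEvenPotential.spectralGap_eq] at this
  · obtain ⟨i, rfl⟩ := Nat.exists_eq_add_of_le' hj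
    rw [Lame.IsEvenPotential.spectralGap_eq, nonempty_Ioo, min_lt_max]
    exact ⟨Lame.le_of_cosEigenvalue_ne_sinEigenvalue hk0 hk1,
      Lame.cosEigenvalue_ne_sinEigenvalue hk0 hk1⟩
  · rw [Lame.lameOperator, hspec]
    obtain ⟨j, hc, hs⟩ := hq.exists_of_isCoexistencePoint hμ
    have hmono : StrictMono (Lame.cosEigenvalue q K) :=
      strictMono_nat_of_lt_succ hq.cosEigenvalue_lt_succ
    have hmono' : StrictMono (Lame.sinEigenvalue q K) :=
      strictMono_nat_of_lt_succ hq.sinEigenvalue_lt_succ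
    have hjm : m < j + 1 := not_le.1 fun hle =>
      Lame.cosEigenvalue_ne_sinEigenvalue hk0 hk1 hle (hc.trans hs.symm)
    refine ⟨y, ⟨?_, fun i hi => ?_⟩, rfl⟩
    · exact ((hmono.monotone (Nat.zero_le _)).trans_eq hc).trans hy
    -- A gap containing `y` is open, so its index is at most `m < j + 1`; both its edges are then at
    -- most `μ ≤ y`.
    · have hne := min_lt_max.1 (hi.1.trans hi.2)
      have him := Lame.le_of_cosEigenvalue_ne_sinEigenvalue hk0 hk1 hne
      have h1 := hmono.monotone (show i + 1 ≤ j + 1 by omega)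
      have h2 := hmono'.monotone (show i ≤ j by omega)
      exact absurd hi.2 (not_lt.2 ((max_le (h1.trans_eq hc) (h2.trans_eq hs)).trans hy))
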